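/- Let $(E,[\![\cdot,\cdot]\!],\rho)$ be a (smooth, real) Lie algebroid of rank $m$ over a smooth $n$-manifold $Q$, and let $\pi\colon E\times\mathbb R\to Q$ be the map $\pi(b_q,s)=q$. **Setting.** The prolongation $\mathcal T^E(E\times\mathbb R)\to E\times\mathbb R$ is the vector bundle of rank $2m+1$ with fibres $$\mathcal T^E(E\times\mathbb R)_{(b_q,s)}=\{(a_q,v)\in E_q\times T_{(b_q,s)}(E\times\mathbb R)\;:\;\rho(a_q)=T\pi(v)\}.$$ It is a Lie algebroid with anchor $\rho^\pi(a_q,v)=v$ and with the bracket whose second component is the Lie bracket of vector fields and whose first component is, for $Z=(\sum_\alpha a^\alpha e_\alpha,v)$ and $W=(\sum_\alpha b^\alpha e_\alpha,w)$ in a local frame $(e_\alpha)$ of $E$, with functions $a^\alpha,b^\alpha$ on $E\times\mathbb R$, equal to $\sum_\alpha (v(b^\alpha)-w(a^\alpha))e_\alpha+\sum_{\alpha,\beta}a^\alpha b^\beta[\![e_\alpha,e_\beta]\!]$. For a function $f$ on $E\times\mathbb R$ and a $1$-section $\eta$ of the prolongation (a section of its dual), put $df(Z)=\rho^\pi(Z)(f)$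 and $d\eta(Z,W)=\rho^\pi(Z)(\eta(W))-\rho^\pi(W)(\eta(Z))-\eta([Z,W])$. For $a\in E_q$ the vertical lift to $p=(b,s)\in E_q\times\mathbb R$ is $a^{\mathbf V}=(0,\frac{d}{dt}|_{t=0}(b+ta,s))$. Let $S(a,v)=a^{\mathbf V}$ be the vertical endomorphism and $\Delta(b,s)=b^{\mathbf V}$ the Liouville section. A section $\Gamma$ of the prolongation is a SODE if $S(\Gamma)=\Delta$; an integral curve of $\Gamma$ is an integral curve of the vector field $\rho^\pi(\Gamma)$ on $E\times\mathbb R$. For a smooth function $L\colon E\times\mathbb R\to\mathbb R$ put $\mathcal V^s=ds$, $\Theta_L=dL\circ S$, $\eta_L=\mathcal V^s-\Theta_L$ and $E_L=\rho^\pi(\Delta)(L)-L$. The function $L$ is regular if, for linear fibre coordinates $y^\alpha$ of $E$, the matrix $\left(\partial^2L/\partial y^\alpha\partial y^\beta\right)$ is non-singular at every point. **Theorem (Herglotz equations on Lie algebroids).** Let $L\colon E\times\mathbb R\to\mathbb R$ be a regular smooth Lagrangian. Then $\eta_L$ is a contact section of $\mathcal T^E(E\times\mathbb R)$: $\eta_L\wedge(d\eta_L)^m\neq0$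 everywhere. There is a unique (Reeb) section $\mathcal R_L$ of the prolongation with $i_{\mathcal R_L}d\eta_L=0$ and $i_{\mathcal R_L}\eta_L=1$, and a unique section $\Gamma_L$ of the prolongation with $$i_{\Gamma_L}\eta_L=-E_L,\qquad i_{\Gamma_L}d\eta_L=dE_L-\rho^\pi(\mathcal R_L)(E_L)\,\eta_L .$$ Moreover: 1. $\Gamma_L$ is a SODE. 2. Let $(q^i)$ be local coordinates of $Q$ and $(e_\alpha)$ a local frame of $E$, both on an open set $U\subseteq Q$, let $(q^i,y^\alpha,s)$ be the induced coordinates on $\pi^{-1}(U)$, and let $\rho^i_\alpha$, $\mathcal C^\gamma_{\alpha\beta}$ be the structure functions, $\rho(e_\alpha)=\sum_i\rho^i_\alpha\,\partial/\partial q^i$ and $[\![e_\alpha,e_\beta]\!]=\sum_\gamma\mathcal C^\gamma_{\alpha\beta}e_\gamma$. If $\widetilde c\colon I\subseteq\mathbb R\to E\times\mathbb R$ is an integral curve of $\Gamma_L$, then, wherever $\widetilde c(t)=(q^i(t),y^\alpha(t),s(t))$ lies over $U$, it satisfies the Herglotz equations $$\frac{d}{dt}\left(\frac{\partial L}{\partial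 y^\alpha}(\widetilde c(t))\right)=\sum_i\rho^i_\alpha\frac{\partial L}{\partial q^i}-\sum_{\beta,\gamma}y^\beta\,\mathcal C^\gamma_{\alpha\beta}\frac{\partial L}{\partial y^\gamma}+\frac{\partial L}{\partial y^\alpha}\frac{\partial L}{\partial s},\qquad \frac{dq^i}{dt}=\sum_\alpha y^\alpha\rho^i_\alpha,\qquad \frac{ds}{dt}=L(\widetilde c(t)),$$ for $i=1,\dots,n$ and $\alpha=1,\dots,m$, where the right-hand sides are evaluated along $\widetilde c(t)$. -/

import Mathlib

open scoped Bundle Manifold ContDiff Topology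

set_option linter.unusedSectionVars false

noncomputable section

namespace HerglotzAlgebroid

open Bundle VectorField Set

/-! Auxiliary facts on derivatives of functions along vector fields. -/

lemma mvfderiv_vec {V : Type*} [NormedAddCommGroup V] [NormedSpace ℝ V] (g : V → ℝ) (y u : V) :
    mvfderiv 𝓘(ℝ, V) g y u = fderiv ℝ g y u := by
  have : mfderiv 𝓘(ℝ, V) 𝓘(ℝ, ℝ) g y = fderiv ℝ g y := mfderiv_eq_fderiv
  exact congrArg (fun T => T u) this

section LieDerivative

variable {V : Type*} [NormedAddCommGroup V] [NormedSpace ℝ V] [CompleteSpace V]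
  {H : Type*} [TopologicalSpace H] {I : ModelWithCorners ℝ V H} [I.Boundaryless]
  {M : Type*} [TopologicalSpace M] [ChartedSpace H M] [IsManifold I ∞ M]

/-- `[X, Y] f = X (Y f) - Y (X f)` on a manifold. -/
lemma mv_lie (f : M → ℝ) (hf : ContMDiff I 𝓘(ℝ, ℝ) ∞ f)
    (X Y : ∀ x : M, TangentSpace I x) (x : M)
    (hX : MDifferentiableAt I I.tangent (fun y => (⟨y, X y⟩ : TangentBundle I M)) x)
    (hY : MDifferentiableAt I I.tangent (fun y => (⟨y, Y y⟩ : TangentBundle I M)) x)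
    (hXf : MDifferentiableAt I 𝓘(ℝ, ℝ) (fun y => mvfderiv I f y (X y)) x)
    (hYf : MDifferentiableAt I 𝓘(ℝ, ℝ) (fun y => mvfderiv I f y (Y y)) x) :
    mvfderiv I f x (mlieBracket I X Y x) =
      mvfderiv I (fun y => mvfderiv I f y (Y y)) x (X x) -
      mvfderiv I (fun y => mvfderiv I f y (X y)) x (Y x) := by
  have h2i : minSmoothness ℝ 2 ≤ (∞ : WithTop ℕ∞) := by
    rw [minSmoothness_of_isRCLikeNormedField]; exact ENat.LEInfty.out
  have hM2 : IsManifold I (minSmoothness ℝ 2) M := IsManifold.of_le (n := ∞) h2i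
  have hM3 : IsManifold I 2 M := inferInstance
  set φ := extChartAt I x
  have hfd : MDifferentiable I 𝓘(ℝ, ℝ) f := hf.mdifferentiable (by simp)
  let X' : V → V := mpullback 𝓘(ℝ, V) I φ.symm X
  let Y' : V → V := mpullback 𝓘(ℝ, V) I φ.symm Y
  have hopen : IsOpen φ.target := isOpen_extChartAt_target x
  have hxt : φ x ∈ φ.target := mem_extChartAt_target x
  have hsm : ∀ y ∈ φ.target, ContMDiffAt 𝓘(ℝ, V) I ∞ φ.symm y := fun y hy =>
    (contMDiffOn_extChartAt_symm x).contMDiffAt (hopen.mem_nhds hy)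
  have hsd : ∀ y ∈ φ.target, MDifferentiableAt 𝓘(ℝ, V) I φ.symm y := fun y hy =>
    (hsm y hy).mdifferentiableAt (by simp)
  have hinv : ∀ y ∈ φ.target, (mfderiv 𝓘(ℝ, V) I φ.symm y).IsInvertible := by
    intro y hy
    have := isInvertible_mfderivWithin_extChartAt_symm (I := I) (x := x) hy
    rwa [I.range_eq_univ, mfderivWithin_univ] at this
  have hxx : φ.symm (φ x) = x := extChartAt_to_inv x
  have key : ∀ (g : M → ℝ) (Z : ∀ x : M, TangentSpace I x) (y : V), y ∈ φ.target →
      MDifferentiableAt I 𝓘(ℝ, ℝ) g (φ.symm y) →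
      fderiv ℝ (g ∘ φ.symm) y (mpullback 𝓘(ℝ, V) I φ.symm Z y) =
        mvfderiv I g (φ.symm y) (Z (φ.symm y)) := by
    intro g Z y hy hg
    have h1 := mvfderiv_comp_apply y hg (hsd y hy) (mpullback 𝓘(ℝ, V) I φ.symm Z y)
    have h2 : mfderiv 𝓘(ℝ, V) I φ.symm y (mpullback 𝓘(ℝ, V) I φ.symm Z y) = Z (φ.symm y) := by
      rw [mpullback_apply]
      exact (hinv y hy).self_apply_inverse _
    rw [h2] at h1
    rw [← h1]
    exact (mvfderiv_vec _ _ _).symm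
  have hX0 := hX
  have hY0 := hY
  have hXf0 := hXf
  have hYf0 := hYf
  rw [← hxx] at hX0 hY0 hXf0 hYf0
  have hdX : DifferentiableAt ℝ X' (φ x) := by
    have := (mdifferentiableWithinAt_univ.mpr hX).differentiableWithinAt_mpullbackWithin_vectorField
    rw [preimage_univ, univ_inter, I.range_eq_univ, mpullbackWithin_univ] at this
    exact differentiableWithinAt_univ.mp this
  have hdY : DifferentiableAt ℝ Y' (φ x) := by
    have := (mdifferentiableWithinAt_univ.mpr hY).differentiableWithinAt_mpullbackWithin_vectorField
    rw [preimage_univ, univ_inter, I.range_eq_univ, mpullbackWithin_univ] at this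
    exact differentiableWithinAt_univ.mp this
  have hfc : ContDiffAt ℝ ∞ (f ∘ φ.symm) (φ x) :=
    (ContMDiffAt.comp (φ x) (hf.contMDiffAt) (hsm _ hxt)).contDiffAt
  have h := fderiv_apply_lieBracket (V := X') (W := Y') hfc h2i hdY hdX
  have e1 : mpullback 𝓘(ℝ, V) I φ.symm (mlieBracket I X Y) (φ x) = lieBracket ℝ X' Y' (φ x) := by
    rw [mpullback_mlieBracket hX0 hY0 (hsm _ hxt) h2i]
    rw [← mlieBracketWithin_univ, mlieBracketWithin_eq_lieBracketWithin]
    exact congrFun (lieBracketWithin_univ (V := X') (W := Y')) (φ x)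
  have e2 : ∀ Z : ∀ x : M, TangentSpace I x, (fun y => fderiv ℝ (f ∘ φ.symm) y (mpullback 𝓘(ℝ, V) I φ.symm Z y)) =ᶠ[𝓝 (φ x)]
      (fun y => mvfderiv I f y (Z y)) ∘ φ.symm := fun Z => by
    filter_upwards [hopen.mem_nhds hxt] with y hy
    exact key f Z y hy (hfd _)
  rw [(e2 Y).fderiv_eq, (e2 X).fderiv_eq, ← e1, key _ _ _ hxt (hfd _), key _ _ _ hxt hYf0, key _ _ _ hxt hXf0] at h
  rwa [hxx] at h

end LieDerivative

section Smooth
variable {V : Type*} [NormedAddCommGroup V] [NormedSpace ℝ V]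
  {H : Type*} [TopologicalSpace H] {I : ModelWithCorners ℝ V H}
  {M : Type*} [TopologicalSpace M] [ChartedSpace H M] [IsManifold I ∞ M]

lemma contMDiff_mvfderiv_apply {f : M → ℝ} (hf : ContMDiff I 𝓘(ℝ, ℝ) ∞ f)
    {X : ∀ x : M, TangentSpace I x}
    (hX : ContMDiff I I.tangent ∞ (fun y => (⟨y, X y⟩ : TangentBundle I M))) :
    ContMDiff I 𝓘(ℝ, ℝ) ∞ (fun y => mvfderiv I f y (X y)) := by
  have h1 : ContMDiff I.tangent 𝓘(ℝ, ℝ).tangent ∞ (tangentMap I 𝓘(ℝ, ℝ) f) :=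
    hf.contMDiff_tangentMap (by simp)
  exact (contMDiff_snd_tangentBundle_modelSpace ℝ 𝓘(ℝ, ℝ)).comp (h1.comp hX)

lemma mvfderiv_sum_mul {ι : Type*} (s : Finset ι) (a b : ι → M → ℝ) (x : M)
    (ha : ∀ i, MDifferentiableAt I 𝓘(ℝ, ℝ) (a i) x)
    (hb : ∀ i, MDifferentiableAt I 𝓘(ℝ, ℝ) (b i) x) (v : TangentSpace I x) :
    MDifferentiableAt I 𝓘(ℝ, ℝ) (fun y => ∑ i ∈ s, a i y * b i y) x ∧
    mvfderiv I (fun y => ∑ i ∈ s, a i y * b i y) x v =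
      ∑ i ∈ s, (mvfderiv I (a i) x v * b i x + a i x * mvfderiv I (b i) x v) := by
  classical
  induction s using Finset.induction_on with
  | empty =>
    simp only [Finset.sum_empty]
    refine ⟨mdifferentiableAt_const, ?_⟩
    rw [mvfderiv_const]; rfl
  | insert j s hj ih =>
    simp only [Finset.sum_insert hj]
    have hm : MDifferentiableAt I 𝓘(ℝ, ℝ) (fun y => a j y * b j y) x := (ha j).mul (hb j)
    refine ⟨hm.add ih.1, ?_⟩
    rw [mvfderiv_fun_add hm ih.1, mvfderiv_fun_mul (ha j) (hb j), add_apply,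
      ih.2, add_apply, smul_apply,
      smul_apply, smul_eq_mul, smul_eq_mul]
    ring

lemma mvfderiv_congr {f g : M → ℝ} {x : M} (h : f =ᶠ[𝓝 x] g) (v : TangentSpace I x) :
    mvfderiv I f x v = mvfderiv I g x v := by
  have h' : mfderiv I 𝓘(ℝ, ℝ) f x = mfderiv I 𝓘(ℝ, ℝ) g x := h.mfderiv_eq
  exact congrArg (fun T : TangentSpace I x →L[ℝ] ℝ => T v) h'

/-- Smooth functions separate the tangent vectors of a Hausdorff manifold. -/
lemma tangent_ext {n : ℕ} {M : Type*} [TopologicalSpace M]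
    [ChartedSpace (EuclideanSpace ℝ (Fin n)) M] [IsManifold (𝓡 n) ∞ M] [T2Space M] (q : M)
    (u w : TangentSpace (𝓡 n) q)
    (h : ∀ f : M → ℝ, ContMDiff (𝓡 n) 𝓘(ℝ, ℝ) ∞ f → mvfderiv (𝓡 n) f q u = mvfderiv (𝓡 n) f q w) :
    u = w := by
  have hinj := (isInvertible_mfderiv_extChartAt (I := 𝓡 n) (mem_extChartAt_source q)).injective
  apply hinj
  obtain ⟨χ, -⟩ : ∃ χ : SmoothBumpFunction (𝓡 n) q, True :=
    ⟨Classical.choice inferInstance, trivial⟩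
  have hc : ContMDiffAt (𝓡 n) 𝓘(ℝ, EuclideanSpace ℝ (Fin n)) ∞ (extChartAt (𝓡 n) q) q :=
    contMDiffAt_extChartAt
  suffices ∀ i : Fin n, (mvfderiv (𝓡 n) (extChartAt (𝓡 n) q) q u) i =
      (mvfderiv (𝓡 n) (extChartAt (𝓡 n) q) q w) i by
    exact PiLp.ext this
  intro i
  have hs := contMDiffOn_extChartAt (I := 𝓡 n) (n := ∞) (x := q)
  let pr : EuclideanSpace ℝ (Fin n) →L[ℝ] ℝ := EuclideanSpace.proj i
  have hg : ContMDiffOn (𝓡 n) 𝓘(ℝ, ℝ) ∞ (pr ∘ extChartAt (𝓡 n) q)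
      (chartAt (EuclideanSpace ℝ (Fin n)) q).source :=
    pr.contDiff.contMDiff.comp_contMDiffOn hs
  have hf := χ.contMDiff_smul hg
  have heq : (fun x => χ x • (pr ∘ extChartAt (𝓡 n) q) x) =ᶠ[𝓝 q] (pr ∘ extChartAt (𝓡 n) q) := by
    filter_upwards [χ.eventuallyEq_one] with x hx
    simp [hx]
  have key : ∀ v : TangentSpace (𝓡 n) q,
      mvfderiv (𝓡 n) (fun x => χ x • (pr ∘ extChartAt (𝓡 n) q) x) q v =
        (mvfderiv (𝓡 n) (extChartAt (𝓡 n) q) q v) i := by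
    intro v
    have h1 : mfderiv (𝓡 n) 𝓘(ℝ, ℝ) (fun x => χ x • (pr ∘ extChartAt (𝓡 n) q) x) q =
      mfderiv (𝓡 n) 𝓘(ℝ, ℝ) (pr ∘ extChartAt (𝓡 n) q) q := heq.mfderiv_eq
    have h2 := mfderiv_comp_apply q (I := 𝓡 n) (I' := 𝓘(ℝ, EuclideanSpace ℝ (Fin n)))
      (I'' := 𝓘(ℝ, ℝ)) (g := pr) (f := extChartAt (𝓡 n) q)
      (pr.mdifferentiableAt) (hc.mdifferentiableAt (by simp)) v
    rw [ContinuousLinearMap.mfderiv_eq] at h2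
    exact (congrArg (fun T => T v) h1).trans h2
  rw [← key, ← key]
  exact h _ hf

end Smooth

section Algebroid

variable (n m : ℕ) {Q : Type*} [TopologicalSpace Q] [ChartedSpace (EuclideanSpace ℝ (Fin n)) Q]
  [IsManifold (𝓡 n) ∞ Q] [T2Space Q]
  (E : Q → Type*) [TopologicalSpace (TotalSpace (EuclideanSpace ℝ (Fin m)) E)]
  [∀ q, TopologicalSpace (E q)] [∀ q, AddCommGroup (E q)] [∀ q, Module ℝ (E q)]
  [FiberBundle (EuclideanSpace ℝ (Fin m)) E] [VectorBundle ℝ (EuclideanSpace ℝ (Fin m)) E]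
  [ContMDiffVectorBundle ∞ (EuclideanSpace ℝ (Fin m)) E (𝓡 n)]

/-- The global smooth sections of the vector bundle `E → Q`. -/
abbrev Sec := ContMDiffSection (𝓡 n) (EuclideanSpace ℝ (Fin m)) ∞ E

/-- The product `f σ` of a smooth function and a smooth section. -/
def Sec.smulFun {n m : ℕ} {Q : Type*} [TopologicalSpace Q]
    [ChartedSpace (EuclideanSpace ℝ (Fin n)) Q]
    {E : Q → Type*} [TopologicalSpace (TotalSpace (EuclideanSpace ℝ (Fin m)) E)]
    [∀ q, TopologicalSpace (E q)] [∀ q, AddCommGroup (E q)] [∀ q, Module ℝ (E q)]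
    [FiberBundle (EuclideanSpace ℝ (Fin m)) E] [VectorBundle ℝ (EuclideanSpace ℝ (Fin m)) E]
    (f : Q → ℝ) (hf : ContMDiff (𝓡 n) 𝓘(ℝ, ℝ) ∞ f) (σ : Sec n m E) : Sec n m E :=
  ⟨fun q => f q • σ q, hf.smul_section σ.contMDiff⟩

/-- A Lie algebroid structure on the vector bundle `E → Q`: a Lie bracket on the space of smooth
sections and a smooth vector bundle morphism `E → TQ` over the identity (the anchor), related by
the Leibniz rule. -/
structure LieAlgebroid where
  bracket : Sec n m E →ₗ[ℝ] Sec n m E →ₗ[ℝ] Sec n m E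
  bracket_self : ∀ σ, bracket σ σ = 0
  jacobi : ∀ σ τ υ,
    bracket σ (bracket τ υ) = bracket (bracket σ τ) υ + bracket τ (bracket σ υ)
  anchor : ∀ q, E q →ₗ[ℝ] TangentSpace (𝓡 n) q
  contMDiff_anchor : ContMDiff ((𝓡 n).prod 𝓘(ℝ, EuclideanSpace ℝ (Fin m))) (𝓡 n).tangent ∞
    (fun a : TotalSpace (EuclideanSpace ℝ (Fin m)) E =>
      (⟨a.proj, anchor a.proj a.snd⟩ : TangentBundle (𝓡 n) Q))
  leibniz : ∀ (f : Q → ℝ) (hf : ContMDiff (𝓡 n) 𝓘(ℝ, ℝ) ∞ f) (σ τ : Sec n m E) (q : Q),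
    bracket σ (Sec.smulFun f hf τ) q =
      f q • bracket σ τ q + mvfderiv (𝓡 n) f q (anchor q (σ q)) • τ q

/-- The manifold `E × ℝ`. -/
abbrev ExtPhase := TotalSpace (EuclideanSpace ℝ (Fin m)) E × ℝ

/-- The model with corners of the manifold `E × ℝ`. -/
abbrev extModel := ((𝓡 n).prod 𝓘(ℝ, EuclideanSpace ℝ (Fin m))).prod 𝓘(ℝ, ℝ)

variable {n m E}

/-- The projection `π : E × ℝ → Q`, `π (b_q, s) = q`. -/
abbrev proj (p : ExtPhase m E) : Q := p.1.proj

variable (A : LieAlgebroid n m E)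

/-- The fibre at `p = (b_q, s)` of the prolongation `T^E(E × ℝ)`: the pairs `(a, v)` with `a ∈ E_q`,
`v ∈ T_p(E × ℝ)` and `ρ(a) = Tπ(v)`. -/
def prolFiber (p : ExtPhase m E) :
    Submodule ℝ (E p.1.proj × TangentSpace (extModel n m) p) where
  carrier := {w | A.anchor p.1.proj w.1 = mfderiv (extModel n m) (𝓡 n) proj p w.2}
  add_mem' {a b} ha hb := by
    simp only [mem_ofPred_eq] at *
    rw [Prod.fst_add, Prod.snd_add, map_add, map_add, ha, hb]
  zero_mem' := by
    simp only [mem_ofPred_eq] at *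
    rw [Prod.fst_zero, Prod.snd_zero, map_zero, map_zero]
  smul_mem' c a ha := by
    simp only [mem_ofPred_eq] at *
    rw [Prod.smul_fst, Prod.smul_snd, map_smul, map_smul, ha]

/-- The smooth sections `p ↦ (a(p), v(p))` of the prolongation, a subbundle of the fibre product over
`E × ℝ` of the pullback of `E` and of `T(E × ℝ)`. -/
structure ProlSection where
  val : ∀ p : ExtPhase m E, prolFiber A p
  contMDiff_fst : ContMDiff (extModel n m) ((𝓡 n).prod 𝓘(ℝ, EuclideanSpace ℝ (Fin m))) ∞
    (fun p => (⟨p.1.proj, (val p).1.1⟩ : TotalSpace (EuclideanSpace ℝ (Fin m)) E))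
  contMDiff_snd : ContMDiff (extModel n m) (extModel n m).tangent ∞
    (fun p => (⟨p, (val p).1.2⟩ : TangentBundle (extModel n m) (ExtPhase m E)))

/-- The anchor `ρ^π (a, v) = v` of the prolongation. -/
def prolAnchor (p : ExtPhase m E) : prolFiber A p →ₗ[ℝ] TangentSpace (extModel n m) p :=
  (LinearMap.snd ℝ _ _).comp (prolFiber A p).subtype

/-- The curve `t ↦ (b + t a, s)` in `E × ℝ`, where `p = (b, s)`. -/
def vertCurve (p : ExtPhase m E) (a : E p.1.proj) (t : ℝ) : ExtPhase m E :=
  (⟨p.1.proj, p.1.snd + t • a⟩, p.2)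

/-- The vertical lift `a^V` of `a` to `T_p(E × ℝ)`: the velocity at `0` of `t ↦ (b + t a, s)`. -/
def vertVector (p : ExtPhase m E) (a : E p.1.proj) : TangentSpace (extModel n m) p :=
  mfderiv 𝓘(ℝ, ℝ) (extModel n m) (vertCurve p a) 0 (1 : ℝ)

lemma vertCurve_zero (p : ExtPhase m E) (a : E p.1.proj) : vertCurve p a 0 = p := by
  simp [vertCurve]

lemma contMDiff_vertCurve (p : ExtPhase m E) (a : E p.1.proj) :
    ContMDiff 𝓘(ℝ, ℝ) (extModel n m) ∞ (vertCurve p a) := by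
  refine ContMDiff.prodMk ?_ contMDiff_const
  intro t
  rw [contMDiffAt_totalSpace]
  refine ⟨contMDiffAt_const, ?_⟩
  set e := trivializationAt (EuclideanSpace ℝ (Fin m)) E p.1.proj
  have he : p.1.proj ∈ e.baseSet := FiberBundle.mem_baseSet_trivializationAt' _
  have : (fun t : ℝ => (e ⟨p.1.proj, p.1.snd + t • a⟩).2) =
      fun t => e.linearMapAt ℝ p.1.proj p.1.snd + t • e.linearMapAt ℝ p.1.proj a := by
    funext t
    rw [← map_smul, ← map_add, e.linearMapAt_apply, if_pos he]
  change ContMDiffAt _ _ _ (fun t : ℝ => (e ⟨p.1.proj, p.1.snd + t • a⟩).2) t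
  rw [this]
  exact (contDiff_const.add (contDiff_id.smul contDiff_const)).contMDiff t

lemma vertVector_eq (p : ExtPhase m E) (a : E p.1.proj) :
    (vertVector p a : (EuclideanSpace ℝ (Fin n) × EuclideanSpace ℝ (Fin m)) × ℝ) =
      ((0, (trivializationAt (EuclideanSpace ℝ (Fin m)) E p.1.proj).linearMapAt ℝ p.1.proj a), 0) := by
  set e := trivializationAt (EuclideanSpace ℝ (Fin m)) E p.1.proj with hedef
  have he : p.1.proj ∈ e.baseSet := FiberBundle.mem_baseSet_trivializationAt' _
  have hd : MDifferentiableAt 𝓘(ℝ, ℝ) (extModel n m) (vertCurve p a) 0 :=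
    (contMDiff_vertCurve p a).mdifferentiable (by simp) 0
  have hw : writtenInExtChartAt 𝓘(ℝ, ℝ) (extModel n m) 0 (vertCurve p a) =
      fun t : ℝ => ((extChartAt (𝓡 n) p.1.proj p.1.proj,
        e.linearMapAt ℝ p.1.proj p.1.snd + t • e.linearMapAt ℝ p.1.proj a), p.2) := by
    funext t
    unfold writtenInExtChartAt
    rw [vertCurve_zero]
    rw [← map_smul, ← map_add, e.linearMapAt_apply, if_pos he]
    simp [vertCurve, FiberBundle.chartedSpace_chartAt, chartAt_self_eq, he, ← hedef]
  have hder : HasDerivAt (fun t : ℝ => ((extChartAt (𝓡 n) p.1.proj p.1.proj,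
        e.linearMapAt ℝ p.1.proj p.1.snd + t • e.linearMapAt ℝ p.1.proj a), p.2))
      ((0, e.linearMapAt ℝ p.1.proj a), 0) 0 := by
    refine HasDerivAt.prodMk (HasDerivAt.prodMk (hasDerivAt_const _ _) ?_) (hasDerivAt_const _ _)
    have := ((hasDerivAt_id (0 : ℝ)).smul_const (e.linearMapAt ℝ p.1.proj a)).const_add (e.linearMapAt ℝ p.1.proj p.1.snd)
    simpa using this
  have h1 := hd.mfderiv
  rw [hw] at h1
  simp only [mfld_simps, fderivWithin_univ] at h1
  unfold vertVector
  have h2 : mfderiv 𝓘(ℝ, ℝ) (extModel n m) (vertCurve p a) 0 (1 : ℝ) = fderiv ℝ (fun t : ℝ => ((extChartAt (𝓡 n) p.1.proj p.1.proj,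
        e.linearMapAt ℝ p.1.proj p.1.snd + t • e.linearMapAt ℝ p.1.proj a), p.2)) 0 1 := by
    exact congrArg (fun T => T (1:ℝ)) h1
  rw [h2]
  exact (fderiv_eq_smul_deriv _).trans (by rw [hder.deriv, one_smul])

lemma contMDiff_proj_ext :
    ContMDiff (extModel n m) (𝓡 n) ∞ (proj : ExtPhase m E → Q) :=
  (contMDiff_proj E).comp contMDiff_fst

lemma mfderiv_proj_vertVector (p : ExtPhase m E) (a : E p.1.proj) :
    mfderiv (extModel n m) (𝓡 n) proj p (vertVector p a) = 0 := by
  have hp : MDifferentiableAt (extModel n m) (𝓡 n) (proj : ExtPhase m E → Q) (vertCurve p a 0) :=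
    (contMDiff_proj_ext.mdifferentiable (by simp)) _
  have hc : MDifferentiableAt 𝓘(ℝ, ℝ) (extModel n m) (vertCurve p a) 0 :=
    (contMDiff_vertCurve p a).mdifferentiable (by simp) 0
  have h := mfderiv_comp_apply (0 : ℝ) hp hc 1
  have h0 : mfderiv 𝓘(ℝ, ℝ) (𝓡 n) (proj ∘ vertCurve p a) 0 = 0 := mfderiv_const
  rw [h0] at h
  have key : ∀ p' : ExtPhase m E, p' = p →
      ∀ v : (EuclideanSpace ℝ (Fin n) × EuclideanSpace ℝ (Fin m)) × ℝ,
      (mfderiv (extModel n m) (𝓡 n) proj p' v : EuclideanSpace ℝ (Fin n)) =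
        mfderiv (extModel n m) (𝓡 n) proj p v := by
    rintro p' rfl v; rfl
  exact (key _ (vertCurve_zero p a) _).symm.trans h.symm


section Frame

lemma exists_frame_section (q : Q) (v : EuclideanSpace ℝ (Fin m)) :
    ∃ σ : Sec n m E, ∀ᶠ q' in 𝓝 q,
      σ q' = (trivializationAt (EuclideanSpace ℝ (Fin m)) E q).symm q' v := by
  set e := trivializationAt (EuclideanSpace ℝ (Fin m)) E q
  have he : q ∈ e.baseSet := FiberBundle.mem_baseSet_trivializationAt' q
  have hbase : e.baseSet ∈ 𝓝 q := e.open_baseSet.mem_nhds he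
  have hs : ContMDiffOn (𝓡 n) ((𝓡 n).prod 𝓘(ℝ, EuclideanSpace ℝ (Fin m))) ∞
      (fun x => TotalSpace.mk' (EuclideanSpace ℝ (Fin m)) x (e.symm x v)) e.baseSet := by
    rw [e.contMDiffOn_section_baseSet_iff]
    refine (contMDiffOn_const (c := v)).congr fun x hx => ?_
    rw [e.apply_mk_symm hx]
  obtain ⟨χ, hχ, -⟩ := (SmoothBumpFunction.nhds_basis_support (I := 𝓡 n) hbase).mem_iff.mp hbase
  refine ⟨⟨fun x => χ x • e.symm x v,
    ContMDiffOn.smul_section_of_tsupport χ.contMDiff.contMDiffOn e.open_baseSet hχ hs⟩, ?_⟩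
  filter_upwards [χ.eventuallyEq_one] with x hx
  change χ x • e.symm x v = _
  rw [hx]; simp

/-- Global smooth sections of `E` which, near `q`, are the local frame of `E` given by a
trivialization at `q` (see `eventually_eq_sum_frame`). -/
def frameSec (q : Q) (i : Fin m) : Sec n m E :=
  (exists_frame_section (n := n) (E := E) q (EuclideanSpace.single i 1)).choose

/-- The fibre coordinates of `E` near `q` for the local frame `frameSec q`. -/
def frameCoord (q : Q) (i : Fin m) (a : TotalSpace (EuclideanSpace ℝ (Fin m)) E) : ℝ :=
  (trivializationAt (EuclideanSpace ℝ (Fin m)) E q a).2 i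

lemma eventually_eq_sum_frame (q : Q) : ∀ᶠ q' in 𝓝 q, ∀ a : E q',
    a = ∑ i : Fin m, frameCoord q i ⟨q', a⟩ • (frameSec (n := n) (E := E) q i) q' := by
  set e := trivializationAt (EuclideanSpace ℝ (Fin m)) E q with hedef
  have he : q ∈ e.baseSet := FiberBundle.mem_baseSet_trivializationAt' q
  have h : ∀ᶠ q' in 𝓝 q, ∀ i : Fin m, (frameSec (n := n) (E := E) q i) q' =
      e.symm q' (EuclideanSpace.single i 1) :=
    Filter.eventually_all.mpr fun i =>
      (exists_frame_section (n := n) (E := E) q (EuclideanSpace.single i 1)).choose_spec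
  filter_upwards [h, e.open_baseSet.mem_nhds he] with q' h1 h2 a
  have hinj : Function.Injective (e.linearMapAt ℝ q') :=
    Function.LeftInverse.injective (e.symmₗ_linearMapAt (R := ℝ) h2)
  apply hinj
  rw [map_sum]
  simp only [map_smul, h1]
  ext j
  simp only [e.linearMapAt_apply, if_pos h2, e.apply_mk_symm h2, frameCoord, ← hedef]
  simp [Pi.single_apply]

lemma contMDiffAt_frameCoord (q : Q) (i : Fin m) (a : TotalSpace (EuclideanSpace ℝ (Fin m)) E)
    (ha : a.proj = q) :
    ContMDiffAt ((𝓡 n).prod 𝓘(ℝ, EuclideanSpace ℝ (Fin m))) 𝓘(ℝ, ℝ) ∞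
      (frameCoord (E := E) q i) a := by
  subst ha
  have h := (contMDiffAt_totalSpace (IB := 𝓡 n) (F := EuclideanSpace ℝ (Fin m)) (E := E) (n := ∞)
    (f := id) (x₀ := a)).mp contMDiffAt_id
  let pr : EuclideanSpace ℝ (Fin m) →L[ℝ] ℝ := EuclideanSpace.proj i
  exact pr.contDiff.contMDiff.contMDiffAt.comp a h.2

end Frame

lemma LieAlgebroid.bracket_skew (σ τ : Sec n m E) : A.bracket σ τ = - A.bracket τ σ := by
  have h := A.bracket_self (σ + τ)
  simp only [map_add, LinearMap.add_apply, A.bracket_self, zero_add, add_zero] at h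
  exact eq_neg_of_add_eq_zero_right h

lemma LieAlgebroid.contMDiff_anchor_section (σ : Sec n m E) :
    ContMDiff (𝓡 n) (𝓡 n).tangent ∞
      (fun q => (⟨q, A.anchor q (σ q)⟩ : TangentBundle (𝓡 n) Q)) :=
  A.contMDiff_anchor.comp σ.contMDiff

/-- The function `ρ(σ) f`. -/
def LieAlgebroid.act (σ : Sec n m E) (f : Q → ℝ) (q : Q) : ℝ :=
  mvfderiv (𝓡 n) f q (A.anchor q (σ q))

lemma LieAlgebroid.contMDiff_act (σ : Sec n m E) {f : Q → ℝ} (hf : ContMDiff (𝓡 n) 𝓘(ℝ, ℝ) ∞ f) :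
    ContMDiff (𝓡 n) 𝓘(ℝ, ℝ) ∞ (A.act σ f) :=
  contMDiff_mvfderiv_apply hf (A.contMDiff_anchor_section σ)

lemma LieAlgebroid.leibniz' (f : Q → ℝ) (hf : ContMDiff (𝓡 n) 𝓘(ℝ, ℝ) ∞ f) (σ τ : Sec n m E) :
    A.bracket σ (Sec.smulFun f hf τ) =
      Sec.smulFun f hf (A.bracket σ τ) + Sec.smulFun (A.act σ f) (A.contMDiff_act σ hf) τ := by
  ext q
  exact A.leibniz f hf σ τ q

lemma LieAlgebroid.act_bracket (σ τ : Sec n m E) {f : Q → ℝ}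
    (hf : ContMDiff (𝓡 n) 𝓘(ℝ, ℝ) ∞ f) (q : Q) :
    A.act (A.bracket σ τ) f q = A.act σ (A.act τ f) q - A.act τ (A.act σ f) q := by
  by_cases hE : ∃ a : E q, a ≠ 0
  · obtain ⟨a, ha⟩ := hE
    set e := trivializationAt (EuclideanSpace ℝ (Fin m)) E q
    have he : q ∈ e.baseSet := FiberBundle.mem_baseSet_trivializationAt' q
    obtain ⟨υ, hυ⟩ := exists_frame_section (n := n) (E := E) q (e ⟨q, a⟩).2
    have hυq : υ q = a := by
      rw [hυ.self_of_nhds]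
      exact e.symm_apply_apply_mk he a
    have hj := A.jacobi σ τ (Sec.smulFun f hf υ)
    simp only [A.leibniz', map_add] at hj
    have hj' := congrArg (fun s : Sec n m E => s q) (A.jacobi σ τ υ)
    have hjq := congrArg (fun s : Sec n m E => s q) hj
    simp only [ContMDiffSection.coe_add, Pi.add_apply] at hjq hj'
    simp only [Sec.smulFun, ContMDiffSection.coeFn_mk, hυq] at hjq
    rw [hj', smul_add] at hjq
    have h0 : (A.act σ (A.act τ f) q - A.act τ (A.act σ f) q - A.act (A.bracket σ τ) f q) • a = 0 := by
      rw [← sub_eq_zero] at hjq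
      rw [← hjq]
      module
    rcases smul_eq_zero.mp h0 with h | h
    · linarith
    · exact absurd h ha
  · push Not at hE
    simp only [LieAlgebroid.act, hE, map_zero, sub_zero]

variable {A}

/-- The component in `E` of a section of the prolongation. -/
def ProlSection.base (Z : ProlSection A) (p : ExtPhase m E) : E p.1.proj := (Z.val p).1.1

/-- The vector field `ρ^π(Z)` on `E × ℝ`. -/
def ProlSection.vec (Z : ProlSection A) (p : ExtPhase m E) : TangentSpace (extModel n m) p :=
  (Z.val p).1.2

lemma ProlSection.anchor_base (Z : ProlSection A) (p : ExtPhase m E) :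
    A.anchor p.1.proj (Z.base p) = mfderiv (extModel n m) (𝓡 n) proj p (Z.vec p) :=
  (Z.val p).2

/-- The components near `q` of `Z.base` in the local frame `frameSec q`. -/
def ProlSection.coord (Z : ProlSection A) (q : Q) (i : Fin m) (p : ExtPhase m E) : ℝ :=
  frameCoord q i ⟨p.1.proj, Z.base p⟩

/-- The component in `E` of the bracket of two sections of the prolongation. If, near `q = π(p)`,
`Z = (a^i e_i, v)` and `W = (b^i e_i, w)` with a local frame `e_i` of `E` and functions `a^i`, `b^i`
on `E × ℝ`, then it is `(v(b^i) - w(a^i)) e_i + a^i b^j [e_i, e_j]`. So it is `[σ, τ]` when `Z` and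
`W` project to sections `σ` and `τ` of `E`, and it extends the Leibniz rule to all sections. -/
def bracketBase (Z W : ProlSection A) (p : ExtPhase m E) : E p.1.proj :=
  ∑ i, (mvfderiv (extModel n m) (W.coord p.1.proj i) p (Z.vec p) -
      mvfderiv (extModel n m) (Z.coord p.1.proj i) p (W.vec p)) •
        (frameSec (n := n) (E := E) p.1.proj i) p.1.proj +
    ∑ i, ∑ j, (Z.coord p.1.proj i p * W.coord p.1.proj j p) •
      A.bracket (frameSec p.1.proj i) (frameSec p.1.proj j) p.1.proj

lemma ProlSection.mdifferentiableAt_coord (Z : ProlSection A) (i : Fin m) (p : ExtPhase m E) :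
    MDifferentiableAt (extModel n m) 𝓘(ℝ, ℝ) (Z.coord p.1.proj i) p :=
  ((contMDiffAt_frameCoord p.1.proj i ⟨p.1.proj, Z.base p⟩ rfl).comp p
    (Z.contMDiff_fst p)).mdifferentiableAt (by simp)

lemma ProlSection.mvfderiv_comp_proj (Z : ProlSection A) {f : Q → ℝ}
    (hf : ContMDiff (𝓡 n) 𝓘(ℝ, ℝ) ∞ f) (p : ExtPhase m E) :
    mvfderiv (extModel n m) (f ∘ proj) p (Z.vec p) =
      mvfderiv (𝓡 n) f p.1.proj (A.anchor p.1.proj (Z.base p)) := by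
  rw [mvfderiv_comp_apply p (hf.mdifferentiable (by simp) _)
    (contMDiff_proj_ext.mdifferentiable (by simp) _), Z.anchor_base]

lemma ProlSection.anchor_base_eq_sum (Z : ProlSection A) (f : Q → ℝ) (q : Q)
    (p : ExtPhase m E)
    (h : ∀ a : E p.1.proj, a = ∑ i : Fin m, frameCoord q i ⟨p.1.proj, a⟩ •
      (frameSec (n := n) (E := E) q i) p.1.proj) :
    mvfderiv (𝓡 n) f p.1.proj (A.anchor p.1.proj (Z.base p)) =
      ∑ i, Z.coord q i p * A.act (frameSec q i) f p.1.proj := by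
  conv_lhs => rw [h (Z.base p)]
  simp only [map_sum, map_smul]
  rfl

lemma ProlSection.mvfderiv_act (Z W : ProlSection A) {f : Q → ℝ}
    (hf : ContMDiff (𝓡 n) 𝓘(ℝ, ℝ) ∞ f) (p : ExtPhase m E) :
    mvfderiv (extModel n m) (fun p' => mvfderiv (extModel n m) (f ∘ proj) p' (W.vec p')) p
        (Z.vec p) =
      ∑ i, mvfderiv (extModel n m) (W.coord p.1.proj i) p (Z.vec p) *
          A.act (frameSec p.1.proj i) f p.1.proj +
        ∑ i, ∑ j, Z.coord p.1.proj i p * W.coord p.1.proj j p *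
          A.act (frameSec p.1.proj i) (A.act (frameSec p.1.proj j) f) p.1.proj := by
  set q := p.1.proj with hq
  have hev : (fun p' => mvfderiv (extModel n m) (f ∘ proj) p' (W.vec p')) =ᶠ[𝓝 p]
      fun p' => ∑ i, W.coord q i p' * (A.act (frameSec q i) f ∘ proj) p' := by
    have hc : ContinuousAt (proj : ExtPhase m E → Q) p :=
      (contMDiff_proj_ext (n := n) (m := m) (E := E)).continuous.continuousAt
    filter_upwards [hc.eventually (eventually_eq_sum_frame (n := n) (m := m) (E := E) q)] with p' hp'
    rw [W.mvfderiv_comp_proj hf, W.anchor_base_eq_sum f q p' hp']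
    rfl
  have hfr := (eventually_eq_sum_frame (n := n) (m := m) (E := E) q).self_of_nhds
  have hA : ∀ g : Q → ℝ, ContMDiff (𝓡 n) 𝓘(ℝ, ℝ) ∞ g →
      mvfderiv (extModel n m) (g ∘ proj) p (Z.vec p) =
        ∑ i, Z.coord q i p * A.act (frameSec q i) g q := fun g hg => by
    rw [Z.mvfderiv_comp_proj hg, Z.anchor_base_eq_sum g q p hfr]
  have h1 : mvfderiv (extModel n m)
      (fun p' => mvfderiv (extModel n m) (f ∘ proj) p' (W.vec p')) p (Z.vec p) =
      mvfderiv (extModel n m)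
        (fun p' => ∑ i, W.coord q i p' * (A.act (frameSec q i) f ∘ proj) p') p (Z.vec p) :=
    mvfderiv_congr hev _
  rw [h1, (mvfderiv_sum_mul Finset.univ (fun i => W.coord q i)
    (fun i => A.act (frameSec q i) f ∘ proj) p (fun i => W.mdifferentiableAt_coord i p)
    (fun i => ((A.contMDiff_act _ hf).comp contMDiff_proj_ext).mdifferentiable (by simp) _)
    (Z.vec p)).2, Finset.sum_add_distrib]
  congr 1
  rw [Finset.sum_comm]
  refine Finset.sum_congr rfl fun j _ => ?_
  rw [hA _ (A.contMDiff_act _ hf), Finset.mul_sum]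
  refine Finset.sum_congr rfl fun i _ => ?_
  ring

lemma anchor_bracketBase (Z W : ProlSection A) (p : ExtPhase m E) :
    A.anchor p.1.proj (bracketBase Z W p) =
      mfderiv (extModel n m) (𝓡 n) proj p
        (mlieBracket (extModel n m) Z.vec W.vec p) := by
  apply tangent_ext
  intro f hf
  have hfp : ContMDiff (extModel n m) 𝓘(ℝ, ℝ) ∞ (f ∘ proj : ExtPhase m E → ℝ) :=
    hf.comp contMDiff_proj_ext
  rw [← mvfderiv_comp_apply p (hf.mdifferentiable (by simp) _)
    (contMDiff_proj_ext.mdifferentiable (by simp) _)]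
  rw [mv_lie (f ∘ proj) hfp Z.vec W.vec p (Z.contMDiff_snd.mdifferentiable (by simp) _)
    (W.contMDiff_snd.mdifferentiable (by simp) _)
    ((contMDiff_mvfderiv_apply hfp Z.contMDiff_snd).mdifferentiable (by simp) _)
    ((contMDiff_mvfderiv_apply hfp W.contMDiff_snd).mdifferentiable (by simp) _),
    Z.mvfderiv_act W hf, W.mvfderiv_act Z hf]
  unfold bracketBase
  simp only [map_add, map_sum, map_smul, smul_eq_mul]
  have h1 : ∀ i j, mvfderiv (𝓡 n) f p.1.proj (A.anchor p.1.proj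
      (A.bracket (frameSec p.1.proj i) (frameSec p.1.proj j) p.1.proj)) =
        A.act (frameSec p.1.proj i) (A.act (frameSec p.1.proj j) f) p.1.proj -
        A.act (frameSec p.1.proj j) (A.act (frameSec p.1.proj i) f) p.1.proj :=
    fun i j => A.act_bracket _ _ hf _
  have h2 : ∀ i, mvfderiv (𝓡 n) f p.1.proj (A.anchor p.1.proj
      ((frameSec p.1.proj i : Sec n m E) p.1.proj)) = A.act (frameSec p.1.proj i) f p.1.proj := fun i => rfl
  simp only [h1, h2, sub_mul, mul_sub, Finset.sum_sub_distrib]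
  rw [Finset.sum_comm (f := fun i j => W.coord p.1.proj i p * Z.coord p.1.proj j p * _)]
  simp only [mul_comm (W.coord p.1.proj _ p) (Z.coord p.1.proj _ p)]
  ring


/-- The Lie bracket of two sections of the prolongation, evaluated at `p`: its first component is
`bracketBase Z W p` and its second component is the Lie bracket of the vector fields
`ρ^π(Z)` and `ρ^π(W)` on `E × ℝ`. -/
def prolBracket (Z W : ProlSection A) (p : ExtPhase m E) : prolFiber A p :=
  ⟨(bracketBase Z W p, mlieBracket (extModel n m) Z.vec W.vec p), anchor_bracketBase Z W p⟩

variable (A)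

/-- The vertical lift of `a ∈ E_q` to the fibre of the prolongation at `p = (b_q, s)`. -/
def vertLift (p : ExtPhase m E) : E p.1.proj →ₗ[ℝ] prolFiber A p where
  toFun a := ⟨(0, vertVector p a), by
    change A.anchor p.1.proj 0 = mfderiv (extModel n m) (𝓡 n) proj p (vertVector p a)
    rw [mfderiv_proj_vertVector, map_zero]⟩
  map_add' a b := by
    refine Subtype.ext (Prod.ext (add_zero _).symm ?_)
    have h : (vertVector p (a + b) : (EuclideanSpace ℝ (Fin n) × EuclideanSpace ℝ (Fin m)) × ℝ) =
        vertVector p a + vertVector p b := by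
      refine (vertVector_eq p (a + b)).trans ?_
      rw [map_add]
      refine Eq.trans ?_ (congrArg₂ (· + ·) (vertVector_eq p a) (vertVector_eq p b)).symm
      exact Prod.ext (Prod.ext (add_zero _).symm rfl) (add_zero _).symm
    exact h
  map_smul' c a := by
    refine Subtype.ext (Prod.ext (smul_zero _).symm ?_)
    have h : (vertVector p (c • a) : (EuclideanSpace ℝ (Fin n) × EuclideanSpace ℝ (Fin m)) × ℝ) =
        c • vertVector p a := by
      refine (vertVector_eq p (c • a)).trans ?_
      rw [map_smul]
      refine Eq.trans ?_ (congrArg (c • ·) (vertVector_eq p a)).symm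
      exact Prod.ext (Prod.ext (smul_zero _).symm rfl) (smul_zero _).symm
    exact h

/-- The vertical endomorphism `S` of the prolongation: `S (a, v) = (0, a^V)`. -/
def vertEndo (p : ExtPhase m E) : prolFiber A p →ₗ[ℝ] prolFiber A p :=
  (vertLift A p).comp ((LinearMap.fst ℝ _ _).comp (prolFiber A p).subtype)

/-- The Liouville section `Δ`: the value at `p = (b, s)` is the vertical lift of `b`. -/
def liouville (p : ExtPhase m E) : prolFiber A p := vertLift A p p.1.snd

variable {A} in
/-- A section `Γ` of the prolongation is a second order differential equation if `S Γ = Δ`. -/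
def IsSODE (Γ : ProlSection A) : Prop := ∀ p, vertEndo A p (Γ.val p) = liouville A p

/-- The `1`-sections of the prolongation (no smoothness is required here). -/
abbrev OneSection := ∀ p : ExtPhase m E, prolFiber A p →ₗ[ℝ] ℝ

/-- The differential of a function on `E × ℝ`: `(df)(Z) = ρ^π(Z) f`. -/
def dFun (f : ExtPhase m E → ℝ) : OneSection A := fun p =>
  (mvfderiv (extModel n m) f p).toLinearMap.comp (prolAnchor A p)

variable {A} in
/-- The exterior differential of a `1`-section of the prolongation, evaluated on two sections:
`dη(Z, W) = ρ^π(Z)(η(W)) - ρ^π(W)(η(Z)) - η([Z, W])`. -/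
def dForm (η : OneSection A) (Z W : ProlSection A) (p : ExtPhase m E) : ℝ :=
  mvfderiv (extModel n m) (fun p' => η p' (W.val p')) p (Z.vec p) -
    mvfderiv (extModel n m) (fun p' => η p' (Z.val p')) p (W.vec p) - η p (prolBracket Z W p)

/-- The `1`-section `V^s = ds`. -/
def verticalS : OneSection A := dFun A Prod.snd

/-- The Poincaré-Cartan `1`-section `Θ_L = dL ∘ S`. -/
def poincareCartan (L : ExtPhase m E → ℝ) : OneSection A := fun p =>
  (dFun A L p).comp (vertEndo A p)

/-- The `1`-section `η_L = V^s - Θ_L`. -/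
def etaL (L : ExtPhase m E → ℝ) : OneSection A := fun p => verticalS A p - poincareCartan A L p

/-- The energy `E_L = ρ^π(Δ) L - L`. -/
def energy (L : ExtPhase m E → ℝ) (p : ExtPhase m E) : ℝ := dFun A L p (liouville A p) - L p

/-- The value at `p` of `η ∧ (dη)^k` on the sections `Z 0, …, Z (2k)`. -/
def wedgePower (k : ℕ) (η : OneSection A) (Z : Fin (2 * k + 1) → ProlSection A)
    (p : ExtPhase m E) : ℝ :=
  (1 / 2 ^ k : ℝ) * ∑ σ : Equiv.Perm (Fin (2 * k + 1)), (Equiv.Perm.sign σ : ℝ) *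
    (η p ((Z (σ 0)).val p) * ∏ i : Fin k,
      dForm η (Z (σ ⟨2 * i + 1, by omega⟩)) (Z (σ ⟨2 * i + 2, by omega⟩)) p)

/-- `η` is a contact section of the prolongation: the prolongation has rank `2k + 1`, and `η` is a
smooth `1`-section with `η ∧ (dη)^k ≠ 0` everywhere. -/
structure IsContactSection (k : ℕ) (η : OneSection A) : Prop where
  finrank_eq : ∀ p : ExtPhase m E, Module.finrank ℝ (prolFiber A p) = 2 * k + 1
  contMDiff : ∀ Z : ProlSection A,
    ContMDiff (extModel n m) 𝓘(ℝ, ℝ) ∞ (fun p => η p (Z.val p))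
  wedge_ne_zero : ∀ p : ExtPhase m E, ∃ Z : Fin (2 * k + 1) → ProlSection A,
    wedgePower A k η Z p ≠ 0

variable {A} in
/-- `R` is a Reeb section of `η`: `i_R dη = 0` and `i_R η = 1`. -/
def IsReeb (η : OneSection A) (R : ProlSection A) : Prop :=
  (∀ (Z : ProlSection A) (p : ExtPhase m E), dForm η R Z p = 0) ∧
    ∀ p : ExtPhase m E, η p (R.val p) = 1

variable {A} in
/-- The equations of a Lagrangian section, for a given Reeb section `R`:
`i_Γ η_L = -E_L` and `i_Γ dη_L = dE_L - ρ^π(R)(E_L) η_L`. -/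
def IsLagrangianSection (L : ExtPhase m E → ℝ) (R Γ : ProlSection A) : Prop :=
  (∀ p : ExtPhase m E, etaL A L p (Γ.val p) = -energy A L p) ∧
    ∀ (Z : ProlSection A) (p : ExtPhase m E), dForm (etaL A L) Γ Z p =
      dFun A (energy A L) p (Z.val p) -
        dFun A (energy A L) p (R.val p) * etaL A L p (Z.val p)

/-- The Lagrangian is regular: on each fibre `E_q × {s}`, its Hessian matrix in the linear
coordinates given by a basis of `E_q` is non-singular. -/
def IsRegular (L : ExtPhase m E → ℝ) : Prop :=
  ∀ (p : ExtPhase m E) (e : Module.Basis (Fin m) ℝ (E p.1.proj)),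
    (Matrix.of fun α β : Fin m => deriv (fun t : ℝ => deriv (fun u : ℝ =>
      L (⟨p.1.proj, p.1.snd + t • e α + u • e β⟩, p.2)) 0) 0).det ≠ 0

variable (n m E) in
/-- Local data on an open set `U ⊆ Q`: a smooth chart of `Q`, giving the coordinates `q^i`, and a
smooth local frame `e_α` of `E`, giving the fibre coordinates `y^α`. -/
structure LocalData where
  U : Set Q
  isOpen_U : IsOpen U
  chart : OpenPartialHomeomorph Q (EuclideanSpace ℝ (Fin n))
  chart_mem : chart ∈ IsManifold.maximalAtlas (𝓡 n) ∞ Q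
  subset_source : U ⊆ chart.source
  frame : Fin m → ∀ q : Q, E q
  isFrame : IsLocalFrameOn (𝓡 n) (EuclideanSpace ℝ (Fin m)) ∞ frame U

namespace LocalData

variable (D : LocalData n m E)

/-- The coordinate `q^i`. -/
def qCoord (i : Fin n) (p : ExtPhase m E) : ℝ := D.chart p.1.proj i

/-- The fibre coordinate `y^α`. -/
def yCoord (α : Fin m) (p : ExtPhase m E) : ℝ := D.isFrame.coeff α p.1.proj p.1.snd

/-- The point of `E × ℝ` with coordinates `(x, y, s)`. -/
def point (x : EuclideanSpace ℝ (Fin n)) (y : Fin m → ℝ) (s : ℝ) : ExtPhase m E :=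
  (⟨D.chart.symm x, ∑ α, y α • D.frame α (D.chart.symm x)⟩, s)

/-- The partial derivative `∂f/∂q^i` in the coordinates `(q, y, s)`. -/
def partialQ (f : ExtPhase m E → ℝ) (i : Fin n) (p : ExtPhase m E) : ℝ :=
  deriv (fun t : ℝ => f (D.point (D.chart p.1.proj + t • EuclideanSpace.single i 1)
    (fun α => D.yCoord α p) p.2)) 0

/-- The partial derivative `∂f/∂y^α` in the coordinates `(q, y, s)`. -/
def partialY (f : ExtPhase m E → ℝ) (α : Fin m) (p : ExtPhase m E) : ℝ :=
  deriv (fun t : ℝ => f (D.point (D.chart p.1.proj)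
    ((fun β => D.yCoord β p) + t • Pi.single α 1) p.2)) 0

/-- The partial derivative `∂f/∂s` in the coordinates `(q, y, s)`. -/
def partialS (f : ExtPhase m E → ℝ) (p : ExtPhase m E) : ℝ :=
  deriv (fun t : ℝ => f (D.point (D.chart p.1.proj) (fun β => D.yCoord β p) (p.2 + t))) 0

/-- The structure functions `ρ^i_α`, given by `ρ(e_α) = ρ^i_α ∂/∂q^i`. -/
def anchorCoeff (i : Fin n) (α : Fin m) (q : Q) : ℝ :=
  mvfderiv (𝓡 n) (fun q' => D.chart q' i) q (A.anchor q (D.frame α q))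

/-- `C γ α β` are the structure functions `C^γ_{αβ}`, given by `[e_α, e_β] = C^γ_{αβ} e_γ` on `U`.
The bracket of the local sections `e_α` and `e_β` is computed at `q ∈ U` with any global sections
that agree with them near `q`. -/
def IsStructureFunctions (C : Fin m → Fin m → Fin m → Q → ℝ) : Prop :=
  ∀ q ∈ D.U, ∀ (α β : Fin m) (σ τ : Sec n m E),
    (∀ᶠ q' in 𝓝 q, σ q' = D.frame α q') → (∀ᶠ q' in 𝓝 q, τ q' = D.frame β q') →
      A.bracket σ τ q = ∑ γ, C γ α β q • D.frame γ q

/-- The curve `c`, defined on `I`, satisfies the Herglotz equations of `L` in the local coordinates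
`(q^i, y^α, s)`, at each time at which it lies over `U`. -/
def SatisfiesHerglotz (C : Fin m → Fin m → Fin m → Q → ℝ) (L : ExtPhase m E → ℝ)
    (c : ℝ → ExtPhase m E) (I : Set ℝ) : Prop :=
  ∀ t ∈ I, (c t).1.proj ∈ D.U →
    (∀ α : Fin m, HasDerivWithinAt (fun t' => D.partialY L α (c t'))
      (∑ i, D.anchorCoeff A i α (c t).1.proj * D.partialQ L i (c t) -
        ∑ β, ∑ γ, D.yCoord β (c t) * C γ α β (c t).1.proj * D.partialY L γ (c t) +
        D.partialY L α (c t) * D.partialS L (c t)) I t) ∧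
    (∀ i : Fin n, HasDerivWithinAt (fun t' => D.qCoord i (c t'))
      (∑ α, D.yCoord α (c t) * D.anchorCoeff A i α (c t).1.proj) I t) ∧
    HasDerivWithinAt (fun t' => (c t').2) (L (c t)) I t

end LocalData

end Algebroid

end HerglotzAlgebroid

end

/-! Near a point of `Q` fix a frame σ_α of `E`. Let P_α = σ_α^V(L) be the momenta (`momentum`), let
X^α be the components of the `E`-part of an element of the prolongation, and write P(a) for the
fibre derivative of `L` on a ∈ E_q. Then η_L = ds - Σ P_α X^α, and `LocalData.Extends.dForm_etaL`
gives dη_L = Σ_α X^α ∧ dP_α + Σ_{α,β} P([σ_α, σ_β]) X^α ⊗ X^β. The derivatives of the components of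
the two sections cancel against those in their bracket, so dη_L is a bilinear form on each fibre
(`omega`). The bracket is defined through one particular frame at each point;
`LocalData.Extends.bracketBase_eq` shows that the same formula holds in every frame.

Regularity says that the dP_α, restricted to vertical lifts, form an invertible matrix H
(`hessian`). Let w be annihilated by dη_L and η_L. Pairing with vertical lifts gives X(w)H = 0,
hence X(w) = 0. Then w = c^V, because η_L(w) = 0 removes the ∂/∂s part, and pairing with lifts of
the frame gives Hc = 0, hence c = 0. This nondegeneracy (`eq_zero_of_omega_eq_zero`) yields both
uniqueness statements. It also makes the pointwise solutions independent of the frame, so that local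
smooth formulas define global smooth sections.

The Reeb section is ∂/∂s - (H⁻¹ ∂P/∂s)^V. It kills every momentum, and since E_L = Σ y^α P_α - L,
its derivative of E_L is -∂L/∂s. The Lagrangian equation therefore reads i_Γ dη_L = dE_L + (∂L/∂s)
η_L. An element whose `E`-part at (b, s) is b satisfies this on vertical lifts and on ∂/∂s
automatically. On the lift of σ_β it prescribes dP_β(Γ), which a vertical component solved for with
H⁻¹ achieves (`LocalData.Extends.omega_lagrangianElement`). The section built in this way is a SODE
with ds(Γ) = L. Reading the equation on the lift of σ_α in coordinates gives the first Herglotz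
equation (`LocalData.Extends.mvfderiv_momentum_lagrangian`); the other two follow from the `E`-part
and the ds-part of Γ.

For the contact property, ker η_L has a symplectic basis for dη_L (`exists_symplectic`). On the Reeb
section followed by this basis, every nonzero term of the alternating sum defining η_L ∧ (dη_L)^m
equals 1, and the identity permutation gives such a term (`sum_perm_pos`). -/

noncomputable section

namespace HerglotzAlgebroid

open Bundle VectorField Set

/-! ### Initial velocities of families of curves. -/

section Velocity

variable {V : Type*} [NormedAddCommGroup V] [NormedSpace ℝ V]
  {H : Type*} [TopologicalSpace H] {I : ModelWithCorners ℝ V H}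
  {N : Type*} [TopologicalSpace N] [ChartedSpace H N] [IsManifold I ∞ N]
  {V' : Type*} [NormedAddCommGroup V'] [NormedSpace ℝ V']
  {H' : Type*} [TopologicalSpace H'] {I' : ModelWithCorners ℝ V' H'}
  {M : Type*} [TopologicalSpace M] [ChartedSpace H' M] [IsManifold I' ∞ M]

/-- The initial velocities of a smooth family of curves depend smoothly on the parameter. -/
lemma contMDiffAt_velocity (f : N → ℝ → M) (x₀ : N)
    (hf : ContMDiffAt (I.prod 𝓘(ℝ, ℝ)) I' ∞ (Function.uncurry f) (x₀, 0)) :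
    ContMDiffAt I I'.tangent ∞ (fun x =>
      (⟨f x 0, mfderiv 𝓘(ℝ, ℝ) I' (f x) 0 (1 : ℝ)⟩ : TangentBundle I' M)) x₀ := by
  have h := hf.mfderiv (m := ∞) f (fun _ => (0 : ℝ)) contMDiffAt_const (by simp)
  have h1 := h.clm_apply (contMDiffAt_const (c := (1 : ℝ)))
  have h0 : ContMDiffAt I I' ∞ (fun x => f x 0) x₀ :=
    hf.comp x₀ (contMDiffAt_id.prodMk contMDiffAt_const)
  rw [contMDiffAt_totalSpace]
  refine ⟨h0, h1.congr_of_eventuallyEq ?_⟩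
  have := h0.continuousAt.preimage_mem_nhds (extChartAt_source_mem_nhds (I := I') (f x₀ 0))
  filter_upwards [this] with x hx
  have e := congrArg (fun T : ℝ →L[ℝ] V' => T 1) (inTangentCoordinates_eq (I := 𝓘(ℝ, ℝ)) (I' := I')
    (fun _ : N => (0 : ℝ)) (fun x => f x 0) (fun x => mfderiv 𝓘(ℝ, ℝ) I' (f x) 0) (x₀ := x₀) (x := x)
    (by simp) (by simpa using hx))
  refine Eq.trans ?_ e.symm
  -- `inTangentCoordinates` also changes coordinates in the source ℝ. The source point is always 0,
  -- so this change is the identity and keeps the vector 1.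
  have hc : (tangentBundleCore 𝓘(ℝ, ℝ) ℝ).coordChange (achart ℝ (0 : ℝ)) (achart ℝ (0 : ℝ)) 0 (1 : ℝ) = 1 :=
    (tangentBundleCore 𝓘(ℝ, ℝ) ℝ).coordChange_self _ _ (by simp) _
  exact (congrArg (fun r => (tangentBundleCore I' M).coordChange (achart H' (f x 0)) (achart H' (f x₀ 0)) (f x 0)
    (mfderiv 𝓘(ℝ, ℝ) I' (f x) 0 r)) hc).symm

end Velocity

/-! ### Tangent vectors of E × ℝ in the preferred charts. -/

variable {n m : ℕ} {Q : Type*} [TopologicalSpace Q] [ChartedSpace (EuclideanSpace ℝ (Fin n)) Q]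
  [IsManifold (𝓡 n) ∞ Q] [T2Space Q]
  {E : Q → Type*} [TopologicalSpace (TotalSpace (EuclideanSpace ℝ (Fin m)) E)]
  [∀ q, TopologicalSpace (E q)] [∀ q, AddCommGroup (E q)] [∀ q, Module ℝ (E q)]
  [FiberBundle (EuclideanSpace ℝ (Fin m)) E] [VectorBundle ℝ (EuclideanSpace ℝ (Fin m)) E]
  [ContMDiffVectorBundle ∞ (EuclideanSpace ℝ (Fin m)) E (𝓡 n)]

/-- The preferred chart of the total space is a trivialization followed by the chart of `Q` at the
same base point. Hence `proj` reads in these charts as a linear projection, which makes its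
derivative explicit in `mfderiv_proj_apply`. -/
lemma extChartAt_ext_fst_fst {p p' : ExtPhase m E} (h : p' ∈ (extChartAt (extModel n m) p).source) :
    (extChartAt (extModel n m) p p').1.1 = extChartAt (𝓡 n) p.1.proj p'.1.proj := by
  simp only [FiberBundle.chartedSpace_chartAt, mfld_simps] at h
  have h' := ((trivializationAt (EuclideanSpace ℝ (Fin m)) E p.1.proj).mem_source).mp h.1.1
  simp [FiberBundle.chartedSpace_chartAt, h', Trivialization.coe_fst']

lemma mfderiv_proj_apply (p : ExtPhase m E) (v : TangentSpace (extModel n m) p) :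
    (mfderiv (extModel n m) (𝓡 n) proj p v : EuclideanSpace ℝ (Fin n)) =
      (v : (EuclideanSpace ℝ (Fin n) × EuclideanSpace ℝ (Fin m)) × ℝ).1.1 := by
  have hd : MDifferentiableAt (extModel n m) (𝓡 n) (proj : ExtPhase m E → Q) p :=
    contMDiff_proj_ext.mdifferentiable (by simp) p
  have h1 := hd.mfderiv
  have hw : writtenInExtChartAt (extModel n m) (𝓡 n) p (proj : ExtPhase m E → Q)
      =ᶠ[𝓝 (extChartAt (extModel n m) p p)]
      ((ContinuousLinearMap.fst ℝ (EuclideanSpace ℝ (Fin n)) (EuclideanSpace ℝ (Fin m))).comp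
        (ContinuousLinearMap.fst ℝ (EuclideanSpace ℝ (Fin n) × EuclideanSpace ℝ (Fin m)) ℝ)) := by
    filter_upwards [(isOpen_extChartAt_target (I := extModel n m) p).mem_nhds
      (mem_extChartAt_target p)] with z hz
    have h2 := extChartAt_ext_fst_fst ((extChartAt (extModel n m) p).map_target hz)
    rw [(extChartAt (extModel n m) p).right_inv hz] at h2
    exact h2.symm
  have hr : range (extModel n m) = univ := ModelWithCorners.range_eq_univ _
  rw [hr, fderivWithin_univ, hw.fderiv_eq, ContinuousLinearMap.fderiv] at h1
  exact congrArg (fun T => T v) h1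

/-- The vector `∂/∂s` at a point of `E × ℝ`. -/
def sVector (p : ExtPhase m E) : TangentSpace (extModel n m) p :=
  ((0, 1) : (EuclideanSpace ℝ (Fin n) × EuclideanSpace ℝ (Fin m)) × ℝ)

lemma mfderiv_snd_apply (p : ExtPhase m E) (v : TangentSpace (extModel n m) p) :
    mvfderiv (extModel n m) (Prod.snd : ExtPhase m E → ℝ) p v =
      (v : (EuclideanSpace ℝ (Fin n) × EuclideanSpace ℝ (Fin m)) × ℝ).2 := by
  have h : mfderiv (extModel n m) 𝓘(ℝ, ℝ) (Prod.snd : ExtPhase m E → ℝ) p =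
    ContinuousLinearMap.snd ℝ (EuclideanSpace ℝ (Fin n) × EuclideanSpace ℝ (Fin m)) ℝ := mfderiv_snd
  exact congrArg (fun T => T v) h

lemma mfderiv_proj_sVector (p : ExtPhase m E) :
    mfderiv (extModel n m) (𝓡 n) proj p (sVector p) = 0 :=
  mfderiv_proj_apply p _

lemma mvfderiv_snd_sVector (p : ExtPhase m E) :
    mvfderiv (extModel n m) (Prod.snd : ExtPhase m E → ℝ) p (sVector p) = 1 :=
  mfderiv_snd_apply p _

lemma mvfderiv_snd_vertVector (p : ExtPhase m E) (a : E p.1.proj) :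
    mvfderiv (extModel n m) (Prod.snd : ExtPhase m E → ℝ) p (vertVector p a) = 0 :=
  (mfderiv_snd_apply p _).trans (congrArg Prod.snd (vertVector_eq p a))

/-- The vectors tangent to the fibres of `π` are spanned by the vertical lifts and `∂/∂s`. -/
lemma exists_eq_vertVector_add_sVector (p : ExtPhase m E) (v : TangentSpace (extModel n m) p)
    (hv : mfderiv (extModel n m) (𝓡 n) proj p v = 0) :
    ∃ c : E p.1.proj, v = vertVector p c +
      mvfderiv (extModel n m) (Prod.snd : ExtPhase m E → ℝ) p v • sVector p := by
  set e := trivializationAt (EuclideanSpace ℝ (Fin m)) E p.1.proj with hedef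
  have he : p.1.proj ∈ e.baseSet := FiberBundle.mem_baseSet_trivializationAt' _
  let v' : (EuclideanSpace ℝ (Fin n) × EuclideanSpace ℝ (Fin m)) × ℝ := v
  have h1 : v'.1.1 = 0 := (mfderiv_proj_apply p v).symm.trans hv
  refine ⟨e.symm p.1.proj v'.1.2, ?_⟩
  have h2 := vertVector_eq (n := n) p (e.symm p.1.proj v'.1.2)
  have h3 : e.linearMapAt ℝ p.1.proj (e.symm p.1.proj v'.1.2) = v'.1.2 := by
    rw [e.linearMapAt_apply, if_pos he, e.apply_mk_symm he]
  have h4 : v' = (((0, v'.1.2), 0) :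
      (EuclideanSpace ℝ (Fin n) × EuclideanSpace ℝ (Fin m)) × ℝ) + v'.2 • (0, 1) := by
    refine Prod.ext (Prod.ext ?_ ?_) ?_
    · simp [h1]
    · simp
    · simp
  rw [h3] at h2
  rw [mfderiv_snd_apply]
  refine h4.trans ?_
  exact congrArg (· + v'.2 • ((0, 1) :
    (EuclideanSpace ℝ (Fin n) × EuclideanSpace ℝ (Fin m)) × ℝ)) h2.symm

lemma vertVector_add (p : ExtPhase m E) (a b : E p.1.proj) :
    (vertVector p (a + b) : TangentSpace (extModel n m) p) = vertVector p a + vertVector p b := by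
  refine (vertVector_eq p (a + b)).trans ?_
  rw [map_add]
  refine Eq.trans ?_ (congrArg₂ (· + ·) (vertVector_eq p a) (vertVector_eq p b)).symm
  exact Prod.ext (Prod.ext (add_zero _).symm rfl) (add_zero _).symm

lemma vertVector_smul (p : ExtPhase m E) (c : ℝ) (a : E p.1.proj) :
    (vertVector p (c • a) : TangentSpace (extModel n m) p) = c • vertVector p a := by
  refine (vertVector_eq p (c • a)).trans ?_
  rw [map_smul]
  refine Eq.trans ?_ (congrArg (c • ·) (vertVector_eq p a)).symm
  exact Prod.ext (Prod.ext (smul_zero _).symm rfl) (smul_zero _).symm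

/-- The vertical lift `E_q → T_p(E × ℝ)` as a linear map. -/
def vertMap (p : ExtPhase m E) : E p.1.proj →ₗ[ℝ] TangentSpace (extModel n m) p where
  toFun := vertVector p
  map_add' := vertVector_add p
  map_smul' := vertVector_smul p

/-! ### Linear systems with smooth coefficients. -/

section Matrix

variable {V : Type*} [NormedAddCommGroup V] [NormedSpace ℝ V]
  {H : Type*} [TopologicalSpace H] {I : ModelWithCorners ℝ V H}
  {M : Type*} [TopologicalSpace M] [ChartedSpace H M]

lemma contMDiffAt_det {k : ℕ} {W : M → Matrix (Fin k) (Fin k) ℝ} {x : M}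
    (hW : ∀ i j, ContMDiffAt I 𝓘(ℝ, ℝ) ∞ (fun y => W y i j) x) :
    ContMDiffAt I 𝓘(ℝ, ℝ) ∞ (fun y => (W y).det) x := by
  simp only [Matrix.det_apply']
  refine contMDiffAt_finsetSum fun σ _ => ?_
  refine contMDiffAt_const.mul (contMDiffAt_finsetProd fun i _ => hW _ _)

/-- The solution of a linear system with smooth coefficients and non-singular matrix is smooth. -/
lemma contMDiffAt_inv_mulVec {k : ℕ} {W : M → Matrix (Fin k) (Fin k) ℝ} {l : M → Fin k → ℝ} {x : M}
    (hW : ∀ i j, ContMDiffAt I 𝓘(ℝ, ℝ) ∞ (fun y => W y i j) x)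
    (hl : ∀ i, ContMDiffAt I 𝓘(ℝ, ℝ) ∞ (fun y => l y i) x) (h : (W x).det ≠ 0) (i : Fin k) :
    ContMDiffAt I 𝓘(ℝ, ℝ) ∞ (fun y => ((W y)⁻¹.mulVec (l y)) i) x := by
  simp only [Matrix.inv_def, Ring.inverse_eq_inv', Matrix.mulVec, dotProduct, Matrix.smul_apply, smul_eq_mul,
    Matrix.adjugate_apply]
  refine contMDiffAt_finsetSum fun j _ => ContMDiffAt.mul (ContMDiffAt.mul ?_ ?_) (hl j)
  · exact (contMDiffAt_det hW).inv₀ h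
  · refine contMDiffAt_det fun a b => ?_
    -- An adjugate entry is the determinant of `W` with row `j` replaced by a constant unit vector.
    by_cases hab : a = j
    · subst hab
      simpa using contMDiffAt_const
    · simpa [Matrix.updateRow_ne hab] using hW a b

end Matrix

/-! ### Smooth sections of E along a map. -/

section Along

variable {V : Type*} [NormedAddCommGroup V] [NormedSpace ℝ V]
  {H : Type*} [TopologicalSpace H] {I : ModelWithCorners ℝ V H}
  {N : Type*} [TopologicalSpace N] [ChartedSpace H N]

/-- `linearMapAt` is linear on every fibre, being zero off the base set. Smoothness of sums and
multiples is thus reduced to that of vector-valued functions by `map_add` and `map_smul`. -/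
lemma contMDiffAt_along_iff {g : N → Q} {s : ∀ x, E (g x)} {x₀ : N} :
    ContMDiffAt I ((𝓡 n).prod 𝓘(ℝ, EuclideanSpace ℝ (Fin m))) ∞
      (fun x => (⟨g x, s x⟩ : TotalSpace (EuclideanSpace ℝ (Fin m)) E)) x₀ ↔
    ContMDiffAt I (𝓡 n) ∞ g x₀ ∧ ContMDiffAt I 𝓘(ℝ, EuclideanSpace ℝ (Fin m)) ∞
      (fun x => (trivializationAt (EuclideanSpace ℝ (Fin m)) E (g x₀)).linearMapAt ℝ (g x) (s x)) x₀ := by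
  rw [contMDiffAt_totalSpace]
  refine and_congr_right fun hg => ?_
  set e := trivializationAt (EuclideanSpace ℝ (Fin m)) E (g x₀)
  have he : e.baseSet ∈ 𝓝 (g x₀) := e.open_baseSet.mem_nhds (FiberBundle.mem_baseSet_trivializationAt' _)
  refine Filter.EventuallyEq.contMDiffAt_iff ?_
  filter_upwards [hg.continuousAt.preimage_mem_nhds he] with x hx
  rw [e.linearMapAt_apply, if_pos (show g x ∈ e.baseSet from hx)]

lemma contMDiffAt_add_along {g : N → Q} {s t : ∀ x, E (g x)} {x₀ : N}
    (hs : ContMDiffAt I ((𝓡 n).prod 𝓘(ℝ, EuclideanSpace ℝ (Fin m))) ∞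
      (fun x => (⟨g x, s x⟩ : TotalSpace (EuclideanSpace ℝ (Fin m)) E)) x₀)
    (ht : ContMDiffAt I ((𝓡 n).prod 𝓘(ℝ, EuclideanSpace ℝ (Fin m))) ∞
      (fun x => (⟨g x, t x⟩ : TotalSpace (EuclideanSpace ℝ (Fin m)) E)) x₀) :
    ContMDiffAt I ((𝓡 n).prod 𝓘(ℝ, EuclideanSpace ℝ (Fin m))) ∞
      (fun x => (⟨g x, s x + t x⟩ : TotalSpace (EuclideanSpace ℝ (Fin m)) E)) x₀ := by
  rw [contMDiffAt_along_iff] at *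
  refine ⟨hs.1, ?_⟩
  simp only [map_add]
  exact hs.2.add ht.2

lemma contMDiffAt_smul_along {g : N → Q} {a : N → ℝ} {s : ∀ x, E (g x)} {x₀ : N}
    (ha : ContMDiffAt I 𝓘(ℝ, ℝ) ∞ a x₀)
    (hs : ContMDiffAt I ((𝓡 n).prod 𝓘(ℝ, EuclideanSpace ℝ (Fin m))) ∞
      (fun x => (⟨g x, s x⟩ : TotalSpace (EuclideanSpace ℝ (Fin m)) E)) x₀) :
    ContMDiffAt I ((𝓡 n).prod 𝓘(ℝ, EuclideanSpace ℝ (Fin m))) ∞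
      (fun x => (⟨g x, a x • s x⟩ : TotalSpace (EuclideanSpace ℝ (Fin m)) E)) x₀ := by
  rw [contMDiffAt_along_iff] at *
  refine ⟨hs.1, ?_⟩
  simp only [map_smul]
  exact ha.smul hs.2

lemma contMDiffAt_sum_along {ι : Type*} (T : Finset ι) {g : N → Q} {s : ι → ∀ x, E (g x)} {x₀ : N}
    (hg : ContMDiffAt I (𝓡 n) ∞ g x₀)
    (hs : ∀ i ∈ T, ContMDiffAt I ((𝓡 n).prod 𝓘(ℝ, EuclideanSpace ℝ (Fin m))) ∞
      (fun x => (⟨g x, s i x⟩ : TotalSpace (EuclideanSpace ℝ (Fin m)) E)) x₀) :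
    ContMDiffAt I ((𝓡 n).prod 𝓘(ℝ, EuclideanSpace ℝ (Fin m))) ∞
      (fun x => (⟨g x, ∑ i ∈ T, s i x⟩ : TotalSpace (EuclideanSpace ℝ (Fin m)) E)) x₀ := by
  simp only [contMDiffAt_along_iff, map_sum] at *
  exact ⟨hg, contMDiffAt_finsetSum fun i hi => (hs i hi).2⟩

end Along

/-- A curve through a point `p` starts at a point that is only propositionally equal to `p`. All
tangent spaces are the model space, so its velocity can be compared there with a vector at `p`. -/
lemma tangentBundle_mk_congr {V : Type*} [NormedAddCommGroup V] [NormedSpace ℝ V]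
    {H : Type*} [TopologicalSpace H] {I : ModelWithCorners ℝ V H}
    {M : Type*} [TopologicalSpace M] [ChartedSpace H M] {x y : M} (h : x = y)
    {v : TangentSpace I x} {w : TangentSpace I y} (hv : (v : V) = (w : V)) :
    (⟨x, v⟩ : TangentBundle I M) = ⟨y, w⟩ := by
  subst h; exact congrArg _ hv

/-- `sVector p` is defined by its components in the preferred chart at `p`, which varies with `p`,
so smoothness cannot be read off the definition. It follows from `contMDiffAt_velocity`, the field
being the velocity of t ↦ (b, s + t). -/
lemma contMDiff_sVector : ContMDiff (extModel n m) (extModel n m).tangent ∞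
    (fun p => (⟨p, sVector p⟩ : TangentBundle (extModel n m) (ExtPhase m E))) := by
  intro p₀
  have h := contMDiffAt_velocity (I := extModel n m) (I' := extModel n m)
    (fun (p : ExtPhase m E) (t : ℝ) => ((p.1, p.2 + t) : ExtPhase m E)) p₀ (by
      refine ContMDiffAt.prodMk (contMDiffAt_fst.fst) ?_
      exact (contMDiffAt_fst.snd).add contMDiffAt_snd)
  refine h.congr_of_eventuallyEq (Filter.Eventually.of_forall fun p => ?_)
  refine (tangentBundle_mk_congr
    (show ((p.1, p.2 + 0) : ExtPhase m E) = p from Prod.ext rfl (add_zero _)) ?_).symm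
  have h1 : mfderiv 𝓘(ℝ, ℝ) (extModel n m) (fun t : ℝ => ((p.1, p.2 + t) : ExtPhase m E)) 0 =
      (mfderiv 𝓘(ℝ, ℝ) ((𝓡 n).prod 𝓘(ℝ, EuclideanSpace ℝ (Fin m))) (fun _ : ℝ => p.1) 0).prod
        (mfderiv 𝓘(ℝ, ℝ) 𝓘(ℝ, ℝ) (fun t : ℝ => p.2 + t) 0) :=
    mfderiv_prodMk mdifferentiableAt_const
      ((differentiableAt_id.const_add p.2).mdifferentiableAt)
  have h2 : mfderiv 𝓘(ℝ, ℝ) ((𝓡 n).prod 𝓘(ℝ, EuclideanSpace ℝ (Fin m))) (fun _ : ℝ => p.1) 0 = 0 :=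
    mfderiv_const
  have h3 : mfderiv 𝓘(ℝ, ℝ) 𝓘(ℝ, ℝ) (fun t : ℝ => p.2 + t) 0 = ContinuousLinearMap.id ℝ ℝ := by
    refine mfderiv_eq_fderiv.trans ?_
    exact ((hasFDerivAt_id (𝕜 := ℝ) (0 : ℝ)).const_add p.2).fderiv
  rw [h2, h3] at h1
  exact congrArg (fun T => T (1 : ℝ)) h1

lemma contMDiff_vertVector (τ : Sec n m E) : ContMDiff (extModel n m) (extModel n m).tangent ∞
    (fun p => (⟨p, vertVector p (τ p.1.proj)⟩ : TangentBundle (extModel n m) (ExtPhase m E))) := by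
  intro p₀
  have h := contMDiffAt_velocity (I := extModel n m) (I' := extModel n m)
    (fun (p : ExtPhase m E) (t : ℝ) => vertCurve p (τ p.1.proj) t) p₀ (by
      refine ContMDiffAt.prodMk ?_ contMDiffAt_fst.snd
      refine contMDiffAt_add_along ?_ (contMDiffAt_smul_along contMDiffAt_snd ?_)
      · exact contMDiffAt_fst.fst
      · exact (τ.contMDiff.comp (contMDiff_proj_ext.comp contMDiff_fst)).contMDiffAt)
  refine h.congr_of_eventuallyEq (Filter.Eventually.of_forall fun p => ?_)
  exact (tangentBundle_mk_congr (vertCurve_zero _ _) rfl).symm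

/-! ### Local charts and frames, and extension of local objects to global ones. -/

section LocalDataExists

variable (E) in
/-- The local data given by the preferred chart and trivialization at a point. -/
def LocalData.ofPoint (q : Q) : LocalData n m E where
  U := (chartAt (EuclideanSpace ℝ (Fin n)) q).source ∩
    (trivializationAt (EuclideanSpace ℝ (Fin m)) E q).baseSet
  isOpen_U := (chartAt (EuclideanSpace ℝ (Fin n)) q).open_source.inter
    (trivializationAt (EuclideanSpace ℝ (Fin m)) E q).open_baseSet
  chart := chartAt (EuclideanSpace ℝ (Fin n)) q
  chart_mem := IsManifold.chart_mem_maximalAtlas q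
  subset_source := inter_subset_left
  frame := (trivializationAt (EuclideanSpace ℝ (Fin m)) E q).localFrame
    (EuclideanSpace.basisFun (Fin m) ℝ).toBasis
  isFrame := ((trivializationAt (EuclideanSpace ℝ (Fin m)) E q).isLocalFrameOn_localFrame_baseSet
    (𝓡 n) ∞ (EuclideanSpace.basisFun (Fin m) ℝ).toBasis).mono inter_subset_right

lemma LocalData.mem_ofPoint (q : Q) : q ∈ (LocalData.ofPoint (n := n) (m := m) E q).U :=
  ⟨mem_chart_source _ q, FiberBundle.mem_baseSet_trivializationAt' q⟩

/-- Smooth local sections of `E` extend, near a given point, to global ones. -/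
lemma exists_section_eventuallyEq {U : Set Q} (hU : IsOpen U) {s : ∀ q, E q}
    (hs : ContMDiffOn (𝓡 n) ((𝓡 n).prod 𝓘(ℝ, EuclideanSpace ℝ (Fin m))) ∞
      (fun x => TotalSpace.mk' (EuclideanSpace ℝ (Fin m)) x (s x)) U) {q : Q} (hq : q ∈ U) :
    ∃ σ : Sec n m E, ∀ᶠ q' in 𝓝 q, σ q' = s q' := by
  have hb : U ∈ 𝓝 q := hU.mem_nhds hq
  obtain ⟨χ, hχ, -⟩ := (SmoothBumpFunction.nhds_basis_support (I := 𝓡 n) hb).mem_iff.mp hb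
  refine ⟨⟨fun x => χ x • s x,
    ContMDiffOn.smul_section_of_tsupport χ.contMDiff.contMDiffOn hU hχ hs⟩, ?_⟩
  filter_upwards [χ.eventuallyEq_one] with x hx
  change χ x • s x = _
  rw [hx]; simp

/-- Smooth local functions extend, near a given point, to global ones. -/
lemma exists_function_eventuallyEq {f : Q → ℝ} {U : Set Q} (hU : IsOpen U)
    (hf : ContMDiffOn (𝓡 n) 𝓘(ℝ, ℝ) ∞ f U) {q : Q} (hq : q ∈ U) :
    ∃ g : Q → ℝ, ContMDiff (𝓡 n) 𝓘(ℝ, ℝ) ∞ g ∧ g =ᶠ[𝓝 q] f := by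
  have hb : U ∈ 𝓝 q := hU.mem_nhds hq
  obtain ⟨χ, hχ, -⟩ := (SmoothBumpFunction.nhds_basis_support (I := 𝓡 n) hb).mem_iff.mp hb
  refine ⟨fun x => χ x • f x, ?_, ?_⟩
  · refine contMDiff_of_tsupport fun x hx => ?_
    have hx' : x ∈ U := hχ (closure_mono (Function.support_smul_subset_left _ _) hx)
    exact χ.contMDiff.contMDiffAt.smul (hf.contMDiffAt (hU.mem_nhds hx'))
  · filter_upwards [χ.eventuallyEq_one] with x hx
    rw [hx]; simp

lemma exists_section_eq (q : Q) (a : E q) : ∃ σ : Sec n m E, σ q = a := by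
  obtain ⟨σ, h⟩ := exists_frame_section (n := n) (E := E) q
    (trivializationAt (EuclideanSpace ℝ (Fin m)) E q ⟨q, a⟩).2
  exact ⟨σ, h.self_of_nhds.trans
    (Trivialization.symm_apply_apply_mk _ (FiberBundle.mem_baseSet_trivializationAt' q) a)⟩

namespace LocalData

variable (D : LocalData n m E)

lemma exists_extend {q : Q} (hq : q ∈ D.U) :
    ∃ σ : Fin m → Sec n m E, ∀ᶠ q' in 𝓝 q, ∀ α, σ α q' = D.frame α q' := by
  choose σ hσ using fun α => exists_section_eventuallyEq D.isOpen_U (D.isFrame.contMDiffOn α) hq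
  exact ⟨σ, Filter.eventually_all.mpr hσ⟩

lemma eq_sum_coeff {q : Q} (hq : q ∈ D.U) (a : E q) :
    a = ∑ α, D.isFrame.coeff α q a • D.frame α q := by
  have := (Module.Basis.sum_repr (D.isFrame.toBasisAt hq) a).symm
  simpa [IsLocalFrameOn.coeff, hq] using this

lemma coeff_sum {q : Q} (hq : q ∈ D.U) (y : Fin m → ℝ) (α : Fin m) :
    D.isFrame.coeff α q (∑ β, y β • D.frame β q) = y α := by
  have h : ∑ β, y β • D.frame β q = ∑ β, y β • D.isFrame.toBasisAt hq β := by simp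
  simp only [IsLocalFrameOn.coeff, hq, dite_true]
  rw [h, Module.Basis.coord_apply, Module.Basis.repr_sum_self]

section

variable {V : Type*} [NormedAddCommGroup V] [NormedSpace ℝ V]
  {H : Type*} [TopologicalSpace H] {I : ModelWithCorners ℝ V H}
  {N : Type*} [TopologicalSpace N] [ChartedSpace H N]

/-- In a trivialization the components of `s` in the frame solve a linear system whose matrix `P`
consists of the frame vectors. `P` is smooth and nonsingular, so `contMDiffAt_inv_mulVec` applies.
-/
lemma contMDiffAt_coeff {g : N → Q} {s : ∀ x, E (g x)} {x₀ : N} (h : g x₀ ∈ D.U)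
    (hs : ContMDiffAt I ((𝓡 n).prod 𝓘(ℝ, EuclideanSpace ℝ (Fin m))) ∞
      (fun x => (⟨g x, s x⟩ : TotalSpace (EuclideanSpace ℝ (Fin m)) E)) x₀) (α : Fin m) :
    ContMDiffAt I 𝓘(ℝ, ℝ) ∞ (fun x => D.isFrame.coeff α (g x) (s x)) x₀ := by
  have hg := (contMDiffAt_along_iff.mp hs).1
  set e := trivializationAt (EuclideanSpace ℝ (Fin m)) E (g x₀) with hedef
  have he : g x₀ ∈ e.baseSet := FiberBundle.mem_baseSet_trivializationAt' _
  have hfr : ∀ α, ContMDiffAt I ((𝓡 n).prod 𝓘(ℝ, EuclideanSpace ℝ (Fin m))) ∞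
      (fun x => (⟨g x, D.frame α (g x)⟩ : TotalSpace (EuclideanSpace ℝ (Fin m)) E)) x₀ := fun α =>
    ContMDiffAt.comp x₀ ((D.isFrame.contMDiffOn α).contMDiffAt (D.isOpen_U.mem_nhds h)) hg
  let pr : Fin m → EuclideanSpace ℝ (Fin m) →L[ℝ] ℝ := fun i => EuclideanSpace.proj i
  let P : N → Matrix (Fin m) (Fin m) ℝ := fun x =>
    Matrix.of fun i β => e.linearMapAt ℝ (g x) (D.frame β (g x)) i
  let l : N → Fin m → ℝ := fun x i => e.linearMapAt ℝ (g x) (s x) i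
  have hP : ∀ i β, ContMDiffAt I 𝓘(ℝ, ℝ) ∞ (fun x => P x i β) x₀ := fun i β =>
    (pr i).contDiff.contMDiff.contMDiffAt.comp x₀ (contMDiffAt_along_iff.mp (hfr β)).2
  have hl : ∀ i, ContMDiffAt I 𝓘(ℝ, ℝ) ∞ (fun x => l x i) x₀ := fun i =>
    (pr i).contDiff.contMDiff.contMDiffAt.comp x₀ (contMDiffAt_along_iff.mp hs).2
  have hdet : ∀ q (hq : q ∈ D.U) (_ : q ∈ e.baseSet),
      (Matrix.of fun i β => e.linearMapAt ℝ q (D.frame β q) i : Matrix (Fin m) (Fin m) ℝ).det ≠ 0 := by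
    intro q hq hqe
    let b₂ := (D.isFrame.toBasisAt hq).map (e.linearEquivAt ℝ q hqe)
    have h1 : (Matrix.of fun i β => e.linearMapAt ℝ q (D.frame β q) i : Matrix (Fin m) (Fin m) ℝ) =
        (EuclideanSpace.basisFun (Fin m) ℝ).toBasis.toMatrix b₂ := by
      ext i β
      simp [Module.Basis.toMatrix_apply, b₂, e.linearMapAt_apply, hqe]
    rw [h1]
    exact (Module.Basis.isUnit_det _ b₂).ne_zero
  refine (contMDiffAt_inv_mulVec hP hl (hdet _ h he) α).congr_of_eventuallyEq ?_
  filter_upwards [hg.continuousAt.preimage_mem_nhds (D.isOpen_U.mem_nhds h),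
    hg.continuousAt.preimage_mem_nhds (e.open_baseSet.mem_nhds he)] with x hx hxe
  have h2 : l x = (P x).mulVec (fun β => D.isFrame.coeff β (g x) (s x)) := by
    ext i
    change e.linearMapAt ℝ (g x) (s x) i = _
    conv_lhs => rw [D.eq_sum_coeff hx (s x)]
    simp [Matrix.mulVec, dotProduct, P, mul_comm]
  have hu : IsUnit (P x).det := isUnit_iff_ne_zero.mpr (hdet _ hx hxe)
  rw [h2, Matrix.mulVec_mulVec, Matrix.nonsing_inv_mul _ hu, Matrix.one_mulVec]

end

lemma contMDiffAt_yCoord {p : ExtPhase m E} (h : p.1.proj ∈ D.U) (α : Fin m) :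
    ContMDiffAt (extModel n m) 𝓘(ℝ, ℝ) ∞ (D.yCoord α) p :=
  D.contMDiffAt_coeff (g := fun p : ExtPhase m E => p.1.proj) (s := fun p => p.1.snd) h
    contMDiffAt_fst α

lemma contMDiffAt_chart {q : Q} (h : q ∈ D.U) :
    ContMDiffAt (𝓡 n) 𝓘(ℝ, EuclideanSpace ℝ (Fin n)) ∞ D.chart q :=
  contMDiffAt_of_mem_maximalAtlas D.chart_mem (D.subset_source h)

lemma contMDiffAt_point {x : EuclideanSpace ℝ (Fin n)} (hx : x ∈ D.chart.target)
    (h : D.chart.symm x ∈ D.U) (y : Fin m → ℝ) (s : ℝ) :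
    ContMDiffAt 𝓘(ℝ, (EuclideanSpace ℝ (Fin n) × (Fin m → ℝ)) × ℝ) (extModel n m) ∞
      (fun z : (EuclideanSpace ℝ (Fin n) × (Fin m → ℝ)) × ℝ => D.point z.1.1 z.1.2 z.2)
      ((x, y), s) := by
  have h1 : ContMDiffAt 𝓘(ℝ, (EuclideanSpace ℝ (Fin n) × (Fin m → ℝ)) × ℝ) (𝓡 n) ∞
      (fun z : (EuclideanSpace ℝ (Fin n) × (Fin m → ℝ)) × ℝ => D.chart.symm z.1.1) ((x, y), s) := by
    refine ContMDiffAt.comp (g := D.chart.symm) (I' := 𝓡 n) _ ?_ ?_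
    · exact (contMDiffOn_symm_of_mem_maximalAtlas D.chart_mem).contMDiffAt
        (D.chart.open_target.mem_nhds hx)
    · exact (contDiff_fst.fst).contMDiff.contMDiffAt
  refine ContMDiffAt.prodMk ?_ (contDiff_snd.contMDiff.contMDiffAt)
  refine contMDiffAt_sum_along _ h1 fun α _ => contMDiffAt_smul_along ?_ ?_
  · have : ContDiff ℝ ∞ (fun z : (EuclideanSpace ℝ (Fin n) × (Fin m → ℝ)) × ℝ => z.1.2 α) :=
      (contDiff_apply ℝ ℝ α).comp contDiff_fst.snd
    exact this.contMDiff.contMDiffAt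
  · exact ContMDiffAt.comp ((x, y), s)
      ((D.isFrame.contMDiffOn α).contMDiffAt (D.isOpen_U.mem_nhds h)) h1

lemma point_coord {p : ExtPhase m E} (h : p.1.proj ∈ D.U) :
    D.point (D.chart p.1.proj) (fun α => D.yCoord α p) p.2 = p := by
  obtain ⟨⟨q, a⟩, s⟩ := p
  refine Prod.ext ?_ rfl
  change (⟨D.chart.symm (D.chart q), _⟩ : TotalSpace (EuclideanSpace ℝ (Fin m)) E) = ⟨q, a⟩
  have h1 : D.chart.symm (D.chart q) = q := D.chart.left_inv (D.subset_source h)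
  rw [h1]
  exact congrArg _ (D.eq_sum_coeff h a).symm

end LocalData

end LocalDataExists

/-! ### Derivatives along vectors given as velocities of curves. -/

section Curves

variable {V : Type*} [NormedAddCommGroup V] [NormedSpace ℝ V]
  {H : Type*} [TopologicalSpace H] {I : ModelWithCorners ℝ V H}
  {M : Type*} [TopologicalSpace M] [ChartedSpace H M]
  {V' : Type*} [NormedAddCommGroup V'] [NormedSpace ℝ V']
  {H' : Type*} [TopologicalSpace H'] {I' : ModelWithCorners ℝ V' H'}
  {M' : Type*} [TopologicalSpace M'] [ChartedSpace H' M']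

/-- This is the chain rule. The base point `x` is kept apart from `γ t` because `vertCurve` and
`liftCurve` pass through `p` at time 0 only propositionally. -/
lemma mfderiv_apply_velocity {γ : ℝ → M} {g : M → M'} {t : ℝ} {x : M} (h : γ t = x)
    (hγ : MDifferentiableAt 𝓘(ℝ, ℝ) I γ t) (hg : MDifferentiableAt I I' g x) :
    (mfderiv I I' g x (mfderiv 𝓘(ℝ, ℝ) I γ t (1 : ℝ) : V) : V') =
      mfderiv 𝓘(ℝ, ℝ) I' (g ∘ γ) t (1 : ℝ) := by
  subst h
  exact (mfderiv_comp_apply t hg hγ (1 : ℝ)).symm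

lemma mvfderiv_apply_velocity {γ : ℝ → M} {f : M → ℝ} {t : ℝ} {x : M} (h : γ t = x)
    (hγ : MDifferentiableAt 𝓘(ℝ, ℝ) I γ t) (hf : MDifferentiableAt I 𝓘(ℝ, ℝ) f x) :
    mvfderiv I f x (mfderiv 𝓘(ℝ, ℝ) I γ t (1 : ℝ) : V) = deriv (f ∘ γ) t := by
  refine (mfderiv_apply_velocity h hγ hf).trans ?_
  have : mfderiv 𝓘(ℝ, ℝ) 𝓘(ℝ, ℝ) (f ∘ γ) t = fderiv ℝ (f ∘ γ) t := mfderiv_eq_fderiv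
  exact congrArg (fun T => T (1 : ℝ)) this

lemma contMDiffOn_mfderiv_apply [IsManifold I ∞ M] {f : M → V'} {U : Set M} (hU : IsOpen U)
    (hf : ContMDiffOn I 𝓘(ℝ, V') ∞ f U) {X : ∀ x : M, TangentSpace I x}
    (hX : ContMDiff I I.tangent ∞ (fun y => (⟨y, X y⟩ : TangentBundle I M))) :
    ContMDiffOn I 𝓘(ℝ, V') ∞ (fun y => (mfderiv I 𝓘(ℝ, V') f y (X y) : V')) U := by
  have h1 := hf.contMDiffOn_tangentMapWithin (m := ∞) (by simp) hU.uniqueMDiffOn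
  have h2 := (contMDiff_snd_tangentBundle_modelSpace (n := ∞) V' 𝓘(ℝ, V')).comp_contMDiffOn
    (h1.comp hX.contMDiffOn (s := U) fun x hx => hx)
  refine h2.congr fun x hx => ?_
  exact congrArg (fun T : V →L[ℝ] V' => T (X x))
    (mfderivWithin_of_isOpen (I := I) (I' := 𝓘(ℝ, V')) (f := f) hU hx).symm

end Curves

/-! ### Lifting sections of E to the prolongation. -/

section Lift

variable (A : LieAlgebroid n m E) (D : LocalData n m E) (σ : Sec n m E)

namespace LocalData

/-- The components in the chart of the vector `ρ(σ)`. -/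
def anchorVec (q : Q) : EuclideanSpace ℝ (Fin n) :=
  mfderiv (𝓡 n) 𝓘(ℝ, EuclideanSpace ℝ (Fin n)) D.chart q (A.anchor q (σ q))

/-- The curve through `p` with constant `y` and `s` and with velocity over `ρ(σ)`. -/
def liftCurve (p : ExtPhase m E) (t : ℝ) : ExtPhase m E :=
  D.point (D.chart p.1.proj + t • D.anchorVec A σ p.1.proj) (fun α => D.yCoord α p) p.2

/-- The vector at `p` over `ρ(σ)` whose components along the fibre coordinates vanish. -/
def liftVec (p : ExtPhase m E) : TangentSpace (extModel n m) p :=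
  mfderiv 𝓘(ℝ, ℝ) (extModel n m) (D.liftCurve A σ p) 0 (1 : ℝ)

variable {A σ}

lemma liftCurve_zero {p : ExtPhase m E} (h : p.1.proj ∈ D.U) : D.liftCurve A σ p 0 = p := by
  simp only [liftCurve, zero_smul, add_zero]
  exact D.point_coord h

lemma isOpen_proj_preimage : IsOpen ((proj : ExtPhase m E → Q) ⁻¹' D.U) :=
  D.isOpen_U.preimage (contMDiff_proj_ext (n := n)).continuous

lemma contMDiffAt_uncurry_liftCurve {p : ExtPhase m E} (h : p.1.proj ∈ D.U) :
    ContMDiffAt ((extModel n m).prod 𝓘(ℝ, ℝ)) (extModel n m) ∞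
      (Function.uncurry (D.liftCurve A σ)) (p, 0) := by
  have hq : D.chart p.1.proj + (0 : ℝ) • D.anchorVec A σ p.1.proj = D.chart p.1.proj := by simp
  have h0 : D.chart p.1.proj ∈ D.chart.target := D.chart.map_source (D.subset_source h)
  have hpt := D.contMDiffAt_point (x := D.chart p.1.proj + (0 : ℝ) • D.anchorVec A σ p.1.proj)
    (by rwa [hq]) (by rwa [hq, D.chart.left_inv (D.subset_source h)]) (fun α => D.yCoord α p) p.2
  refine ContMDiffAt.comp (p, (0 : ℝ)) (f := fun z : ExtPhase m E × ℝ =>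
    (((D.chart z.1.1.proj + z.2 • D.anchorVec A σ z.1.1.proj, fun α => D.yCoord α z.1), z.1.2) :
      (EuclideanSpace ℝ (Fin n) × (Fin m → ℝ)) × ℝ)) hpt ?_
  have hpr : ContMDiffAt ((extModel n m).prod 𝓘(ℝ, ℝ)) (𝓡 n) ∞
      (fun z : ExtPhase m E × ℝ => z.1.1.proj) (p, 0) :=
    (contMDiff_proj_ext.comp contMDiff_fst).contMDiffAt
  have hv : ContMDiffAt (𝓡 n) 𝓘(ℝ, EuclideanSpace ℝ (Fin n)) ∞ (D.anchorVec A σ) p.1.proj :=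
    (contMDiffOn_mfderiv_apply D.isOpen_U
      (fun q hq => (D.contMDiffAt_chart hq).contMDiffWithinAt)
      (A.contMDiff_anchor_section σ)).contMDiffAt (D.isOpen_U.mem_nhds h)
  refine ContMDiffAt.prodMk_space (ContMDiffAt.prodMk_space ?_ ?_) contMDiffAt_fst.snd
  · exact ((D.contMDiffAt_chart h).comp (p, (0 : ℝ)) hpr).add
      (contMDiffAt_snd.smul (hv.comp (p, (0 : ℝ)) hpr))
  · exact contMDiffAt_pi_space.mpr fun α => (D.contMDiffAt_yCoord h α).comp (p, (0 : ℝ)) contMDiffAt_fst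

lemma mdifferentiableAt_liftCurve {p : ExtPhase m E} (h : p.1.proj ∈ D.U) :
    MDifferentiableAt 𝓘(ℝ, ℝ) (extModel n m) (D.liftCurve A σ p) 0 := by
  have : ContMDiffAt 𝓘(ℝ, ℝ) (extModel n m) ∞ (D.liftCurve A σ p) 0 :=
    (D.contMDiffAt_uncurry_liftCurve h).comp (0 : ℝ) (contMDiffAt_const.prodMk contMDiffAt_id)
  exact this.mdifferentiableAt (by simp)

/-- In the chart, the projected curve is a line whose direction is the image of ρ(σ) under the
derivative of the chart. Its velocity in `Q` is therefore the derivative of `D.chart.symm ∘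
D.chart`, locally the identity, applied to ρ(σ). -/
lemma mfderiv_proj_liftVec {p : ExtPhase m E} (h : p.1.proj ∈ D.U) :
    mfderiv (extModel n m) (𝓡 n) proj p (D.liftVec A σ p) = A.anchor p.1.proj (σ p.1.proj) := by
  set q := p.1.proj with hq
  refine (mfderiv_apply_velocity (D.liftCurve_zero h) (D.mdifferentiableAt_liftCurve h)
    (contMDiff_proj_ext.mdifferentiable (by simp) p)).trans ?_
  have hcomp : (proj : ExtPhase m E → Q) ∘ D.liftCurve A σ p =
      D.chart.symm ∘ fun t : ℝ => D.chart q + t • D.anchorVec A σ q := rfl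
  have h0 : D.chart q ∈ D.chart.target := D.chart.map_source (D.subset_source h)
  have hs : MDifferentiableAt 𝓘(ℝ, EuclideanSpace ℝ (Fin n)) (𝓡 n) D.chart.symm (D.chart q) :=
    ((contMDiffOn_symm_of_mem_maximalAtlas (I := 𝓡 n) (n := ∞) D.chart_mem).contMDiffAt
      (D.chart.open_target.mem_nhds h0)).mdifferentiableAt (by simp)
  have hc : MDifferentiableAt (𝓡 n) 𝓘(ℝ, EuclideanSpace ℝ (Fin n)) D.chart q :=
    (D.contMDiffAt_chart h).mdifferentiableAt (by simp)
  have hl : HasDerivAt (fun t : ℝ => D.chart q + t • D.anchorVec A σ q) (D.anchorVec A σ q) 0 := by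
    simpa using ((hasDerivAt_id (0 : ℝ)).smul_const (D.anchorVec A σ q)).const_add (D.chart q)
  have h1 := mfderiv_apply_velocity (I := 𝓘(ℝ, EuclideanSpace ℝ (Fin n))) (I' := 𝓡 n)
    (γ := fun t : ℝ => D.chart q + t • D.anchorVec A σ q) (g := D.chart.symm) (t := 0)
    (x := D.chart q) (by simp) hl.differentiableAt.mdifferentiableAt hs
  rw [hcomp]
  refine h1.symm.trans ?_
  have h2 : mfderiv 𝓘(ℝ, ℝ) 𝓘(ℝ, EuclideanSpace ℝ (Fin n))
      (fun t : ℝ => D.chart q + t • D.anchorVec A σ q) 0 (1 : ℝ) = D.anchorVec A σ q := by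
    have : mfderiv 𝓘(ℝ, ℝ) 𝓘(ℝ, EuclideanSpace ℝ (Fin n))
      (fun t : ℝ => D.chart q + t • D.anchorVec A σ q) 0 = fderiv ℝ _ 0 := mfderiv_eq_fderiv
    refine (congrArg (fun T => T (1 : ℝ)) this).trans ?_
    exact (fderiv_eq_smul_deriv (f := fun t : ℝ => D.chart q + t • D.anchorVec A σ q) (x := 0)
      (1 : ℝ)).trans ((one_smul ℝ _).trans hl.deriv)
  refine (congrArg (fun v => mfderiv 𝓘(ℝ, EuclideanSpace ℝ (Fin n)) (𝓡 n) D.chart.symm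
    (D.chart q) v) h2).trans ?_
  have h3 := mfderiv_comp_apply q hs hc (A.anchor q (σ q))
  refine h3.symm.trans ?_
  have h4 : D.chart.symm ∘ D.chart =ᶠ[𝓝 q] id := by
    filter_upwards [D.chart.open_source.mem_nhds (D.subset_source h)] with x hx
    exact D.chart.left_inv hx
  have h5 : mfderiv (𝓡 n) (𝓡 n) (D.chart.symm ∘ D.chart) q = mfderiv (𝓡 n) (𝓡 n) id q := h4.mfderiv_eq
  refine (congrArg (fun T : EuclideanSpace ℝ (Fin n) →L[ℝ] EuclideanSpace ℝ (Fin n) =>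
    T (A.anchor q (σ q))) h5).trans ?_
  exact congrArg (fun T : EuclideanSpace ℝ (Fin n) →L[ℝ] EuclideanSpace ℝ (Fin n) =>
    T (A.anchor q (σ q))) mfderiv_id

lemma mvfderiv_snd_liftVec {p : ExtPhase m E} (h : p.1.proj ∈ D.U) :
    mvfderiv (extModel n m) (Prod.snd : ExtPhase m E → ℝ) p (D.liftVec A σ p) = 0 := by
  refine (mvfderiv_apply_velocity (D.liftCurve_zero h) (D.mdifferentiableAt_liftCurve h)
    mdifferentiableAt_snd).trans ?_
  exact deriv_const _ _

lemma contMDiffOn_liftVec : ContMDiffOn (extModel n m) (extModel n m).tangent ∞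
    (fun p => (⟨p, D.liftVec A σ p⟩ : TangentBundle (extModel n m) (ExtPhase m E)))
    (proj ⁻¹' D.U) := by
  intro p hp
  refine ContMDiffAt.contMDiffWithinAt ?_
  refine (contMDiffAt_velocity _ _ (D.contMDiffAt_uncurry_liftCurve (A := A) (σ := σ) hp)).congr_of_eventuallyEq ?_
  filter_upwards [D.isOpen_proj_preimage.mem_nhds hp] with p' hp'
  exact (tangentBundle_mk_congr (D.liftCurve_zero hp') rfl).symm

end LocalData

/-- Every section `σ` of `E` is, near a given point, the projection of a section of the
prolongation that annihilates `ds`. -/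
lemma exists_lift (q : Q) (σ : Sec n m E) : ∃ G : ProlSection A,
    (∀ p : ExtPhase m E, mvfderiv (extModel n m) (Prod.snd : ExtPhase m E → ℝ) p (G.vec p) = 0) ∧
    ∀ᶠ q' in 𝓝 q, ∀ a : E q', ∀ s : ℝ, G.base (⟨q', a⟩, s) = σ q' := by
  set D := LocalData.ofPoint (n := n) (m := m) E q
  have hD : q ∈ D.U := LocalData.mem_ofPoint q
  have hb : D.U ∈ 𝓝 q := D.isOpen_U.mem_nhds hD
  obtain ⟨χ, hχ, -⟩ := (SmoothBumpFunction.nhds_basis_support (I := 𝓡 n) hb).mem_iff.mp hb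
  have hχ0 : ∀ p : ExtPhase m E, p.1.proj ∉ D.U → χ p.1.proj = 0 := fun p hp => by
    by_contra h
    exact hp (hχ (subset_tsupport _ h))
  have hχs : ContMDiff (extModel n m) 𝓘(ℝ, ℝ) ∞ (fun p : ExtPhase m E => χ p.1.proj) :=
    χ.contMDiff.comp contMDiff_proj_ext
  -- Multiplying both components by the bump function preserves the linear condition ρ(a) = Tπ(v).
  -- It also removes the values of `liftVec` off `D.U`, where they carry no information.
  refine ⟨⟨fun p => ⟨(χ p.1.proj • σ p.1.proj, χ p.1.proj • D.liftVec A σ p), ?_⟩, ?_, ?_⟩, ?_, ?_⟩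
  · change A.anchor p.1.proj (χ p.1.proj • σ p.1.proj) =
      mfderiv (extModel n m) (𝓡 n) proj p (χ p.1.proj • D.liftVec A σ p)
    rw [map_smul, map_smul]
    by_cases hp : p.1.proj ∈ D.U
    · rw [D.mfderiv_proj_liftVec hp]
    · rw [hχ0 p hp, zero_smul, zero_smul]
  · exact fun p => contMDiffAt_smul_along hχs.contMDiffAt
      (σ.contMDiff.comp contMDiff_proj_ext).contMDiffAt
  · refine ContMDiffOn.smul_section_of_tsupport hχs.contMDiffOn D.isOpen_proj_preimage ?_
      D.contMDiffOn_liftVec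
    refine Subset.trans ?_ (preimage_mono hχ)
    exact closure_minimal (fun p hp => subset_tsupport _ hp)
      ((isClosed_tsupport _).preimage (contMDiff_proj_ext (n := n)).continuous)
  · intro p
    change mvfderiv (extModel n m) Prod.snd p (χ p.1.proj • D.liftVec A σ p) = 0
    rw [map_smul]
    by_cases hp : p.1.proj ∈ D.U
    · rw [D.mvfderiv_snd_liftVec hp, smul_zero]
    · rw [hχ0 p hp, zero_smul]
  · filter_upwards [χ.eventuallyEq_one] with q' hq' a s
    change χ q' • σ q' = σ q'
    rw [hq']; simp

end Lift

/-! ### Locality of the bracket and its expression in an arbitrary frame. -/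

section Bracket

variable (A : LieAlgebroid n m E)

/-- Take a bump function χ at `q` supported where τ vanishes. Then χτ = 0, and the Leibniz rule at
`q`, with χ(q) = 1 and τ(q) = 0, reduces [σ, χτ](q) = 0 to [σ, τ](q) = 0. -/
lemma LieAlgebroid.bracket_eq_zero_of_eventually (σ : Sec n m E) {τ : Sec n m E} {q : Q}
    (h : ∀ᶠ q' in 𝓝 q, τ q' = 0) : A.bracket σ τ q = 0 := by
  have hb : {q' | τ q' = 0} ∈ 𝓝 q := h
  obtain ⟨χ, hχ, -⟩ := (SmoothBumpFunction.nhds_basis_support (I := 𝓡 n) hb).mem_iff.mp hb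
  have h0 : Sec.smulFun χ χ.contMDiff τ = 0 := by
    ext q'
    change χ q' • τ q' = 0
    by_cases hq : χ q' = 0
    · rw [hq, zero_smul]
    · rw [show τ q' = 0 from hχ (subset_tsupport _ hq), smul_zero]
  have h1 := A.leibniz χ χ.contMDiff σ τ q
  rw [h0, map_zero, h.self_of_nhds, smul_zero, add_zero, χ.eq_one, one_smul] at h1
  exact h1.symm

lemma LieAlgebroid.bracket_congr_right (σ : Sec n m E) {τ τ' : Sec n m E} {q : Q}
    (h : ∀ᶠ q' in 𝓝 q, τ q' = τ' q') : A.bracket σ τ q = A.bracket σ τ' q := by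
  have h1 := A.bracket_eq_zero_of_eventually σ (τ := τ - τ') (q := q) (by
    filter_upwards [h] with q' hq'
    simp [hq'])
  rw [map_sub] at h1
  exact sub_eq_zero.mp h1

lemma LieAlgebroid.bracket_sum_right {ι : Type*} [Fintype ι] (σ τ : Sec n m E) (e : ι → Sec n m E)
    {f : ι → Q → ℝ} (hf : ∀ i, ContMDiff (𝓡 n) 𝓘(ℝ, ℝ) ∞ (f i)) {q : Q}
    (h : ∀ᶠ q' in 𝓝 q, τ q' = ∑ i, f i q' • e i q') :
    A.bracket σ τ q = ∑ i, (f i q • A.bracket σ (e i) q + A.act σ (f i) q • e i q) := by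
  have ev : ∀ (s : ι → Sec n m E) (q' : Q), (∑ i, s i) q' = ∑ i, s i q' := fun s q' =>
    map_sum ({ toFun := fun t => t q', map_zero' := rfl, map_add' := fun _ _ => rfl } :
      Sec n m E →+ E q') s Finset.univ
  rw [A.bracket_congr_right σ (τ' := ∑ i, Sec.smulFun (f i) (hf i) (e i))]
  · rw [map_sum, ev]
    exact Finset.sum_congr rfl fun i _ => A.leibniz (f i) (hf i) σ (e i) q
  · filter_upwards [h] with q' hq'
    rw [hq', ev]
    rfl

lemma LieAlgebroid.bracket_apply_skew (σ τ : Sec n m E) (q : Q) :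
    A.bracket σ τ q = - A.bracket τ σ q := by
  rw [A.bracket_skew σ τ]; rfl

/-- The bracket of two sections given by their components in a local frame. -/
lemma LieAlgebroid.bracket_eq_of_frame {ι : Type*} [Fintype ι] (σ τ : Sec n m E)
    (e : ι → Sec n m E) {f g : ι → Q → ℝ} (hf : ∀ i, ContMDiff (𝓡 n) 𝓘(ℝ, ℝ) ∞ (f i))
    (hg : ∀ i, ContMDiff (𝓡 n) 𝓘(ℝ, ℝ) ∞ (g i)) {q : Q}
    (hσ : ∀ᶠ q' in 𝓝 q, σ q' = ∑ i, f i q' • e i q')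
    (hτ : ∀ᶠ q' in 𝓝 q, τ q' = ∑ i, g i q' • e i q') :
    A.bracket σ τ q = ∑ i, ∑ j, (f i q * g j q) • A.bracket (e i) (e j) q +
      ∑ i, (A.act σ (g i) q - A.act τ (f i) q) • e i q := by
  rw [A.bracket_sum_right σ τ e hg hτ]
  have h1 : ∀ j, A.bracket σ (e j) q = ∑ i, f i q • A.bracket (e i) (e j) q -
      ∑ i, A.act (e j) (f i) q • e i q := fun j => by
    rw [A.bracket_apply_skew, A.bracket_sum_right (e j) σ e hf hσ, ← Finset.sum_neg_distrib,
      ← Finset.sum_sub_distrib]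
    refine Finset.sum_congr rfl fun i _ => ?_
    rw [A.bracket_apply_skew (e j) (e i)]
    module
  have h2 : ∀ i, A.act τ (f i) q = ∑ j, g j q * A.act (e j) (f i) q := fun i => by
    unfold LieAlgebroid.act
    rw [hτ.self_of_nhds]
    simp only [map_sum, map_smul, smul_eq_mul]
  simp only [h1, h2, Finset.sum_add_distrib, sub_smul, smul_sub, Finset.sum_sub_distrib,
    Finset.smul_sum, Finset.sum_smul, smul_smul]
  rw [Finset.sum_comm (f := fun i j => (f i q * g j q) • A.bracket (e i) (e j) q),
    Finset.sum_comm (f := fun i j => (g j q * A.act (e j) (f i) q) • e i q)]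
  simp only [mul_comm (f _ q)]
  abel

/-- The algebra behind frame independence. `a`, `b` stand for the components of `Z`, `W` in one
frame, `da`, `db` for their derivatives along `W`, `Z`, `f` for the transition functions to the
frame `e`, `d` for the derivatives of `f` along the anchor, and `B` for the brackets of `e`. The
`d`-terms on the left come from differentiating the products of components and transition functions;
on the right they are produced by the Leibniz rule. -/
lemma frame_change_identity {F : Type*} [AddCommGroup F] [Module ℝ F] {ι κ : Type*} [Fintype ι]
    [Fintype κ] (a b da db : κ → ℝ) (f : ι → κ → ℝ) (d : κ → ι → κ → ℝ) (e : ι → F) (B : ι → ι → F) :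
    ∑ i, ((∑ α, db α * f i α + ∑ α, ∑ β, b α * a β * d β i α) -
        (∑ α, da α * f i α + ∑ α, ∑ β, a α * b β * d β i α)) • e i +
      ∑ i, ∑ j, ((∑ α, a α * f i α) * ∑ α, b α * f j α) • B i j =
    ∑ α, (db α - da α) • ∑ i, f i α • e i +
      ∑ α, ∑ β, (a α * b β) • (∑ i, ∑ j, (f i α * f j β) • B i j +
        ∑ i, (d α i β - d β i α) • e i) := by
  have hB : ∑ i, ∑ j, ((∑ α, a α * f i α) * ∑ α, b α * f j α) • B i j =
      ∑ α, ∑ β, (a α * b β) • ∑ i, ∑ j, (f i α * f j β) • B i j := by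
    simp only [Finset.sum_mul_sum, Finset.sum_smul, Finset.smul_sum, smul_smul]
    calc _ = ∑ i, ∑ α, ∑ j, ∑ β, (a α * f i α * (b β * f j β)) • B i j :=
          Finset.sum_congr rfl fun i _ => Finset.sum_comm
      _ = ∑ α, ∑ i, ∑ j, ∑ β, (a α * f i α * (b β * f j β)) • B i j := Finset.sum_comm
      _ = ∑ α, ∑ i, ∑ β, ∑ j, (a α * f i α * (b β * f j β)) • B i j :=
          Finset.sum_congr rfl fun α _ => Finset.sum_congr rfl fun i _ => Finset.sum_comm
      _ = ∑ α, ∑ β, ∑ i, ∑ j, (a α * f i α * (b β * f j β)) • B i j :=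
          Finset.sum_congr rfl fun α _ => Finset.sum_comm
      _ = _ := by
        refine Finset.sum_congr rfl fun α _ => Finset.sum_congr rfl fun β _ =>
          Finset.sum_congr rfl fun i _ => Finset.sum_congr rfl fun j _ => ?_
        congr 1
        ring
  have h1 : ∀ c : κ → ℝ, ∑ α, c α • ∑ i, f i α • e i = ∑ i, (∑ α, c α * f i α) • e i := fun c => by
    simp only [Finset.smul_sum, Finset.sum_smul, smul_smul]
    exact Finset.sum_comm
  have h2 : ∑ α, ∑ β, (a α * b β) • ∑ i, (d α i β - d β i α) • e i =
      ∑ i, (∑ α, ∑ β, b α * a β * d β i α - ∑ α, ∑ β, a α * b β * d β i α) • e i := by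
    have h3 : ∀ i, ∑ α, ∑ β, b α * a β * d β i α = ∑ α, ∑ β, a α * b β * d α i β := fun i => by
      rw [Finset.sum_comm]
      exact Finset.sum_congr rfl fun α _ => Finset.sum_congr rfl fun β _ => by ring
    simp only [h3, ← Finset.sum_sub_distrib, ← mul_sub, Finset.smul_sum, Finset.sum_smul, smul_smul]
    exact (Finset.sum_congr rfl fun α _ => Finset.sum_comm).trans Finset.sum_comm
  simp only [smul_add, Finset.sum_add_distrib, h1, h2, ← hB]
  rw [add_left_comm, add_comm]
  congr 1
  rw [← Finset.sum_add_distrib]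
  refine Finset.sum_congr rfl fun i _ => ?_
  rw [← add_smul]
  simp only [sub_mul, Finset.sum_sub_distrib]
  congr 1
  ring

namespace LocalData

variable {A} (D : LocalData n m E)

/-- The components of `Z.base` in the local frame. -/
def comp (Z : ProlSection A) (α : Fin m) (p : ExtPhase m E) : ℝ :=
  D.isFrame.coeff α p.1.proj (Z.base p)

lemma contMDiffAt_comp (Z : ProlSection A) {p : ExtPhase m E} (h : p.1.proj ∈ D.U) (α : Fin m) :
    ContMDiffAt (extModel n m) 𝓘(ℝ, ℝ) ∞ (D.comp Z α) p :=
  D.contMDiffAt_coeff (g := fun p : ExtPhase m E => p.1.proj) h (Z.contMDiff_fst p) α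

/-- The global sections `σ` agree with the local frame near `q`. -/
def Extends (σ : Fin m → Sec n m E) (q : Q) : Prop :=
  q ∈ D.U ∧ ∀ᶠ q' in 𝓝 q, ∀ α, σ α q' = D.frame α q'

variable {D} {σ : Fin m → Sec n m E}

lemma Extends.eventually {q : Q} (h : D.Extends σ q) : ∀ᶠ q' in 𝓝 q, D.Extends σ q' :=
  (D.isOpen_U.eventually_mem h.1).and h.2.eventually_nhds

lemma Extends.eventually_ext {p : ExtPhase m E} (h : D.Extends σ p.1.proj) :
    ∀ᶠ p' : ExtPhase m E in 𝓝 p, D.Extends σ p'.1.proj :=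
  (contMDiff_proj_ext (n := n)).continuous.continuousAt.eventually h.eventually

lemma Extends.eq_sum {q : Q} (h : D.Extends σ q) (a : E q) :
    a = ∑ α, D.isFrame.coeff α q a • σ α q := by
  simp only [fun α => h.2.self_of_nhds α]
  exact D.eq_sum_coeff h.1 a

lemma Extends.coeff_apply {q : Q} (h : D.Extends σ q) (α β : Fin m) :
    D.isFrame.coeff α q (σ β q) = if α = β then 1 else 0 := by
  have := D.coeff_sum h.1 (fun γ => if γ = β then 1 else 0) α
  simpa [h.2.self_of_nhds β] using this

/-- The transition functions from the frame `σ` to the frame `frameSec q`. -/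
lemma Extends.exists_transition {q : Q} (h : D.Extends σ q) :
    ∃ f : Fin m → Fin m → Q → ℝ, (∀ i α, ContMDiff (𝓡 n) 𝓘(ℝ, ℝ) ∞ (f i α)) ∧
      (∀ α, ∀ᶠ q' in 𝓝 q, σ α q' = ∑ i, f i α q' • frameSec (n := n) (m := m) (E := E) q i q') ∧
      ∀ i, ∀ᶠ q' in 𝓝 q, ∀ a : E q',
        frameCoord (m := m) q i ⟨q', a⟩ = ∑ α, D.isFrame.coeff α q' a * f i α q' := by
  set e := trivializationAt (EuclideanSpace ℝ (Fin m)) E q with hedef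
  have he : q ∈ e.baseSet := FiberBundle.mem_baseSet_trivializationAt' q
  have hs : ∀ i α, ContMDiffOn (𝓡 n) 𝓘(ℝ, ℝ) ∞ (fun q' => frameCoord (m := m) q i ⟨q', σ α q'⟩) e.baseSet := by
    intro i α
    let pr : EuclideanSpace ℝ (Fin m) →L[ℝ] ℝ := EuclideanSpace.proj i
    exact pr.contDiff.contMDiff.comp_contMDiffOn
      ((e.contMDiffOn_section_baseSet_iff).mp (σ α).contMDiff.contMDiffOn)
  -- The transition functions are known to be smooth only on the base set, while the Leibniz rule
  -- takes globally smooth functions.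
  choose f hf hfe using fun i α => exists_function_eventuallyEq e.open_baseSet (hs i α) he
  refine ⟨f, hf, fun α => ?_, fun i => ?_⟩
  · filter_upwards [Filter.eventually_all.mpr fun i => hfe i α,
      eventually_eq_sum_frame (n := n) (m := m) (E := E) q] with q' h1 h2
    conv_lhs => rw [h2 (σ α q')]
    simp only [h1]
  · filter_upwards [Filter.eventually_all.mpr fun α => hfe i α, h.eventually,
      e.open_baseSet.mem_nhds he] with q' h1 h2 h3 a
    have hlin : ∀ b : E q', frameCoord (m := m) q i ⟨q', b⟩ = e.linearMapAt ℝ q' b i := fun b => by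
      rw [e.linearMapAt_apply, if_pos h3]; rfl
    rw [hlin]
    conv_lhs => rw [h2.eq_sum a]
    simp [h1, hlin]

lemma Extends.anchor_base {p : ExtPhase m E} (h : D.Extends σ p.1.proj) (Z : ProlSection A)
    (f : Q → ℝ) : mvfderiv (𝓡 n) f p.1.proj (A.anchor p.1.proj (Z.base p)) =
      ∑ α, D.comp Z α p * A.act (σ α) f p.1.proj := by
  conv_lhs => rw [h.eq_sum (Z.base p)]
  simp only [map_sum, map_smul]
  rfl

/-- The component in `E` of the bracket of two sections of the prolongation, in any local frame. -/
lemma Extends.bracketBase_eq {p : ExtPhase m E} (h : D.Extends σ p.1.proj) (Z W : ProlSection A) :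
    bracketBase Z W p =
      ∑ α, (mvfderiv (extModel n m) (D.comp W α) p (Z.vec p) -
        mvfderiv (extModel n m) (D.comp Z α) p (W.vec p)) • σ α p.1.proj +
      ∑ α, ∑ β, (D.comp Z α p * D.comp W β p) • A.bracket (σ α) (σ β) p.1.proj := by
  set q := p.1.proj with hq
  obtain ⟨f, hf, hσ, hc⟩ := h.exists_transition
  have hcont : ContinuousAt (proj : ExtPhase m E → Q) p :=
    (contMDiff_proj_ext (n := n)).continuous.continuousAt
  have hcoord : ∀ (X : ProlSection A) i,
      X.coord q i =ᶠ[𝓝 p] fun p' => ∑ α, D.comp X α p' * (f i α ∘ proj) p' := by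
    intro X i
    filter_upwards [hcont.eventually (hc i)] with p' hp'
    exact hp' _
  have hd : ∀ (X Y : ProlSection A) i, mvfderiv (extModel n m) (X.coord q i) p (Y.vec p) =
      ∑ α, mvfderiv (extModel n m) (D.comp X α) p (Y.vec p) * f i α q +
      ∑ α, ∑ β, D.comp X α p * D.comp Y β p * A.act (σ β) (f i α) q := by
    intro X Y i
    rw [mvfderiv_congr (hcoord X i), (mvfderiv_sum_mul Finset.univ (D.comp X)
      (fun α => f i α ∘ proj) p
      (fun α => (D.contMDiffAt_comp X h.1 α).mdifferentiableAt (by simp))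
      (fun α => ((hf i α).comp contMDiff_proj_ext).mdifferentiable (by simp) _) _).2,
      Finset.sum_add_distrib]
    congr 1
    refine Finset.sum_congr rfl fun α _ => ?_
    rw [Y.mvfderiv_comp_proj (hf i α), h.anchor_base, Finset.mul_sum]
    exact Finset.sum_congr rfl fun β _ => by ring
  have hb : ∀ α β, A.bracket (σ α) (σ β) q =
      ∑ i, ∑ j, (f i α q * f j β q) • A.bracket (frameSec (m := m) q i) (frameSec q j) q +
      ∑ i, (A.act (σ α) (f i β) q - A.act (σ β) (f i α) q) • frameSec (n := n) (m := m) (E := E) q i q :=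
    fun α β => A.bracket_eq_of_frame (σ α) (σ β) (frameSec q) (fun i => hf i α) (fun i => hf i β)
      (hσ α) (hσ β)
  have hσq : ∀ α, σ α q = ∑ i, f i α q • frameSec (n := n) (m := m) (E := E) q i q :=
    fun α => (hσ α).self_of_nhds
  have hcq : ∀ (X : ProlSection A) i, X.coord q i p = ∑ α, D.comp X α p * f i α q :=
    fun X i => (hcoord X i).self_of_nhds
  unfold bracketBase
  rw [← hq]
  simp only [hd, hb, hσq, hcq]
  exact frame_change_identity _ _ _ _ _ _ _ _

end LocalData

end Bracket

/-! ### The exterior differential of η_L in a local frame. -/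

section Form

variable (A : LieAlgebroid n m E) (L : ExtPhase m E → ℝ)

/-- The fibre derivative of `L` at `p = (b, s)`: `a ↦ a^V(L)`. -/
def fibDeriv (p : ExtPhase m E) : E p.1.proj →ₗ[ℝ] ℝ :=
  (mvfderiv (extModel n m) L p).toLinearMap.comp (vertMap p)

/-- The derivative of `L` along the vertical lift of the section `σ`. -/
def momentum (σ : Sec n m E) (p : ExtPhase m E) : ℝ := fibDeriv (n := n) L p (σ p.1.proj)

/-- The projection of the prolongation to `E`. -/
def prolBase (p : ExtPhase m E) : prolFiber A p →ₗ[ℝ] E p.1.proj :=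
  (LinearMap.fst ℝ _ _).comp (prolFiber A p).subtype

lemma etaL_apply (p : ExtPhase m E) (w : prolFiber A p) :
    etaL A L p w = mvfderiv (extModel n m) (Prod.snd : ExtPhase m E → ℝ) p (prolAnchor A p w) -
      fibDeriv (n := n) L p (prolBase A p w) := rfl

variable {L}

lemma contMDiff_momentum (hL : ContMDiff (extModel n m) 𝓘(ℝ, ℝ) ∞ L) (σ : Sec n m E) :
    ContMDiff (extModel n m) 𝓘(ℝ, ℝ) ∞ (momentum L σ) :=
  contMDiff_mvfderiv_apply hL (contMDiff_vertVector σ)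

lemma mdifferentiableAt_momentum (hL : ContMDiff (extModel n m) 𝓘(ℝ, ℝ) ∞ L) (σ : Sec n m E)
    (p : ExtPhase m E) : MDifferentiableAt (extModel n m) 𝓘(ℝ, ℝ) (momentum L σ) p :=
  (contMDiff_momentum hL σ).mdifferentiable (by simp) p

namespace LocalData

variable (D : LocalData n m E) (σ : Fin m → Sec n m E)

/-- The components of an element of the prolongation in the local frame. -/
def compAt (p : ExtPhase m E) (α : Fin m) : prolFiber A p →ₗ[ℝ] ℝ :=
  (D.isFrame.coeff α p.1.proj).comp (prolBase A p)

variable (L) in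
/-- The derivative of the momenta of `L` along an element of the prolongation. -/
def dMomAt (p : ExtPhase m E) (α : Fin m) : prolFiber A p →ₗ[ℝ] ℝ :=
  (mvfderiv (extModel n m) (momentum L (σ α)) p).toLinearMap.comp (prolAnchor A p)

variable (L) in
/-- The `2`-form `dη_L` at a point, in the local frame. -/
def form (p : ExtPhase m E) : prolFiber A p →ₗ[ℝ] prolFiber A p →ₗ[ℝ] ℝ :=
  ∑ α, ((LinearMap.mul ℝ ℝ).compl₁₂ (D.compAt A p α) (dMomAt A L σ p α) -
    (LinearMap.mul ℝ ℝ).compl₁₂ (dMomAt A L σ p α) (D.compAt A p α)) +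
  ∑ α, ∑ β, fibDeriv (n := n) L p (A.bracket (σ α) (σ β) p.1.proj) •
    (LinearMap.mul ℝ ℝ).compl₁₂ (D.compAt A p α) (D.compAt A p β)

lemma form_apply (p : ExtPhase m E) (w w' : prolFiber A p) :
    D.form A L σ p w w' =
      ∑ α, (D.compAt A p α w * dMomAt A L σ p α w' - dMomAt A L σ p α w * D.compAt A p α w') +
      ∑ α, ∑ β, fibDeriv (n := n) L p (A.bracket (σ α) (σ β) p.1.proj) *
        (D.compAt A p α w * D.compAt A p β w') := by
  simp [form, LinearMap.sum_apply, LinearMap.add_apply]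

variable {A D σ}

/-- The exterior differential of `η_L`, in any local frame. -/
lemma Extends.dForm_etaL (hL : ContMDiff (extModel n m) 𝓘(ℝ, ℝ) ∞ L) {p : ExtPhase m E}
    (h : D.Extends σ p.1.proj) (Z W : ProlSection A) :
    dForm (etaL A L) Z W p = D.form A L σ p (Z.val p) (W.val p) := by
  have hev : ∀ X : ProlSection A, (fun p' => etaL A L p' (X.val p')) =ᶠ[𝓝 p]
      (fun p' => mvfderiv (extModel n m) (Prod.snd : ExtPhase m E → ℝ) p' (X.vec p')) -
        fun p' => ∑ α, D.comp X α p' * momentum L (σ α) p' := by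
    intro X
    filter_upwards [h.eventually_ext] with p' hp'
    rw [etaL_apply, Pi.sub_apply]
    refine congrArg₂ (· - ·) rfl ?_
    change fibDeriv L p' (X.base p') = _
    conv_lhs => rw [hp'.eq_sum (X.base p')]
    simp only [map_sum, map_smul, smul_eq_mul]
    rfl
  have hs : ContMDiff (extModel n m) 𝓘(ℝ, ℝ) ∞ (Prod.snd : ExtPhase m E → ℝ) := contMDiff_snd
  have hsd : ∀ X : ProlSection A, MDifferentiableAt (extModel n m) 𝓘(ℝ, ℝ)
      (fun p' => mvfderiv (extModel n m) (Prod.snd : ExtPhase m E → ℝ) p' (X.vec p')) p := fun X =>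
    (contMDiff_mvfderiv_apply hs X.contMDiff_snd).mdifferentiable (by simp) p
  have hsum := fun X : ProlSection A => mvfderiv_sum_mul Finset.univ (D.comp X)
      (fun α => momentum L (σ α)) p
      (fun α => (D.contMDiffAt_comp X h.1 α).mdifferentiableAt (by simp))
      (fun α => mdifferentiableAt_momentum hL (σ α) p)
  have hd : ∀ X Y : ProlSection A,
      mvfderiv (extModel n m) (fun p' => etaL A L p' (X.val p')) p (Y.vec p) =
      mvfderiv (extModel n m)
        (fun p' => mvfderiv (extModel n m) (Prod.snd : ExtPhase m E → ℝ) p' (X.vec p')) p (Y.vec p) -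
      (∑ α, (mvfderiv (extModel n m) (D.comp X α) p (Y.vec p) * momentum L (σ α) p +
        D.comp X α p * mvfderiv (extModel n m) (momentum L (σ α)) p (Y.vec p))) := by
    intro X Y
    rw [mvfderiv_congr (hev X), mvfderiv_sub (hsd X) (hsum X 0).1, sub_apply, (hsum X _).2]
  -- This identity says that ds is closed, so the ds-part of η_L contributes nothing.
  have hlie := mv_lie (Prod.snd : ExtPhase m E → ℝ) hs Z.vec W.vec p
    (Z.contMDiff_snd.mdifferentiable (by simp) _) (W.contMDiff_snd.mdifferentiable (by simp) _)
    (hsd Z) (hsd W)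
  have hbr : etaL A L p (prolBracket Z W p) =
      mvfderiv (extModel n m) (Prod.snd : ExtPhase m E → ℝ) p
        (mlieBracket (extModel n m) Z.vec W.vec p) -
      (∑ α, (mvfderiv (extModel n m) (D.comp W α) p (Z.vec p) -
        mvfderiv (extModel n m) (D.comp Z α) p (W.vec p)) * momentum L (σ α) p +
      ∑ α, ∑ β, (D.comp Z α p * D.comp W β p) *
        fibDeriv (n := n) L p (A.bracket (σ α) (σ β) p.1.proj)) := by
    rw [etaL_apply]
    refine congrArg₂ (· - ·) rfl ?_
    change fibDeriv L p (bracketBase Z W p) = _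
    rw [h.bracketBase_eq]
    simp only [map_add, map_sum, map_smul, smul_eq_mul]
    rfl
  have hform : D.form A L σ p (Z.val p) (W.val p) =
      ∑ α, (D.comp Z α p * mvfderiv (extModel n m) (momentum L (σ α)) p (W.vec p) -
        mvfderiv (extModel n m) (momentum L (σ α)) p (Z.vec p) * D.comp W α p) +
      ∑ α, ∑ β, fibDeriv (n := n) L p (A.bracket (σ α) (σ β) p.1.proj) *
        (D.comp Z α p * D.comp W β p) := form_apply _ _ _ _ _ _
  unfold dForm
  -- The derivatives of the components of `Z` and `W` cancel against those in `hbr`. Only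
  -- derivatives of the momenta and brackets of the frame survive, so the result depends on the
  -- values of `Z` and `W` at `p` alone.
  rw [hd, hd, hbr, hlie, hform]
  simp only [sub_mul, Finset.sum_sub_distrib, Finset.sum_add_distrib, mul_comm (fibDeriv L p _),
    mul_comm (mvfderiv (extModel n m) (momentum L (σ _)) p _)]
  ring

end LocalData

end Form

/-! ### Smooth sections of the prolongation through every element. -/

section Sections

variable {A : LieAlgebroid n m E}

@[ext]
lemma ProlSection.ext {Z W : ProlSection A} (h : ∀ p, Z.val p = W.val p) : Z = W := by
  cases Z; cases W
  congr
  exact funext h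

lemma prolFiber_ext {p : ExtPhase m E} {w w' : prolFiber A p}
    (h₁ : prolBase A p w = prolBase A p w') (h₂ : prolAnchor A p w = prolAnchor A p w') : w = w' :=
  Subtype.ext (Prod.ext h₁ h₂)

variable (A) in
/-- The element `∂/∂s` of the prolongation. -/
def sElement (p : ExtPhase m E) : prolFiber A p :=
  ⟨(0, sVector p), by
    change A.anchor p.1.proj 0 = mfderiv (extModel n m) (𝓡 n) proj p (sVector p)
    rw [mfderiv_proj_sVector, map_zero]⟩

@[simp] lemma prolBase_sElement (p : ExtPhase m E) : prolBase A p (sElement A p) = 0 := rfl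

@[simp] lemma prolAnchor_sElement (p : ExtPhase m E) :
    prolAnchor A p (sElement A p) = sVector p := rfl

@[simp] lemma prolBase_vertLift (p : ExtPhase m E) (a : E p.1.proj) :
    prolBase A p (vertLift A p a) = 0 := rfl

@[simp] lemma prolAnchor_vertLift (p : ExtPhase m E) (a : E p.1.proj) :
    prolAnchor A p (vertLift A p a) = vertVector p a := rfl

/-- The sum of two sections of the prolongation. -/
def ProlSection.add (Z W : ProlSection A) : ProlSection A where
  val p := Z.val p + W.val p
  contMDiff_fst p := contMDiffAt_add_along (Z.contMDiff_fst p) (W.contMDiff_fst p)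
  contMDiff_snd := Z.contMDiff_snd.add_section W.contMDiff_snd

/-- The product of a section of the prolongation and a constant. -/
def ProlSection.smul (c : ℝ) (Z : ProlSection A) : ProlSection A where
  val p := c • Z.val p
  contMDiff_fst p := contMDiffAt_smul_along contMDiffAt_const (Z.contMDiff_fst p)
  contMDiff_snd := (contMDiff_const (c := c)).smul_section Z.contMDiff_snd

variable (A) in
/-- The section `∂/∂s` of the prolongation. -/
def sSection : ProlSection A where
  val := sElement A
  contMDiff_fst := (0 : Sec n m E).contMDiff.comp contMDiff_proj_ext
  contMDiff_snd := contMDiff_sVector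

variable (A) in
/-- The vertical lift of a section of `E`. -/
def vertSection (τ : Sec n m E) : ProlSection A where
  val p := vertLift A p (τ p.1.proj)
  contMDiff_fst := (0 : Sec n m E).contMDiff.comp contMDiff_proj_ext
  contMDiff_snd := contMDiff_vertVector τ

/-- The elements of the prolongation over `0 ∈ E_q`. -/
lemma eq_vertLift_add_sElement {p : ExtPhase m E} {w : prolFiber A p} (hw : prolBase A p w = 0) :
    ∃ c : E p.1.proj, w = vertLift A p c +
      mvfderiv (extModel n m) (Prod.snd : ExtPhase m E → ℝ) p (prolAnchor A p w) • sElement A p := by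
  obtain ⟨c, hc⟩ := exists_eq_vertVector_add_sVector p (prolAnchor A p w) (by
    have h : A.anchor p.1.proj (prolBase A p w) =
      mfderiv (extModel n m) (𝓡 n) proj p (prolAnchor A p w) := w.2
    rw [← h, hw, map_zero])
  refine ⟨c, prolFiber_ext ?_ ?_⟩
  · rw [map_add, map_smul, prolBase_vertLift, prolBase_sElement, smul_zero, add_zero, hw]
  · rw [map_add, map_smul, prolAnchor_vertLift, prolAnchor_sElement]
    exact hc

/-- Every element of the prolongation is a value of a section. -/
lemma exists_prolSection_eq (p : ExtPhase m E) (w : prolFiber A p) :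
    ∃ Z : ProlSection A, Z.val p = w := by
  obtain ⟨σ, hσ⟩ := exists_section_eq (n := n) (m := m) p.1.proj (prolBase A p w)
  obtain ⟨G, -, hG⟩ := exists_lift A p.1.proj σ
  have hb : prolBase A p (G.val p) = prolBase A p w := (hG.self_of_nhds p.1.snd p.2).trans hσ
  -- After subtracting a lift with the same `E`-part, only a vertical lift and a multiple of ∂/∂s
  -- remain, and both extend to global sections.
  obtain ⟨c, hc⟩ := eq_vertLift_add_sElement (w := w - G.val p) (by rw [map_sub, hb, sub_self])
  obtain ⟨τ, hτ⟩ := exists_section_eq (n := n) (m := m) p.1.proj c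
  refine ⟨G.add ((vertSection A τ).add ((sSection A).smul
    (mvfderiv (extModel n m) (Prod.snd : ExtPhase m E → ℝ) p (prolAnchor A p (w - G.val p))))), ?_⟩
  change G.val p + (vertLift A p (τ p.1.proj) + _ • sElement A p) = w
  rw [hτ, ← hc]
  abel

end Sections

/-! ### The 2-form on a single fibre. -/

section Omega

variable (A : LieAlgebroid n m E) (L : ExtPhase m E → ℝ)

/-- The `2`-form `dη_L` at a point. -/
def omega (p : ExtPhase m E) : prolFiber A p →ₗ[ℝ] prolFiber A p →ₗ[ℝ] ℝ :=
  (LocalData.ofPoint (n := n) (m := m) E p.1.proj).form A L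
    ((LocalData.ofPoint (n := n) (m := m) E p.1.proj).exists_extend (LocalData.mem_ofPoint p.1.proj)).choose p

variable {A L}

lemma dForm_etaL_eq_omega (hL : ContMDiff (extModel n m) 𝓘(ℝ, ℝ) ∞ L) (Z W : ProlSection A)
    (p : ExtPhase m E) : dForm (etaL A L) Z W p = omega A L p (Z.val p) (W.val p) :=
  LocalData.Extends.dForm_etaL hL
    ⟨LocalData.mem_ofPoint p.1.proj, ((LocalData.ofPoint (n := n) (m := m) E p.1.proj).exists_extend
      (LocalData.mem_ofPoint p.1.proj)).choose_spec⟩ Z W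

variable {D : LocalData n m E} {σ : Fin m → Sec n m E}

/-- `omega` is built from one chosen frame, but the expressions in all frames compute the same
`dForm`, and values of sections exhaust the fibre. Any convenient frame may therefore be used. -/
lemma LocalData.Extends.omega_eq (hL : ContMDiff (extModel n m) 𝓘(ℝ, ℝ) ∞ L) {p : ExtPhase m E}
    (h : D.Extends σ p.1.proj) (w w' : prolFiber A p) : omega A L p w w' = D.form A L σ p w w' := by
  obtain ⟨Z, rfl⟩ := exists_prolSection_eq p w
  obtain ⟨W, rfl⟩ := exists_prolSection_eq p w'
  rw [← dForm_etaL_eq_omega hL, h.dForm_etaL hL]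

end Omega

/-! ### The fibre Hessian and nondegeneracy. -/

section Regular

variable {A : LieAlgebroid n m E} {L : ExtPhase m E → ℝ} {D : LocalData n m E}
  {σ : Fin m → Sec n m E}

lemma mvfderiv_vertVector {f : ExtPhase m E → ℝ} {p : ExtPhase m E}
    (hf : MDifferentiableAt (extModel n m) 𝓘(ℝ, ℝ) f p) (a : E p.1.proj) :
    mvfderiv (extModel n m) f p (vertVector p a) = deriv (fun t => f (vertCurve p a t)) 0 :=
  mvfderiv_apply_velocity (vertCurve_zero p a)
    ((contMDiff_vertCurve p a).mdifferentiable (by simp) 0) hf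

variable (L σ) in
/-- The Hessian matrix of `L` along the fibres, in the frame `σ`. -/
def hessian (p : ExtPhase m E) : Matrix (Fin m) (Fin m) ℝ :=
  Matrix.of fun α β => mvfderiv (extModel n m) (momentum L (σ α)) p (vertVector p (σ β p.1.proj))

lemma contMDiff_hessian (hL : ContMDiff (extModel n m) 𝓘(ℝ, ℝ) ∞ L) (α β : Fin m) :
    ContMDiff (extModel n m) 𝓘(ℝ, ℝ) ∞ (fun p => hessian L σ p α β) :=
  contMDiff_mvfderiv_apply (contMDiff_momentum hL (σ α)) (contMDiff_vertVector (σ β))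

/-- Regularity is applied to the basis of the fibre given by the frame. The matrix there
differentiates in the opposite order, so it is the transpose of `hessian`; passing to the transpose
avoids the symmetry of second derivatives. -/
lemma LocalData.Extends.det_hessian_ne_zero (hL : ContMDiff (extModel n m) 𝓘(ℝ, ℝ) ∞ L)
    (hreg : IsRegular L) {p : ExtPhase m E} (h : D.Extends σ p.1.proj) :
    (hessian L σ p).det ≠ 0 := by
  have hb : ∀ α, D.isFrame.toBasisAt h.1 α = σ α p.1.proj := fun α => by
    rw [IsLocalFrameOn.toBasisAt_coe, h.2.self_of_nhds α]
  have h1 := hreg p (D.isFrame.toBasisAt h.1)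
  rw [← Matrix.det_transpose]
  convert h1 using 2
  ext α β
  simp only [hb, Matrix.transpose_apply, Matrix.of_apply, hessian]
  rw [mvfderiv_vertVector (mdifferentiableAt_momentum hL (σ β) p)]
  congr 1
  funext t
  exact mvfderiv_vertVector (hL.mdifferentiable (by simp) _) _

namespace LocalData

@[simp] lemma compAt_vertLift (p : ExtPhase m E) (a : E p.1.proj) (α : Fin m) :
    D.compAt A p α (vertLift A p a) = 0 :=
  map_zero (D.isFrame.coeff α p.1.proj)

@[simp] lemma compAt_sElement (p : ExtPhase m E) (α : Fin m) :
    D.compAt A p α (sElement A p) = 0 :=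
  map_zero (D.isFrame.coeff α p.1.proj)

lemma dMomAt_vertLift (p : ExtPhase m E) (c : Fin m → ℝ) (α : Fin m) :
    dMomAt A L σ p α (vertLift A p (∑ β, c β • σ β p.1.proj)) = (hessian L σ p).mulVec c α := by
  simp only [map_sum, map_smul, smul_eq_mul, Matrix.mulVec, dotProduct]
  exact Finset.sum_congr rfl fun β _ => mul_comm _ _

/-- `(dη_L, η_L)` is non-degenerate on the fibres of the prolongation, in a local frame. -/
lemma Extends.eq_zero_of_form_eq_zero (hL : ContMDiff (extModel n m) 𝓘(ℝ, ℝ) ∞ L)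
    (hreg : IsRegular L) {p : ExtPhase m E} (h : D.Extends σ p.1.proj) {w : prolFiber A p}
    (hw : ∀ w', D.form A L σ p w w' = 0) (hη : etaL A L p w = 0) : w = 0 := by
  have hdet : IsUnit (hessian L σ p).det := isUnit_iff_ne_zero.mpr (h.det_hessian_ne_zero hL hreg)
  have hc : (fun α => D.compAt A p α w) = 0 := by
    have h1 : Matrix.vecMul (fun α => D.compAt A p α w) (hessian L σ p) = 0 := by
      ext β
      -- Vertical lifts have no `E`-part, so pairing `w` with the lift of σ_β leaves only the
      -- `β`-entry of the row vector X(w)H.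
      have h2 := hw (vertLift A p (∑ γ, (Pi.single β 1 : Fin m → ℝ) γ • σ γ p.1.proj))
      simp only [form_apply, compAt_vertLift, dMomAt_vertLift] at h2
      simpa [Matrix.vecMul, dotProduct] using h2
    exact Matrix.eq_zero_of_vecMul_eq_zero hdet.ne_zero h1
  have hc' : ∀ α, D.compAt A p α w = 0 := fun α => congrFun hc α
  have hb : prolBase A p w = 0 := by
    rw [h.eq_sum (prolBase A p w)]
    exact Finset.sum_eq_zero fun α _ => by
      rw [show D.isFrame.coeff α p.1.proj (prolBase A p w) = 0 from hc' α, zero_smul]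
  obtain ⟨c, hw'⟩ := eq_vertLift_add_sElement hb
  rw [etaL_apply, hb, map_zero, sub_zero] at hη
  rw [hη, zero_smul, add_zero] at hw'
  -- Now `w` is vertical, and pairing it with a lift of σ_α leaves -dP_α(w), the negative of the
  -- `α`-entry of Hc.
  have hcz : (hessian L σ p).mulVec (fun β => D.isFrame.coeff β p.1.proj c) = 0 := by
    ext α
    rw [← dMomAt_vertLift (A := A), ← h.eq_sum c, ← hw']
    obtain ⟨G, -, hG⟩ := exists_lift A p.1.proj (σ α)
    have h2 := hw (G.val p)
    have h3 : ∀ β, D.compAt A p β (G.val p) = if β = α then 1 else 0 := fun β => by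
      rw [← h.coeff_apply]
      exact congrArg _ (hG.self_of_nhds p.1.snd p.2)
    simpa [form_apply, hc', h3] using h2
  have hz := Matrix.eq_zero_of_mulVec_eq_zero hdet.ne_zero hcz
  rw [hw', h.eq_sum c]
  simp [fun β => congrFun hz β]

end LocalData

/-- `(dη_L, η_L)` is non-degenerate on the fibres of the prolongation. -/
lemma eq_zero_of_omega_eq_zero (hL : ContMDiff (extModel n m) 𝓘(ℝ, ℝ) ∞ L)
    (hreg : IsRegular L) {p : ExtPhase m E} {w : prolFiber A p}
    (hw : ∀ w', omega A L p w w' = 0) (hη : etaL A L p w = 0) : w = 0 :=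
  LocalData.Extends.eq_zero_of_form_eq_zero hL hreg
    ⟨LocalData.mem_ofPoint p.1.proj, ((LocalData.ofPoint (n := n) (m := m) E p.1.proj).exists_extend
      (LocalData.mem_ofPoint p.1.proj)).choose_spec⟩ hw hη

end Regular

/-! ### The energy and its differential. -/

section Energy

variable {A : LieAlgebroid n m E} {L : ExtPhase m E → ℝ} {D : LocalData n m E}
  {σ : Fin m → Sec n m E}

lemma energy_apply (p : ExtPhase m E) : energy A L p = fibDeriv (n := n) L p p.1.snd - L p := rfl

lemma LocalData.Extends.energy_eventuallyEq {p : ExtPhase m E} (h : D.Extends σ p.1.proj) :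
    energy A L =ᶠ[𝓝 p] (fun p' => ∑ α, D.yCoord α p' * momentum L (σ α) p') - L := by
  filter_upwards [h.eventually_ext] with p' hp'
  rw [energy_apply, Pi.sub_apply]
  congr 1
  conv_lhs => rw [hp'.eq_sum p'.1.snd]
  simp only [map_sum, map_smul, smul_eq_mul]
  rfl

lemma contMDiff_energy (hL : ContMDiff (extModel n m) 𝓘(ℝ, ℝ) ∞ L) :
    ContMDiff (extModel n m) 𝓘(ℝ, ℝ) ∞ (energy A L) := by
  intro p
  have hD := LocalData.mem_ofPoint (n := n) (m := m) (E := E) p.1.proj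
  obtain ⟨σ, hσ⟩ := (LocalData.ofPoint (n := n) (m := m) E p.1.proj).exists_extend hD
  refine ContMDiffAt.congr_of_eventuallyEq ?_
    (LocalData.Extends.energy_eventuallyEq (A := A) (L := L) ⟨hD, hσ⟩)
  refine ContMDiffAt.sub (contMDiffAt_finsetSum fun α _ => ?_) hL.contMDiffAt
  exact (LocalData.contMDiffAt_yCoord _ hD α).mul (contMDiff_momentum hL (σ α)).contMDiffAt

/-- The differential of the energy, in a local frame. -/
lemma LocalData.Extends.mvfderiv_energy (hL : ContMDiff (extModel n m) 𝓘(ℝ, ℝ) ∞ L)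
    {p : ExtPhase m E} (h : D.Extends σ p.1.proj) (v : TangentSpace (extModel n m) p) :
    mvfderiv (extModel n m) (energy A L) p v =
      ∑ α, (mvfderiv (extModel n m) (D.yCoord α) p v * momentum L (σ α) p +
        D.yCoord α p * mvfderiv (extModel n m) (momentum L (σ α)) p v) -
      mvfderiv (extModel n m) L p v := by
  have hsum := mvfderiv_sum_mul Finset.univ D.yCoord (fun α => momentum L (σ α)) p
    (fun α => (D.contMDiffAt_yCoord h.1 α).mdifferentiableAt (by simp))
    (fun α => mdifferentiableAt_momentum hL (σ α) p) v
  rw [mvfderiv_congr h.energy_eventuallyEq, mvfderiv_sub hsum.1 (hL.mdifferentiable (by simp) p),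
    sub_apply, hsum.2]

lemma LocalData.mvfderiv_yCoord_vertVector {p : ExtPhase m E} (h : p.1.proj ∈ D.U) (α : Fin m)
    (c : E p.1.proj) :
    mvfderiv (extModel n m) (D.yCoord α) p (vertVector p c) = D.isFrame.coeff α p.1.proj c := by
  rw [mvfderiv_vertVector ((D.contMDiffAt_yCoord h α).mdifferentiableAt (by simp))]
  have h1 : (fun t : ℝ => D.yCoord α (vertCurve p c t)) =
      fun t => D.yCoord α p + t * D.isFrame.coeff α p.1.proj c := by
    funext t
    change D.isFrame.coeff α p.1.proj (p.1.snd + t • c) = _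
    rw [map_add, map_smul, smul_eq_mul]
    rfl
  rw [h1]
  simp

lemma LocalData.mvfderiv_yCoord_sVector {p : ExtPhase m E} (h : p.1.proj ∈ D.U) (α : Fin m) :
    mvfderiv (extModel n m) (D.yCoord α) p (sVector p) = 0 := by
  have hg : MDifferentiableAt ((𝓡 n).prod 𝓘(ℝ, EuclideanSpace ℝ (Fin m))) 𝓘(ℝ, ℝ)
      (fun a : TotalSpace (EuclideanSpace ℝ (Fin m)) E => D.isFrame.coeff α a.proj a.snd) p.1 :=
    (D.contMDiffAt_coeff (g := fun a : TotalSpace (EuclideanSpace ℝ (Fin m)) E => a.proj)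
      (s := fun a => a.snd) h contMDiffAt_id α).mdifferentiableAt (by simp)
  have h1 := mvfderiv_comp_apply (I' := extModel n m) (I := (𝓡 n).prod 𝓘(ℝ, EuclideanSpace ℝ (Fin m))) (f := (Prod.fst : ExtPhase m E → _))
    (g := fun a : TotalSpace (EuclideanSpace ℝ (Fin m)) E => D.isFrame.coeff α a.proj a.snd) p hg
    (mdifferentiableAt_fst (I := (𝓡 n).prod 𝓘(ℝ, EuclideanSpace ℝ (Fin m))) (I' := 𝓘(ℝ, ℝ))) (sVector p)
  have h2 : mfderiv (extModel n m) ((𝓡 n).prod 𝓘(ℝ, EuclideanSpace ℝ (Fin m)))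
      (Prod.fst : ExtPhase m E → _) p (sVector p) = 0 := by
    have : mfderiv (extModel n m) ((𝓡 n).prod 𝓘(ℝ, EuclideanSpace ℝ (Fin m)))
      (Prod.fst : ExtPhase m E → _) p =
      ContinuousLinearMap.fst ℝ (EuclideanSpace ℝ (Fin n) × EuclideanSpace ℝ (Fin m)) ℝ := mfderiv_fst
    exact congrArg (fun T => T (sVector p)) this
  refine h1.trans ((congrArg _ h2).trans (map_zero _))

lemma LocalData.Extends.mvfderiv_energy_sVector (hL : ContMDiff (extModel n m) 𝓘(ℝ, ℝ) ∞ L)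
    {p : ExtPhase m E} (h : D.Extends σ p.1.proj) :
    mvfderiv (extModel n m) (energy A L) p (sVector p) =
      ∑ α, D.yCoord α p * mvfderiv (extModel n m) (momentum L (σ α)) p (sVector p) -
        mvfderiv (extModel n m) L p (sVector p) := by
  rw [h.mvfderiv_energy hL]
  simp only [LocalData.mvfderiv_yCoord_sVector h.1, zero_mul, zero_add]

/-- In the differential of Σ y^α P_α - L, the terms with dy^α(c^V) = c^α add up to c^V(L) and cancel
the last term. -/
lemma LocalData.Extends.mvfderiv_energy_vertVector (hL : ContMDiff (extModel n m) 𝓘(ℝ, ℝ) ∞ L)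
    {p : ExtPhase m E} (h : D.Extends σ p.1.proj) (c : E p.1.proj) :
    mvfderiv (extModel n m) (energy A L) p (vertVector p c) =
      ∑ α, D.yCoord α p * mvfderiv (extModel n m) (momentum L (σ α)) p (vertVector p c) := by
  have h1 : mvfderiv (extModel n m) L p (vertVector p c) =
      ∑ α, D.isFrame.coeff α p.1.proj c * momentum L (σ α) p := by
    change fibDeriv L p c = _
    conv_lhs => rw [h.eq_sum c]
    simp only [map_sum, map_smul, smul_eq_mul]
    rfl
  rw [h.mvfderiv_energy hL, h1, Finset.sum_add_distrib]
  simp only [LocalData.mvfderiv_yCoord_vertVector h.1]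
  ring

end Energy

/-! ### The Reeb section. -/

section Reeb

variable {A : LieAlgebroid n m E} {L : ExtPhase m E → ℝ} {D : LocalData n m E}
  {σ : Fin m → Sec n m E}

variable (L σ) in
/-- The vertical components of the Reeb section in the local frame, up to sign. -/
def reebCoeff (p : ExtPhase m E) : Fin m → ℝ :=
  (hessian L σ p)⁻¹.mulVec fun α => mvfderiv (extModel n m) (momentum L (σ α)) p (sVector p)

variable (A L σ) in
/-- The Reeb element at `p`, in the local frame. -/
def reebElement (p : ExtPhase m E) : prolFiber A p :=
  sElement A p - vertLift A p (∑ β, reebCoeff L σ p β • σ β p.1.proj)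

/-- This fixes the choice of `reebCoeff`: the vertical part changes P_α by (H H⁻¹ ∂P/∂s)_α, exactly
what ∂/∂s contributes. -/
lemma LocalData.dMomAt_reebElement (p : ExtPhase m E) (hdet : (hessian L σ p).det ≠ 0) (α : Fin m) :
    LocalData.dMomAt A L σ p α (reebElement A L σ p) = 0 := by
  rw [reebElement, map_sub, LocalData.dMomAt_vertLift, reebCoeff, Matrix.mulVec_mulVec,
    Matrix.mul_nonsing_inv _ (isUnit_iff_ne_zero.mpr hdet), Matrix.one_mulVec]
  exact sub_self _

@[simp] lemma prolBase_reebElement (p : ExtPhase m E) : prolBase A p (reebElement A L σ p) = 0 := by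
  rw [reebElement, map_sub, prolBase_sElement, prolBase_vertLift, sub_zero]

lemma etaL_sElement (p : ExtPhase m E) : etaL A L p (sElement A p) = 1 := by
  rw [etaL_apply, prolBase_sElement, map_zero, sub_zero, prolAnchor_sElement, mvfderiv_snd_sVector]

lemma etaL_vertLift (p : ExtPhase m E) (c : E p.1.proj) : etaL A L p (vertLift A p c) = 0 := by
  rw [etaL_apply, prolBase_vertLift, map_zero, sub_zero, prolAnchor_vertLift,
    mvfderiv_snd_vertVector]

lemma etaL_reebElement (p : ExtPhase m E) : etaL A L p (reebElement A L σ p) = 1 := by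
  rw [reebElement, map_sub, etaL_sElement, etaL_vertLift, sub_zero]

lemma LocalData.Extends.omega_reebElement (hL : ContMDiff (extModel n m) 𝓘(ℝ, ℝ) ∞ L)
    (hreg : IsRegular L) {p : ExtPhase m E} (h : D.Extends σ p.1.proj) (w' : prolFiber A p) :
    omega A L p (reebElement A L σ p) w' = 0 := by
  rw [h.omega_eq hL, LocalData.form_apply]
  have h1 : ∀ α, D.compAt A p α (reebElement A L σ p) = 0 := fun α => by
    change D.isFrame.coeff α p.1.proj (prolBase A p (reebElement A L σ p)) = 0
    rw [prolBase_reebElement, map_zero]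
  simp [h1, LocalData.dMomAt_reebElement p (h.det_hessian_ne_zero hL hreg)]

/-- The energy formulas for ∂/∂s and for vertical lifts combine to Σ y^α dP_α(R) - ∂L/∂s, and `R`
kills the momenta. This is the origin of the term (∂L/∂y^α)(∂L/∂s) in the Herglotz equations. -/
lemma LocalData.Extends.mvfderiv_energy_reebElement (hL : ContMDiff (extModel n m) 𝓘(ℝ, ℝ) ∞ L)
    (hreg : IsRegular L) {p : ExtPhase m E} (h : D.Extends σ p.1.proj) :
    mvfderiv (extModel n m) (energy A L) p (prolAnchor A p (reebElement A L σ p)) =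
      - mvfderiv (extModel n m) L p (sVector p) := by
  have h1 : ∀ α, mvfderiv (extModel n m) (momentum L (σ α)) p (sVector p) -
      mvfderiv (extModel n m) (momentum L (σ α)) p
        (vertVector p (∑ β, reebCoeff L σ p β • σ β p.1.proj)) = 0 := fun α => by
    have h2 := LocalData.dMomAt_reebElement (A := A) p (h.det_hessian_ne_zero hL hreg) α
    rw [reebElement, map_sub] at h2
    exact h2
  rw [reebElement, map_sub, map_sub, prolAnchor_sElement, prolAnchor_vertLift,
    h.mvfderiv_energy_sVector hL, h.mvfderiv_energy_vertVector hL, sub_right_comm,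
    ← Finset.sum_sub_distrib]
  simp only [← mul_sub, h1]
  simp

lemma LocalData.Extends.contMDiffAt_reebElement (hL : ContMDiff (extModel n m) 𝓘(ℝ, ℝ) ∞ L)
    (hreg : IsRegular L) {p : ExtPhase m E} (h : D.Extends σ p.1.proj) :
    ContMDiffAt (extModel n m) (extModel n m).tangent ∞
      (fun p => (⟨p, prolAnchor A p (reebElement A L σ p)⟩ :
        TangentBundle (extModel n m) (ExtPhase m E))) p := by
  have hc : ∀ β, ContMDiffAt (extModel n m) 𝓘(ℝ, ℝ) ∞ (fun p => reebCoeff L σ p β) p := fun β =>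
    contMDiffAt_inv_mulVec (fun i j => (contMDiff_hessian hL i j).contMDiffAt)
      (fun i => (contMDiff_mvfderiv_apply (contMDiff_momentum hL (σ i)) contMDiff_sVector).contMDiffAt)
      (h.det_hessian_ne_zero hL hreg) β
  have h1 := (contMDiff_sVector (n := n) (m := m) (E := E)).contMDiffAt.sub_section
    (ContMDiffAt.sum_section (s := Finset.univ) fun β _ =>
      (hc β).smul_section (contMDiff_vertVector (σ β)).contMDiffAt)
  refine h1.congr_of_eventuallyEq (Filter.Eventually.of_forall fun p' => ?_)
  refine congrArg (TotalSpace.mk p') ?_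
  rw [reebElement, map_sub, prolAnchor_sElement, map_sum, map_sum]
  simp only [map_smul, prolAnchor_vertLift]
  rfl

/-- The Reeb section of `η_L`. -/
lemma exists_reeb (hL : ContMDiff (extModel n m) 𝓘(ℝ, ℝ) ∞ L) (hreg : IsRegular L) :
    ∃ R : ProlSection A, (∀ p w', omega A L p (R.val p) w' = 0) ∧
      (∀ p, etaL A L p (R.val p) = 1) ∧
      ∀ p, dFun A (energy A L) p (R.val p) = - mvfderiv (extModel n m) L p (sVector p) := by
  have hex : ∀ q : Q, ∃ (D : LocalData n m E) (σ : Fin m → Sec n m E), D.Extends σ q := fun q => by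
    obtain ⟨σ, hσ⟩ := (LocalData.ofPoint (n := n) (m := m) E q).exists_extend (LocalData.mem_ofPoint q)
    exact ⟨_, σ, LocalData.mem_ofPoint q, hσ⟩
  choose D σ h using hex
  -- The frame is chosen separately for each base point. Nondegeneracy makes the Reeb element
  -- independent of it, so near `p₀` the section agrees with the smooth formula in the single frame
  -- chosen at `p₀`.
  have huniq : ∀ (p₀ p : ExtPhase m E), (D p₀.1.proj).Extends (σ p₀.1.proj) p.1.proj →
      reebElement A L (σ p.1.proj) p = reebElement A L (σ p₀.1.proj) p := by
    intro p₀ p hp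
    rw [← sub_eq_zero]
    refine eq_zero_of_omega_eq_zero hL hreg (fun w' => ?_) ?_
    · rw [map_sub, LinearMap.sub_apply, (h _).omega_reebElement hL hreg,
        hp.omega_reebElement hL hreg, sub_zero]
    · rw [map_sub, etaL_reebElement, etaL_reebElement, sub_self]
  refine ⟨⟨fun p => reebElement A L (σ p.1.proj) p, ?_, ?_⟩, ?_, ?_, ?_⟩
  · refine ((0 : Sec n m E).contMDiff.comp contMDiff_proj_ext).congr fun p => ?_
    exact congrArg (TotalSpace.mk p.1.proj) (prolBase_reebElement (A := A) p)
  · intro p₀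
    refine ((h p₀.1.proj).contMDiffAt_reebElement (A := A) hL hreg).congr_of_eventuallyEq ?_
    filter_upwards [(h p₀.1.proj).eventually_ext] with p hp
    exact congrArg (fun w : prolFiber A p => (⟨p, prolAnchor A p w⟩ :
      TangentBundle (extModel n m) (ExtPhase m E))) (huniq p₀ p hp)
  · exact fun p w' => (h p.1.proj).omega_reebElement hL hreg w'
  · exact fun p => etaL_reebElement p
  · exact fun p => (h p.1.proj).mvfderiv_energy_reebElement hL hreg

end Reeb

/-! ### The Lagrangian section. -/

section Lagrangian

variable {A : LieAlgebroid n m E} {L : ExtPhase m E → ℝ} {D : LocalData n m E}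
  {σ : Fin m → Sec n m E} {G : Fin m → ProlSection A}

variable (G) in
/-- A linear functional on the prolongation vanishes if it vanishes on lifts of a frame, on the
vertical lifts and on `∂/∂s`. -/
lemma LocalData.Extends.functional_eq_zero {p : ExtPhase m E} (h : D.Extends σ p.1.proj)
    (hG : ∀ α, (G α).base p = σ α p.1.proj) (Φ : prolFiber A p →ₗ[ℝ] ℝ)
    (h₁ : ∀ α, Φ ((G α).val p) = 0) (h₂ : ∀ c, Φ (vertLift A p c) = 0)
    (h₃ : Φ (sElement A p) = 0) : Φ = 0 := by
  ext w
  have hb : prolBase A p (w - ∑ α, D.compAt A p α w • (G α).val p) = 0 := by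
    rw [map_sub, map_sum, sub_eq_zero]
    conv_lhs => rw [h.eq_sum (prolBase A p w)]
    refine Finset.sum_congr rfl fun α _ => ?_
    rw [map_smul, ← hG α]
    rfl
  obtain ⟨c, hc⟩ := eq_vertLift_add_sElement hb
  rw [sub_eq_iff_eq_add] at hc
  rw [hc]
  simp [h₁, h₂, h₃]

variable (L D σ G) in
/-- The derivative of the momentum `L_β` along the Lagrangian section. -/
def momentumRate (β : Fin m) (p : ExtPhase m E) : ℝ :=
  ∑ α, D.yCoord α p * mvfderiv (extModel n m) (momentum L (σ α)) p ((G β).vec p) +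
    ∑ α, D.yCoord α p * momentum L (A.bracket (σ α) (σ β)) p -
    mvfderiv (extModel n m) (energy A L) p ((G β).vec p) +
    mvfderiv (extModel n m) L p (sVector p) * momentum L (σ β) p

variable (L D σ G) in
/-- The vertical components of the Lagrangian section in the local frame. -/
def lagrangianCoeff (p : ExtPhase m E) : Fin m → ℝ :=
  (hessian L σ p)⁻¹.mulVec fun β => momentumRate L D σ G β p -
    ∑ α, D.yCoord α p * mvfderiv (extModel n m) (momentum L (σ β)) p ((G α).vec p) -
    L p * mvfderiv (extModel n m) (momentum L (σ β)) p (sVector p)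

variable (L D σ G) in
/-- The value at `p` of the Lagrangian section, in the local frame. -/
def lagrangianElement (p : ExtPhase m E) : prolFiber A p :=
  ∑ α, D.yCoord α p • (G α).val p +
    vertLift A p (∑ β, lagrangianCoeff L D σ G p β • σ β p.1.proj) + L p • sElement A p

/-- `lagrangianCoeff` applies H⁻¹ to the required rate minus the contributions of the lifts and of
∂/∂s; the vertical part supplies exactly that difference. -/
lemma dMomAt_lagrangianElement (p : ExtPhase m E) (hdet : (hessian L σ p).det ≠ 0) (β : Fin m) :
    LocalData.dMomAt A L σ p β (lagrangianElement L D σ G p) = momentumRate L D σ G β p := by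
  rw [lagrangianElement, map_add, map_add, LocalData.dMomAt_vertLift, lagrangianCoeff,
    Matrix.mulVec_mulVec, Matrix.mul_nonsing_inv _ (isUnit_iff_ne_zero.mpr hdet),
    Matrix.one_mulVec, map_sum, map_smul]
  simp only [map_smul, smul_eq_mul]
  change (∑ α, D.yCoord α p * mvfderiv (extModel n m) (momentum L (σ β)) p ((G α).vec p)) +
    (_ - (∑ α, D.yCoord α p * mvfderiv (extModel n m) (momentum L (σ β)) p ((G α).vec p)) - _) +
    L p * mvfderiv (extModel n m) (momentum L (σ β)) p (sVector p) = _
  ring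

lemma LocalData.Extends.prolBase_lagrangianElement {p : ExtPhase m E} (h : D.Extends σ p.1.proj)
    (hG : ∀ α, (G α).base p = σ α p.1.proj) :
    prolBase A p (lagrangianElement L D σ G p) = p.1.snd := by
  rw [lagrangianElement, map_add, map_add, prolBase_vertLift, map_smul, prolBase_sElement,
    smul_zero, add_zero, add_zero, map_sum]
  conv_rhs => rw [h.eq_sum p.1.snd]
  refine Finset.sum_congr rfl fun α _ => ?_
  rw [map_smul, ← hG α]
  rfl

lemma mvfderiv_snd_lagrangianElement {p : ExtPhase m E}
    (hs : ∀ α, mvfderiv (extModel n m) (Prod.snd : ExtPhase m E → ℝ) p ((G α).vec p) = 0) :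
    mvfderiv (extModel n m) (Prod.snd : ExtPhase m E → ℝ) p
      (prolAnchor A p (lagrangianElement L D σ G p)) = L p := by
  have hs' : ∀ α, mvfderiv (extModel n m) (Prod.snd : ExtPhase m E → ℝ) p
    (prolAnchor A p ((G α).val p)) = 0 := hs
  rw [lagrangianElement]
  simp only [map_add, map_sum, map_smul, hs', prolAnchor_sElement, mvfderiv_snd_sVector,
    smul_zero, Finset.sum_const_zero]
  simp [mvfderiv_snd_vertVector]

lemma LocalData.Extends.etaL_lagrangianElement {p : ExtPhase m E} (h : D.Extends σ p.1.proj)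
    (hG : ∀ α, (G α).base p = σ α p.1.proj)
    (hs : ∀ α, mvfderiv (extModel n m) (Prod.snd : ExtPhase m E → ℝ) p ((G α).vec p) = 0) :
    etaL A L p (lagrangianElement L D σ G p) = - energy A L p := by
  rw [etaL_apply, h.prolBase_lagrangianElement hG, energy_apply, mvfderiv_snd_lagrangianElement hs]
  ring

/-- The hypothesis on `w` is the SODE condition at `p`, so X^α(w) = y^α and `w` enters further only
through dP_α(w). The formula serves both to construct Γ and to extract the Herglotz equations from
it. -/
lemma LocalData.Extends.omega_of_base_eq (hL : ContMDiff (extModel n m) 𝓘(ℝ, ℝ) ∞ L)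
    {p : ExtPhase m E} (h : D.Extends σ p.1.proj) {w : prolFiber A p}
    (hw : prolBase A p w = p.1.snd) (w' : prolFiber A p) :
    omega A L p w w' = ∑ α, D.yCoord α p * LocalData.dMomAt A L σ p α w' -
      ∑ α, LocalData.dMomAt A L σ p α w * D.compAt A p α w' +
      ∑ β, (∑ α, D.yCoord α p * momentum L (A.bracket (σ α) (σ β)) p) * D.compAt A p β w' := by
  have hc : ∀ α, D.compAt A p α w = D.yCoord α p := fun α => congrArg _ hw
  rw [h.omega_eq hL, LocalData.form_apply]
  simp only [hc, Finset.sum_sub_distrib, Finset.sum_mul]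
  congr 1
  rw [Finset.sum_comm]
  refine Finset.sum_congr rfl fun β _ => Finset.sum_congr rfl fun α _ => ?_
  change momentum L (A.bracket (σ α) (σ β)) p * _ = _
  ring

lemma LocalData.Extends.compAt_eq {p : ExtPhase m E} (h : D.Extends σ p.1.proj) {w : prolFiber A p}
    {β : Fin m} (hw : prolBase A p w = σ β p.1.proj) (α : Fin m) :
    D.compAt A p α w = if α = β then 1 else 0 := by
  rw [← h.coeff_apply]
  exact congrArg _ hw

/-- It suffices to test on lifts of the frame, vertical lifts and ∂/∂s. The last two cases use only
the SODE condition and the energy formulas. On the lift of σ_β the equation says that dP_β takes the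
value `momentumRate`. -/
lemma LocalData.Extends.omega_lagrangianElement (hL : ContMDiff (extModel n m) 𝓘(ℝ, ℝ) ∞ L)
    (hreg : IsRegular L) {p : ExtPhase m E} (h : D.Extends σ p.1.proj)
    (hG : ∀ α, (G α).base p = σ α p.1.proj)
    (hs : ∀ α, mvfderiv (extModel n m) (Prod.snd : ExtPhase m E → ℝ) p ((G α).vec p) = 0)
    (w' : prolFiber A p) :
    omega A L p (lagrangianElement L D σ G p) w' = dFun A (energy A L) p w' +
      mvfderiv (extModel n m) L p (sVector p) * etaL A L p w' := by
  have hΦ : omega A L p (lagrangianElement L D σ G p) - dFun A (energy A L) p -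
      mvfderiv (extModel n m) L p (sVector p) • etaL A L p = 0 := by
    have hom := h.omega_of_base_eq hL (h.prolBase_lagrangianElement (L := L) hG)
    refine h.functional_eq_zero G hG _ (fun β => ?_) (fun c => ?_) ?_
    · have hη : etaL A L p ((G β).val p) = - momentum L (σ β) p := by
        rw [etaL_apply]
        have h1 : prolBase A p ((G β).val p) = σ β p.1.proj := hG β
        have h2 : mvfderiv (extModel n m) (Prod.snd : ExtPhase m E → ℝ) p
          (prolAnchor A p ((G β).val p)) = 0 := hs β
        rw [h1, h2, zero_sub]
        rfl
      have hE : dFun A (energy A L) p ((G β).val p) =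
        mvfderiv (extModel n m) (energy A L) p ((G β).vec p) := rfl
      have hd : ∀ α, LocalData.dMomAt A L σ p α ((G β).val p) =
        mvfderiv (extModel n m) (momentum L (σ α)) p ((G β).vec p) := fun α => rfl
      simp only [LinearMap.sub_apply, LinearMap.smul_apply, smul_eq_mul, hom, hη, hE, hd,
        h.compAt_eq (hG β), dMomAt_lagrangianElement p (h.det_hessian_ne_zero hL hreg),
        mul_ite, mul_one, mul_zero, Finset.sum_ite_eq', Finset.mem_univ, if_true, momentumRate]
      ring
    · have hE : dFun A (energy A L) p (vertLift A p c) =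
        ∑ α, D.yCoord α p * LocalData.dMomAt A L σ p α (vertLift A p c) :=
          h.mvfderiv_energy_vertVector hL c
      simp only [LinearMap.sub_apply, LinearMap.smul_apply, smul_eq_mul, hom, hE, etaL_vertLift,
        LocalData.compAt_vertLift, mul_zero, Finset.sum_const_zero]
      ring
    · have hE : dFun A (energy A L) p (sElement A p) =
        ∑ α, D.yCoord α p * LocalData.dMomAt A L σ p α (sElement A p) -
          mvfderiv (extModel n m) L p (sVector p) := h.mvfderiv_energy_sVector hL
      simp only [LinearMap.sub_apply, LinearMap.smul_apply, smul_eq_mul, hom, hE, etaL_sElement,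
        LocalData.compAt_sElement, mul_zero, Finset.sum_const_zero]
      ring
  have := congrArg (fun Φ : prolFiber A p →ₗ[ℝ] ℝ => Φ w') hΦ
  simp only [LinearMap.sub_apply, LinearMap.smul_apply, smul_eq_mul, LinearMap.zero_apply] at this
  linarith

lemma LocalData.Extends.contMDiffAt_lagrangianElement
    (hL : ContMDiff (extModel n m) 𝓘(ℝ, ℝ) ∞ L) (hreg : IsRegular L) {p : ExtPhase m E}
    (h : D.Extends σ p.1.proj) :
    ContMDiffAt (extModel n m) (extModel n m).tangent ∞
      (fun p => (⟨p, prolAnchor A p (lagrangianElement L D σ G p)⟩ :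
        TangentBundle (extModel n m) (ExtPhase m E))) p := by
  have hy : ∀ α, ContMDiffAt (extModel n m) 𝓘(ℝ, ℝ) ∞ (D.yCoord α) p :=
    fun α => D.contMDiffAt_yCoord h.1 α
  have hm : ∀ τ : Sec n m E, ContMDiffAt (extModel n m) 𝓘(ℝ, ℝ) ∞ (momentum L τ) p :=
    fun τ => (contMDiff_momentum hL τ).contMDiffAt
  have hmG : ∀ α β, ContMDiffAt (extModel n m) 𝓘(ℝ, ℝ) ∞
      (fun p => mvfderiv (extModel n m) (momentum L (σ α)) p ((G β).vec p)) p := fun α β =>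
    (contMDiff_mvfderiv_apply (contMDiff_momentum hL (σ α)) (G β).contMDiff_snd).contMDiffAt
  have hms : ∀ α, ContMDiffAt (extModel n m) 𝓘(ℝ, ℝ) ∞
      (fun p => mvfderiv (extModel n m) (momentum L (σ α)) p (sVector p)) p := fun α =>
    (contMDiff_mvfderiv_apply (contMDiff_momentum hL (σ α)) contMDiff_sVector).contMDiffAt
  have hr : ∀ β, ContMDiffAt (extModel n m) 𝓘(ℝ, ℝ) ∞ (momentumRate L D σ G β) p := fun β => by
    refine ((ContMDiffAt.add ?_ ?_).sub ?_).add ?_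
    · exact contMDiffAt_finsetSum fun α _ => (hy α).mul (hmG α β)
    · exact contMDiffAt_finsetSum fun α _ => (hy α).mul (hm _)
    · exact (contMDiff_mvfderiv_apply (contMDiff_energy hL) (G β).contMDiff_snd).contMDiffAt
    · exact (contMDiff_mvfderiv_apply hL contMDiff_sVector).contMDiffAt.mul (hm _)
  have hc : ∀ β, ContMDiffAt (extModel n m) 𝓘(ℝ, ℝ) ∞ (fun p => lagrangianCoeff L D σ G p β) p :=
    fun β => contMDiffAt_inv_mulVec (fun i j => (contMDiff_hessian hL i j).contMDiffAt)
      (fun i => ((hr i).sub (contMDiffAt_finsetSum fun α _ => (hy α).mul (hmG i α))).sub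
        (hL.contMDiffAt.mul (hms i))) (h.det_hessian_ne_zero hL hreg) β
  have h1 := ((ContMDiffAt.sum_section (s := Finset.univ) fun α _ =>
      (hy α).smul_section (G α).contMDiff_snd.contMDiffAt).add_section
    (ContMDiffAt.sum_section (s := Finset.univ) fun β _ =>
      (hc β).smul_section (contMDiff_vertVector (σ β)).contMDiffAt)).add_section
    (hL.contMDiffAt.smul_section contMDiff_sVector.contMDiffAt)
  refine h1.congr_of_eventuallyEq (Filter.Eventually.of_forall fun p' => ?_)
  refine congrArg (TotalSpace.mk p') ?_
  rw [lagrangianElement, map_add, map_add, map_smul, prolAnchor_sElement, map_sum, map_sum, map_sum]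
  simp only [map_smul, prolAnchor_vertLift]
  rfl

/-- The Lagrangian section of a regular Lagrangian. -/
lemma exists_lagrangian (hL : ContMDiff (extModel n m) 𝓘(ℝ, ℝ) ∞ L) (hreg : IsRegular L) :
    ∃ Γ : ProlSection A, (∀ p, Γ.base p = p.1.snd) ∧
      (∀ p, mvfderiv (extModel n m) (Prod.snd : ExtPhase m E → ℝ) p (Γ.vec p) = L p) ∧
      ∀ p w', omega A L p (Γ.val p) w' = dFun A (energy A L) p w' +
        mvfderiv (extModel n m) L p (sVector p) * etaL A L p w' := by
  have hex : ∀ q : Q, ∃ (D : LocalData n m E) (σ : Fin m → Sec n m E) (G : Fin m → ProlSection A),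
      D.Extends σ q ∧ (∀ α p, mvfderiv (extModel n m) (Prod.snd : ExtPhase m E → ℝ) p
        ((G α).vec p) = 0) ∧ ∀ᶠ q' in 𝓝 q, ∀ α (a : E q') s, (G α).base (⟨q', a⟩, s) = σ α q' := by
    intro q
    obtain ⟨σ, hσ⟩ := (LocalData.ofPoint (n := n) (m := m) E q).exists_extend (LocalData.mem_ofPoint q)
    choose G hs hG using fun α => exists_lift A q (σ α)
    exact ⟨_, σ, G, ⟨LocalData.mem_ofPoint q, hσ⟩, hs, Filter.eventually_all.mpr hG⟩
  choose D σ G h hs hG using hex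
  have hGp : ∀ p : ExtPhase m E, ∀ α, (G p.1.proj α).base p = σ p.1.proj α p.1.proj := fun p α =>
    (hG p.1.proj).self_of_nhds α p.1.snd p.2
  have hbase : ∀ p : ExtPhase m E, prolBase A p (lagrangianElement L (D p.1.proj) (σ p.1.proj)
      (G p.1.proj) p) = p.1.snd := fun p => (h p.1.proj).prolBase_lagrangianElement (hGp p)
  -- Frame independence again gives smoothness. The extra hypothesis is needed because the lifts
  -- chosen at `p₀` project to the frame only near `p₀`.
  have huniq : ∀ (p₀ p : ExtPhase m E), (D p₀.1.proj).Extends (σ p₀.1.proj) p.1.proj →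
      (∀ α, (G p₀.1.proj α).base p = σ p₀.1.proj α p.1.proj) →
      lagrangianElement L (D p.1.proj) (σ p.1.proj) (G p.1.proj) p =
        lagrangianElement L (D p₀.1.proj) (σ p₀.1.proj) (G p₀.1.proj) p := by
    intro p₀ p hp hp'
    rw [← sub_eq_zero]
    refine eq_zero_of_omega_eq_zero hL hreg (fun w' => ?_) ?_
    · rw [map_sub, LinearMap.sub_apply,
        (h p.1.proj).omega_lagrangianElement hL hreg (hGp p) (fun α => hs _ α p),
        hp.omega_lagrangianElement hL hreg hp' (fun α => hs _ α p), sub_self]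
    · rw [map_sub, (h p.1.proj).etaL_lagrangianElement (hGp p) (fun α => hs _ α p),
        hp.etaL_lagrangianElement hp' (fun α => hs _ α p), sub_self]
  refine ⟨⟨fun p => lagrangianElement L (D p.1.proj) (σ p.1.proj) (G p.1.proj) p, ?_, ?_⟩,
    hbase, ?_, ?_⟩
  · refine (contMDiff_fst (I := (𝓡 n).prod 𝓘(ℝ, EuclideanSpace ℝ (Fin m)))
      (J := 𝓘(ℝ, ℝ))).congr fun p => ?_
    exact congrArg (TotalSpace.mk p.1.proj) (hbase p)
  · intro p₀
    refine ((h p₀.1.proj).contMDiffAt_lagrangianElement (A := A) (G := G p₀.1.proj)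
      hL hreg).congr_of_eventuallyEq ?_
    filter_upwards [(h p₀.1.proj).eventually_ext,
      (contMDiff_proj_ext (n := n)).continuous.continuousAt.eventually (hG p₀.1.proj)] with p hp hp'
    exact congrArg (fun w : prolFiber A p => (⟨p, prolAnchor A p w⟩ :
      TangentBundle (extModel n m) (ExtPhase m E))) (huniq p₀ p hp fun α => hp' α p.1.snd p.2)
  · exact fun p => mvfderiv_snd_lagrangianElement (fun α => hs _ α p)
  · exact fun p w' => (h p.1.proj).omega_lagrangianElement hL hreg (hGp p) (fun α => hs _ α p) w'

end Lagrangian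

/-! ### The Pfaffian of the standard symplectic matrix. -/

section Pfaffian

/-- The indices `0` and `2i + 1`, `2i + 2` for `i < k`. -/
def pairIndex (k : ℕ) : Option (Fin k × Bool) → Fin (2 * k + 1)
  | none => 0
  | some (i, false) => ⟨2 * i + 1, by omega⟩
  | some (i, true) => ⟨2 * i + 2, by omega⟩

lemma pairIndex_injective (k : ℕ) : Function.Injective (pairIndex k) := by
  rintro (_ | ⟨i, _ | _⟩) (_ | ⟨j, _ | _⟩) h <;>
    simp only [pairIndex, Fin.ext_iff, Fin.val_zero] at h <;> first | rfl | omega | skip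
  all_goals
    have : i = j := Fin.ext (by omega)
    rw [this]

/-- `pairIndex` as an equivalence. -/
def pairEquiv (k : ℕ) : Option (Fin k × Bool) ≃ Fin (2 * k + 1) :=
  Equiv.ofBijective (pairIndex k) ((Fintype.bijective_iff_injective_and_card _).mpr
    ⟨pairIndex_injective k, by simp [mul_comm]⟩)

/-- The standard symplectic matrix. -/
def stdSymplectic {k : ℕ} (x y : Fin k × Bool) : ℝ :=
  if x.1 = y.1 then (if x.2 = y.2 then 0 else if x.2 then -1 else 1) else 0

lemma stdSymplectic_ne_zero {k : ℕ} {x y : Fin k × Bool} (h : stdSymplectic x y ≠ 0) :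
    y = (x.1, !x.2) ∧ stdSymplectic x y = if x.2 then -1 else 1 := by
  obtain ⟨i, a⟩ := x
  obtain ⟨j, b⟩ := y
  unfold stdSymplectic at *
  by_cases hij : i = j
  · subst hij
    cases a <;> cases b <;> simp_all
  · simp [hij] at h

/-- The permutations preserving the pairs contribute positively to the Pfaffian of the standard
symplectic matrix. -/
lemma sign_mul_prod_stdSymplectic {k : ℕ} (τ : Equiv.Perm (Fin k × Bool))
    (h : ∀ i, stdSymplectic (τ (i, false)) (τ (i, true)) ≠ 0) :
    (Equiv.Perm.sign τ : ℝ) * ∏ i, stdSymplectic (τ (i, false)) (τ (i, true)) = 1 := by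
  have h1 := fun i => (stdSymplectic_ne_zero (h i)).1
  have h2 := fun i => (stdSymplectic_ne_zero (h i)).2
  -- If the pairs `i` and `j` land in the same pair, then τ(i, false) equals τ(j, false) or its
  -- partner τ(j, true); either way i = j.
  have hinj : Function.Injective fun i => (τ (i, false)).1 := by
    intro i j hij
    by_cases hb : (τ (i, false)).2 = (τ (j, false)).2
    · exact congrArg Prod.fst (τ.injective (Prod.ext hij hb))
    · have : τ (i, false) = τ (j, true) := by
        rw [h1 j]
        refine Prod.ext hij ?_
        revert hb
        cases (τ (i, false)).2 <;> cases (τ (j, false)).2 <;> simp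
      exact congrArg Prod.fst (τ.injective this)
  let ψ : Equiv.Perm (Fin k) := Equiv.ofBijective _ (Finite.injective_iff_bijective.mp hinj)
  let κ : Fin k → Equiv.Perm Bool := fun i => if (τ (i, false)).2 then Equiv.swap false true else 1
  -- τ flips some of the pairs internally (κ) and then permutes the pairs as blocks (ψ).
  have hτ : τ = Equiv.prodCongrLeft (fun _ => ψ) * Equiv.prodCongrRight κ := by
    ext1 x
    obtain ⟨i, b⟩ := x
    rw [Equiv.Perm.mul_apply, Equiv.prodCongrRight_apply, Equiv.prodCongrLeft_apply]
    cases b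
    · refine Prod.ext rfl ?_
      simp only [κ]
      cases hb : (τ (i, false)).2 <;> simp
    · rw [h1 i]
      refine Prod.ext rfl ?_
      simp only [κ]
      cases hb : (τ (i, false)).2 <;> simp
  have hs : Equiv.Perm.sign τ = ∏ i, Equiv.Perm.sign (κ i) := by
    conv_lhs => rw [hτ]
    -- ψ acts once on each of the two layers of `Bool`, so its sign occurs squared. Only the flips
    -- remain, and each meets an entry -1 of the symplectic matrix.
    rw [map_mul, Equiv.Perm.sign_prodCongrLeft, Equiv.Perm.sign_prodCongrRight]
    simp
  rw [hs]
  push_cast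
  rw [← Finset.prod_mul_distrib]
  refine Finset.prod_eq_one fun i _ => ?_
  rw [h2 i]
  simp only [κ]
  cases hb : (τ (i, false)).2 <;> simp

/-- Every nonzero term equals 1, and the identity gives one. Since η vanishes off the index 0, a
nonzero term forces σ to fix 0; nonzero entries of Ω then force σ to preserve the pairs, where
`sign_mul_prod_stdSymplectic` applies. -/
lemma sum_perm_pos {k : ℕ} (η : Fin (2 * k + 1) → ℝ) (Ω : Fin (2 * k + 1) → Fin (2 * k + 1) → ℝ)
    (hη₀ : η 0 = 1) (hη : ∀ x, η (pairEquiv k (some x)) = 0)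
    (hΩ : ∀ x y, Ω (pairEquiv k (some x)) (pairEquiv k (some y)) = stdSymplectic x y) :
    0 < ∑ σ : Equiv.Perm (Fin (2 * k + 1)), (Equiv.Perm.sign σ : ℝ) *
      (η (σ 0) * ∏ i : Fin k, Ω (σ ⟨2 * i + 1, by omega⟩) (σ ⟨2 * i + 2, by omega⟩)) := by
  have key : ∀ σ : Equiv.Perm (Fin (2 * k + 1)), (Equiv.Perm.sign σ : ℝ) *
      (η (σ 0) * ∏ i : Fin k, Ω (σ ⟨2 * i + 1, by omega⟩) (σ ⟨2 * i + 2, by omega⟩)) ≠ 0 →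
      (Equiv.Perm.sign σ : ℝ) *
      (η (σ 0) * ∏ i : Fin k, Ω (σ ⟨2 * i + 1, by omega⟩) (σ ⟨2 * i + 2, by omega⟩)) = 1 := by
    intro σ hσ
    have h0 : σ 0 = 0 := by
      by_contra h0
      obtain ⟨x, hx⟩ : ∃ x, pairEquiv k (some x) = σ 0 := by
        obtain ⟨y, hy⟩ := (pairEquiv k).surjective (σ 0)
        cases y with
        | none => exact absurd hy.symm h0
        | some x => exact ⟨x, hy⟩
      rw [← hx, hη] at hσ
      simp at hσ
    -- With the index 0 as `none`, fixing 0 lets `Equiv.removeNone` restrict the permutation to the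
    -- pairs without changing its sign.
    set τ : Equiv.Perm (Option (Fin k × Bool)) := (pairEquiv k).symm.permCongr σ with hτdef
    have hτ0 : τ none = none := by
      rw [hτdef, Equiv.permCongr_apply]
      refine (pairEquiv k).symm_apply_eq.mpr ?_
      exact h0
    have hτ : Equiv.optionCongr (Equiv.removeNone τ) = τ := by
      rw [map_equiv_removeNone, hτ0, Equiv.swap_self]; rfl
    have happ : ∀ x, σ (pairEquiv k (some x)) = pairEquiv k (some (Equiv.removeNone τ x)) := by
      intro x
      have : τ (some x) = some (Equiv.removeNone τ x) := by
        conv_lhs => rw [← hτ]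
        rfl
      rw [← this, hτdef, Equiv.permCongr_apply]
      simp
    have hsign : Equiv.Perm.sign σ = Equiv.Perm.sign (Equiv.removeNone τ) := by
      rw [← Equiv.optionCongr_sign (Equiv.removeNone τ), hτ, hτdef, Equiv.Perm.sign_permCongr]
    have hprod : ∀ i : Fin k, Ω (σ ⟨2 * i + 1, by omega⟩) (σ ⟨2 * i + 2, by omega⟩) =
        stdSymplectic (Equiv.removeNone τ (i, false)) (Equiv.removeNone τ (i, true)) := by
      intro i
      rw [← hΩ, ← happ, ← happ]
      rfl
    simp only [hprod, h0, hη₀, one_mul, hsign] at hσ ⊢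
    refine sign_mul_prod_stdSymplectic _ fun i => ?_
    exact Finset.prod_ne_zero_iff.mp (right_ne_zero_of_mul hσ) i (Finset.mem_univ i)
  refine Finset.sum_pos' (fun σ _ => ?_) ⟨1, Finset.mem_univ _, ?_⟩
  · by_cases h : (Equiv.Perm.sign σ : ℝ) *
      (η (σ 0) * ∏ i : Fin k, Ω (σ ⟨2 * i + 1, by omega⟩) (σ ⟨2 * i + 2, by omega⟩)) = 0
    · exact h.ge
    · rw [key σ h]; exact zero_le_one
  · rw [key 1]
    · exact zero_lt_one
    · have h1 : ∀ i : Fin k, Ω ⟨2 * i + 1, by omega⟩ ⟨2 * i + 2, by omega⟩ = 1 := fun i =>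
        (hΩ (i, false) (i, true)).trans (by simp [stdSymplectic])
      simp [h1, hη₀]

end Pfaffian

/-! ### The contact property. -/

section Contact

variable {A : LieAlgebroid n m E} {L : ExtPhase m E → ℝ} {D : LocalData n m E}
  {σ : Fin m → Sec n m E}

/-- An element of the prolongation is determined by its projection to `E` and its vertical part. -/
def prolEquiv (p : ExtPhase m E) :
    prolFiber A p ≃ₗ[ℝ] E p.1.proj × (EuclideanSpace ℝ (Fin m) × ℝ) where
  toFun w := (w.1.1,
    ((w.1.2 : (EuclideanSpace ℝ (Fin n) × EuclideanSpace ℝ (Fin m)) × ℝ).1.2,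
     (w.1.2 : (EuclideanSpace ℝ (Fin n) × EuclideanSpace ℝ (Fin m)) × ℝ).2))
  invFun x := ⟨(x.1, (((A.anchor p.1.proj x.1, x.2.1), x.2.2) :
      (EuclideanSpace ℝ (Fin n) × EuclideanSpace ℝ (Fin m)) × ℝ)),
    (mfderiv_proj_apply p (((A.anchor p.1.proj x.1, x.2.1), x.2.2) :
      (EuclideanSpace ℝ (Fin n) × EuclideanSpace ℝ (Fin m)) × ℝ)).symm⟩
  map_add' _ _ := rfl
  map_smul' _ _ := rfl
  left_inv w := by
    have h : (A.anchor p.1.proj w.1.1 : EuclideanSpace ℝ (Fin n)) =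
        (w.1.2 : (EuclideanSpace ℝ (Fin n) × EuclideanSpace ℝ (Fin m)) × ℝ).1.1 :=
      Eq.trans w.2 (mfderiv_proj_apply p w.1.2)
    exact Subtype.ext (Prod.ext rfl (Prod.ext (Prod.ext h rfl) rfl))
  right_inv _ := rfl

lemma finrank_prolFiber (p : ExtPhase m E) : Module.finrank ℝ (prolFiber A p) = 2 * m + 1 := by
  let e := (trivializationAt (EuclideanSpace ℝ (Fin m)) E p.1.proj).linearEquivAt ℝ p.1.proj
    (FiberBundle.mem_baseSet_trivializationAt' _)
  rw [((prolEquiv (A := A) p).trans (e.prodCongr (LinearEquiv.refl ℝ _))).finrank_eq, Module.finrank_prod,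
    Module.finrank_prod]
  simp
  ring

lemma contMDiff_etaL (hL : ContMDiff (extModel n m) 𝓘(ℝ, ℝ) ∞ L) (Z : ProlSection A) :
    ContMDiff (extModel n m) 𝓘(ℝ, ℝ) ∞ (fun p => etaL A L p (Z.val p)) := by
  intro p
  have hD := LocalData.mem_ofPoint (n := n) (m := m) (E := E) p.1.proj
  set D := LocalData.ofPoint (n := n) (m := m) E p.1.proj
  obtain ⟨σ, hσ⟩ := D.exists_extend hD
  have h : D.Extends σ p.1.proj := ⟨hD, hσ⟩
  have hs : ContMDiff (extModel n m) 𝓘(ℝ, ℝ) ∞ (Prod.snd : ExtPhase m E → ℝ) := contMDiff_snd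
  refine ContMDiffAt.congr_of_eventuallyEq
    ((contMDiff_mvfderiv_apply hs Z.contMDiff_snd).contMDiffAt.sub
      (contMDiffAt_finsetSum (t := Finset.univ) fun α _ =>
        (D.contMDiffAt_comp Z hD α).mul (contMDiff_momentum hL (σ α)).contMDiffAt)) ?_
  filter_upwards [h.eventually_ext] with p' hp'
  rw [etaL_apply]
  refine congrArg₂ (· - ·) rfl ?_
  change fibDeriv L p' (Z.base p') = _
  conv_lhs => rw [hp'.eq_sum (Z.base p')]
  simp only [map_sum, map_smul, smul_eq_mul]
  rfl

lemma omega_skew (p : ExtPhase m E) (w w' : prolFiber A p) :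
    omega A L p w w' = - omega A L p w' w := by
  unfold omega
  simp only [LocalData.form_apply]
  rw [neg_add, ← Finset.sum_neg_distrib]
  refine congrArg₂ (· + ·) (Finset.sum_congr rfl fun α _ => by ring) ?_
  rw [Finset.sum_comm]
  simp only [← Finset.sum_neg_distrib]
  refine Finset.sum_congr rfl fun α _ => Finset.sum_congr rfl fun β _ => ?_
  rw [A.bracket_apply_skew, map_neg]
  ring

/-- A symplectic basis of the kernel of `η_L` for the form `dη_L`. -/
lemma exists_symplectic (hL : ContMDiff (extModel n m) 𝓘(ℝ, ℝ) ∞ L) (hreg : IsRegular L)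
    (p : ExtPhase m E) {R : prolFiber A p} (hR : ∀ w, omega A L p R w = 0)
    (hR1 : etaL A L p R = 1) :
    ∃ b : Fin m × Bool → prolFiber A p, (∀ x, etaL A L p (b x) = 0) ∧
      ∀ x y, omega A L p (b x) (b y) = stdSymplectic x y := by
  obtain ⟨D, σ, h⟩ : ∃ (D : LocalData n m E) (σ : Fin m → Sec n m E), D.Extends σ p.1.proj := by
    obtain ⟨σ, hσ⟩ := (LocalData.ofPoint (n := n) (m := m) E p.1.proj).exists_extend
      (LocalData.mem_ofPoint p.1.proj)
    exact ⟨_, σ, LocalData.mem_ofPoint p.1.proj, hσ⟩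
  have hR' : ∀ w, omega A L p w R = 0 := fun w => by rw [omega_skew, hR, neg_zero]
  have hdet : IsUnit (hessian L σ p).det := isUnit_iff_ne_zero.mpr (h.det_hessian_ne_zero hL hreg)
  choose G hs hG using fun α => exists_lift A p.1.proj (σ α)
  have hGb : ∀ α, prolBase A p ((G α).val p) = σ α p.1.proj := fun α =>
    (hG α).self_of_nhds p.1.snd p.2
  -- The columns of H⁻¹ make the vertical vectors dual to the differentials of the momenta.
  let V : Fin m → prolFiber A p := fun β =>
    vertLift A p (∑ γ, (hessian L σ p)⁻¹.mulVec (Pi.single β 1) γ • σ γ p.1.proj)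
  have hVd : ∀ α β, LocalData.dMomAt A L σ p α (V β) = if α = β then 1 else 0 := fun α β => by
    rw [LocalData.dMomAt_vertLift, Matrix.mulVec_mulVec, Matrix.mul_nonsing_inv _ hdet,
      Matrix.one_mulVec, Pi.single_apply]
  have hVη : ∀ β, etaL A L p (V β) = 0 := fun β => etaL_vertLift p _
  have hVV : ∀ α β, omega A L p (V α) (V β) = 0 := fun α β => by
    rw [h.omega_eq hL, LocalData.form_apply]
    simp [V]
  -- Subtracting a multiple of `R` moves the lift into ker η_L without affecting `omega`.
  let g : Fin m → prolFiber A p := fun α => (G α).val p - etaL A L p ((G α).val p) • R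
  have hgV : ∀ α β, omega A L p (g α) (V β) = if α = β then 1 else 0 := fun α β => by
    simp only [g, map_sub, map_smul, LinearMap.sub_apply, LinearMap.smul_apply, hR, smul_zero,
      sub_zero]
    rw [h.omega_eq hL, LocalData.form_apply]
    simp only [h.compAt_eq (hGb α), hVd]
    simp [V, eq_comm]
  have hVg : ∀ α β, omega A L p (V α) (g β) = -if β = α then 1 else 0 := fun α β => by
    rw [omega_skew, hgV]
  have hgη : ∀ α, etaL A L p (g α) = 0 := fun α => by
    simp only [g, map_sub, map_smul, hR1, smul_eq_mul, mul_one, sub_self]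
  -- Write ω for `omega`. Each of the two cross terms in ω(g'_α, g'_β) contributes -ω(g_α, g_β)/2,
  -- so the factor 1/2 makes the span of the g' isotropic. The pairing with `V` is unchanged because
  -- the `V` are isotropic.
  let g' : Fin m → prolFiber A p := fun α => g α + ∑ γ, (omega A L p (g α) (g γ) / 2) • V γ
  have hg'V : ∀ α β, omega A L p (g' α) (V β) = if α = β then 1 else 0 := fun α β => by
    simp [g', LinearMap.sum_apply, hVV, hgV]
  have hg'g' : ∀ α β, omega A L p (g' α) (g' β) = 0 := fun α β => by
    have h1 := omega_skew (L := L) p (g β) (g α)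
    simp only [g', map_add, map_sum, map_smul, LinearMap.add_apply, LinearMap.sum_apply,
      LinearMap.smul_apply, smul_eq_mul, hVV, hgV, hVg, mul_zero, Finset.sum_const_zero, mul_ite,
      mul_one, mul_neg, Finset.sum_neg_distrib, Finset.sum_ite_eq, Finset.mem_univ, if_true]
    simp only [add_zero, mul_ite, mul_one, mul_zero, Finset.sum_ite_eq, Finset.mem_univ, if_true]
    rw [h1]
    ring
  have hg'η : ∀ α, etaL A L p (g' α) = 0 := fun α => by
    simp [g', hgη, hVη]
  refine ⟨fun x => if x.2 then V x.1 else g' x.1, ?_, ?_⟩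
  · rintro ⟨α, _ | _⟩
    · simpa using hg'η α
    · simpa using hVη α
  · rintro ⟨α, _ | _⟩ ⟨β, _ | _⟩
    · simpa [stdSymplectic] using hg'g' α β
    · simpa [stdSymplectic] using hg'V α β
    · have := omega_skew (L := L) p (V α) (g' β)
      rw [hg'V] at this
      by_cases hαβ : α = β
      · subst hαβ
        simpa [stdSymplectic] using this
      · simpa [stdSymplectic, hαβ, Ne.symm hαβ] using this
    · simpa [stdSymplectic] using hVV α β

/-- `η_L` is a contact section if `L` is regular. -/
lemma isContactSection_etaL (hL : ContMDiff (extModel n m) 𝓘(ℝ, ℝ) ∞ L) (hreg : IsRegular L) :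
    IsContactSection A m (etaL A L) where
  finrank_eq := finrank_prolFiber
  contMDiff := contMDiff_etaL hL
  wedge_ne_zero p := by
    obtain ⟨R, hR, hR1, -⟩ := exists_reeb (A := A) hL hreg
    obtain ⟨b, hb, hbb⟩ := exists_symplectic hL hreg p (hR p) (hR1 p)
    choose Z hZ using fun x => exists_prolSection_eq p (b x)
    -- The Reeb section occupies slot 0, and the symplectic pairs fill the slots 2i + 1, 2i + 2 that
    -- `wedgePower` pairs together.
    let F : Fin (2 * m + 1) → ProlSection A := fun j => ((pairEquiv m).symm j).elim R Z
    have hF : ∀ x, F (pairEquiv m (some x)) = Z x := fun x => by simp [F]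
    have hF0 : F 0 = R := by
      have : F (pairEquiv m none) = R := by simp [F]
      exact this
    refine ⟨F, ?_⟩
    unfold wedgePower
    refine mul_ne_zero (by positivity) (ne_of_gt ?_)
    refine sum_perm_pos (fun j => etaL A L p ((F j).val p))
      (fun i j => dForm (etaL A L) (F i) (F j) p) ?_ (fun x => ?_) fun x y => ?_
    · simp only [hF0, hR1]
    · simp only [hF, hZ, hb]
    · simp only [hF, dForm_etaL_eq_omega hL, hZ, hbb]

end Contact

/-! ### Partial derivatives in the coordinates (q, y, s). -/

section Coordinates

variable {A : LieAlgebroid n m E} {L : ExtPhase m E → ℝ} {σ : Fin m → Sec n m E}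

namespace LocalData

variable (D : LocalData n m E)

/-- The coordinates `(q, y, s)` of a point. -/
def coords (p : ExtPhase m E) : (EuclideanSpace ℝ (Fin n) × (Fin m → ℝ)) × ℝ :=
  ((D.chart p.1.proj, fun α => D.yCoord α p), p.2)

variable (L) in
/-- The coordinate expression of `L`. -/
def inCoords (z : (EuclideanSpace ℝ (Fin n) × (Fin m → ℝ)) × ℝ) : ℝ := L (D.point z.1.1 z.1.2 z.2)

variable {D}

lemma mdifferentiableAt_coords {p : ExtPhase m E} (h : p.1.proj ∈ D.U) :
    MDifferentiableAt (extModel n m) 𝓘(ℝ, (EuclideanSpace ℝ (Fin n) × (Fin m → ℝ)) × ℝ)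
      D.coords p := by
  have hc : ContMDiffAt (extModel n m) 𝓘(ℝ, (EuclideanSpace ℝ (Fin n) × (Fin m → ℝ)) × ℝ) ∞
      D.coords p := by
    refine ContMDiffAt.prodMk_space (ContMDiffAt.prodMk_space ?_ ?_) contMDiffAt_snd
    · exact (D.contMDiffAt_chart h).comp p contMDiff_proj_ext.contMDiffAt
    · exact contMDiffAt_pi_space.mpr fun α => D.contMDiffAt_yCoord h α
  exact hc.mdifferentiableAt (by simp)

lemma differentiableAt_inCoords (hL : ContMDiff (extModel n m) 𝓘(ℝ, ℝ) ∞ L) {p : ExtPhase m E}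
    (h : p.1.proj ∈ D.U) : DifferentiableAt ℝ (D.inCoords L) (D.coords p) := by
  have hx : D.chart p.1.proj ∈ D.chart.target := D.chart.map_source (D.subset_source h)
  have hc : ContMDiffAt 𝓘(ℝ, (EuclideanSpace ℝ (Fin n) × (Fin m → ℝ)) × ℝ) 𝓘(ℝ, ℝ) ∞
      (D.inCoords L) (D.coords p) :=
    hL.contMDiffAt.comp (D.coords p) (D.contMDiffAt_point hx
      (by rwa [D.chart.left_inv (D.subset_source h)]) (fun α => D.yCoord α p) p.2)
  exact hc.contDiffAt.differentiableAt (by simp)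

lemma mvfderiv_coords_clm {p : ExtPhase m E} (h : p.1.proj ∈ D.U)
    (l : ((EuclideanSpace ℝ (Fin n) × (Fin m → ℝ)) × ℝ) →L[ℝ] ℝ)
    (v : TangentSpace (extModel n m) p) :
    mvfderiv (extModel n m) (l ∘ D.coords) p v =
      l (mfderiv (extModel n m) 𝓘(ℝ, (EuclideanSpace ℝ (Fin n) × (Fin m → ℝ)) × ℝ) D.coords p v) := by
  refine (mfderiv_comp_apply p l.mdifferentiableAt (mdifferentiableAt_coords h) v).trans ?_
  have : mfderiv 𝓘(ℝ, (EuclideanSpace ℝ (Fin n) × (Fin m → ℝ)) × ℝ) 𝓘(ℝ, ℝ) l (D.coords p) = l :=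
    l.mfderiv_eq
  exact congrArg (fun T : ((EuclideanSpace ℝ (Fin n) × (Fin m → ℝ)) × ℝ) →L[ℝ] ℝ => T _) this

lemma partial_eq_fderiv (hL : ContMDiff (extModel n m) 𝓘(ℝ, ℝ) ∞ L) {p : ExtPhase m E}
    (h : p.1.proj ∈ D.U) {γ : ℝ → (EuclideanSpace ℝ (Fin n) × (Fin m → ℝ)) × ℝ}
    {u : (EuclideanSpace ℝ (Fin n) × (Fin m → ℝ)) × ℝ} (hγ : HasDerivAt γ u 0)
    (h0 : γ 0 = D.coords p) :
    deriv (fun t => D.inCoords L (γ t)) 0 = fderiv ℝ (D.inCoords L) (D.coords p) u := by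
  have h1 := (differentiableAt_inCoords (D := D) hL h).hasFDerivAt
  rw [← h0] at h1 ⊢
  exact (h1.comp_hasDerivAt 0 hγ).deriv

lemma partialQ_eq (hL : ContMDiff (extModel n m) 𝓘(ℝ, ℝ) ∞ L) {p : ExtPhase m E}
    (h : p.1.proj ∈ D.U) (i : Fin n) : D.partialQ L i p =
      fderiv ℝ (D.inCoords L) (D.coords p) ((EuclideanSpace.single i 1, 0), 0) := by
  refine partial_eq_fderiv hL h (γ := fun t : ℝ =>
    ((D.chart p.1.proj + t • EuclideanSpace.single i 1, fun α => D.yCoord α p), p.2)) ?_ ?_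
  · refine ((HasDerivAt.const_add _ ?_).prodMk (hasDerivAt_const _ _)).prodMk (hasDerivAt_const _ _)
    simpa using (hasDerivAt_id (0 : ℝ)).smul_const (EuclideanSpace.single i (1 : ℝ))
  · simp [coords]

lemma partialY_eq (hL : ContMDiff (extModel n m) 𝓘(ℝ, ℝ) ∞ L) {p : ExtPhase m E}
    (h : p.1.proj ∈ D.U) (α : Fin m) : D.partialY L α p =
      fderiv ℝ (D.inCoords L) (D.coords p) ((0, Pi.single α 1), 0) := by
  refine partial_eq_fderiv hL h (γ := fun t : ℝ =>
    ((D.chart p.1.proj, (fun β => D.yCoord β p) + t • Pi.single α 1), p.2)) ?_ ?_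
  · refine ((hasDerivAt_const _ _).prodMk (HasDerivAt.const_add _ ?_)).prodMk (hasDerivAt_const _ _)
    simpa using (hasDerivAt_id (0 : ℝ)).smul_const (Pi.single α 1 : Fin m → ℝ)
  · simp [coords]

lemma partialS_eq (hL : ContMDiff (extModel n m) 𝓘(ℝ, ℝ) ∞ L) {p : ExtPhase m E}
    (h : p.1.proj ∈ D.U) : D.partialS L p =
      fderiv ℝ (D.inCoords L) (D.coords p) ((0, 0), 1) := by
  refine partial_eq_fderiv hL h (γ := fun t : ℝ =>
    ((D.chart p.1.proj, fun β => D.yCoord β p), p.2 + t)) ?_ ?_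
  · exact ((hasDerivAt_const _ _).prodMk (hasDerivAt_const _ _)).prodMk
      ((hasDerivAt_id (0 : ℝ)).const_add p.2)
  · simp [coords]

/-- The differential of `L` in the coordinates `(q, y, s)`. -/
lemma mvfderiv_eq_sum_partial (hL : ContMDiff (extModel n m) 𝓘(ℝ, ℝ) ∞ L) {p : ExtPhase m E}
    (h : p.1.proj ∈ D.U) (v : TangentSpace (extModel n m) p) :
    mvfderiv (extModel n m) L p v =
      ∑ i, mvfderiv (extModel n m) (D.qCoord i) p v * D.partialQ L i p +
      ∑ α, mvfderiv (extModel n m) (D.yCoord α) p v * D.partialY L α p +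
      mvfderiv (extModel n m) (Prod.snd : ExtPhase m E → ℝ) p v * D.partialS L p := by
  have hev : L =ᶠ[𝓝 p] D.inCoords L ∘ D.coords := by
    filter_upwards [D.isOpen_proj_preimage.mem_nhds h] with p' hp'
    exact congrArg L (D.point_coord hp').symm
  set z : (EuclideanSpace ℝ (Fin n) × (Fin m → ℝ)) × ℝ :=
    mfderiv (extModel n m) 𝓘(ℝ, (EuclideanSpace ℝ (Fin n) × (Fin m → ℝ)) × ℝ) D.coords p v with hz
  have h1 : mvfderiv (extModel n m) L p v = fderiv ℝ (D.inCoords L) (D.coords p) z := by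
    rw [mvfderiv_congr hev]
    refine (mfderiv_comp_apply p (differentiableAt_inCoords hL h).mdifferentiableAt
      (mdifferentiableAt_coords h) v).trans ?_
    have : mfderiv 𝓘(ℝ, (EuclideanSpace ℝ (Fin n) × (Fin m → ℝ)) × ℝ) 𝓘(ℝ, ℝ) (D.inCoords L)
      (D.coords p) = fderiv ℝ (D.inCoords L) (D.coords p) := mfderiv_eq_fderiv
    exact congrArg (fun T : ((EuclideanSpace ℝ (Fin n) × (Fin m → ℝ)) × ℝ) →L[ℝ] ℝ => T _) this
  have hq : ∀ i, mvfderiv (extModel n m) (D.qCoord i) p v = z.1.1 i := fun i =>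
    mvfderiv_coords_clm h ((EuclideanSpace.proj i).comp
      ((ContinuousLinearMap.fst ℝ _ _).comp (ContinuousLinearMap.fst ℝ _ _))) v
  have hy : ∀ α, mvfderiv (extModel n m) (D.yCoord α) p v = z.1.2 α := fun α =>
    mvfderiv_coords_clm h ((ContinuousLinearMap.proj α).comp
      ((ContinuousLinearMap.snd ℝ _ _).comp (ContinuousLinearMap.fst ℝ _ _))) v
  have hs : mvfderiv (extModel n m) (Prod.snd : ExtPhase m E → ℝ) p v = z.2 :=
    mvfderiv_coords_clm h (ContinuousLinearMap.snd ℝ _ _) v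
  have hdec : z = ∑ i, z.1.1 i • ((EuclideanSpace.single i 1, 0), 0) +
      ∑ α, z.1.2 α • ((0, Pi.single α 1), 0) + z.2 • ((0, 0), 1) := by
    refine Prod.ext (Prod.ext ?_ ?_) ?_
    · ext j
      simp [Prod.fst_sum, Pi.single_apply]
    · ext j
      simp [Prod.fst_sum, Prod.snd_sum, Pi.single_apply]
    · simp [Prod.snd_sum]
  rw [h1]
  conv_lhs => rw [hdec]
  simp only [map_add, map_sum, map_smul, smul_eq_mul, hq, hy, hs, partialQ_eq hL h, partialY_eq hL h,
    partialS_eq hL h]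

variable (D) in
lemma mdifferentiableAt_chart_apply {q : Q} (h : q ∈ D.U) (i : Fin n) :
    MDifferentiableAt (𝓡 n) 𝓘(ℝ, ℝ) (fun q => D.chart q i) q := by
  let pr : EuclideanSpace ℝ (Fin n) →L[ℝ] ℝ := EuclideanSpace.proj i
  exact ((pr.contDiff.contMDiff.contMDiffAt (n := ∞)).comp q
    (D.contMDiffAt_chart h)).mdifferentiableAt (by simp)

lemma mvfderiv_qCoord (Z : ProlSection A) {p : ExtPhase m E} (h : p.1.proj ∈ D.U) (i : Fin n) :
    mvfderiv (extModel n m) (D.qCoord i) p (Z.vec p) =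
      mvfderiv (𝓡 n) (fun q => D.chart q i) p.1.proj (A.anchor p.1.proj (Z.base p)) := by
  rw [Z.anchor_base]
  exact mvfderiv_comp_apply (f := (proj : ExtPhase m E → Q)) p (D.mdifferentiableAt_chart_apply h i)
    (contMDiff_proj_ext.mdifferentiable (by simp) p) (Z.vec p)

lemma partialS_eq_sVector (hL : ContMDiff (extModel n m) 𝓘(ℝ, ℝ) ∞ L) {p : ExtPhase m E}
    (h : p.1.proj ∈ D.U) : D.partialS L p = mvfderiv (extModel n m) L p (sVector p) := by
  have hq : ∀ i, mvfderiv (extModel n m) (D.qCoord i) p (sVector p) = 0 := fun i => by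
    refine (mvfderiv_comp_apply (f := (proj : ExtPhase m E → Q)) p (D.mdifferentiableAt_chart_apply h i)
      (contMDiff_proj_ext.mdifferentiable (by simp) p) (sVector p)).trans ?_
    exact (congrArg _ (mfderiv_proj_sVector p)).trans (map_zero _)
  rw [mvfderiv_eq_sum_partial hL h]
  simp only [hq, mvfderiv_yCoord_sVector h, mvfderiv_snd_sVector]
  simp

/-- Varying y^α with q and s fixed traces the vertical curve in the direction σ_α, so both sides
differentiate the same function of t. -/
lemma Extends.partialY_eq_momentum (hL : ContMDiff (extModel n m) 𝓘(ℝ, ℝ) ∞ L) {p : ExtPhase m E}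
    (h : D.Extends σ p.1.proj) (α : Fin m) : D.partialY L α p = momentum L (σ α) p := by
  have h1 : momentum L (σ α) p = deriv (fun t => L (vertCurve p (σ α p.1.proj) t)) 0 :=
    mvfderiv_vertVector (hL.mdifferentiable (by simp) p) _
  rw [h1, partialY]
  congr 1
  funext t
  congr 1
  have h2 := D.point_coord (p := vertCurve p (σ α p.1.proj) t) h.1
  rw [← h2]
  refine congrArg (fun y => D.point (D.chart p.1.proj) y p.2) ?_
  funext β
  change D.isFrame.coeff β p.1.proj p.1.snd + t * (Pi.single α 1 : Fin m → ℝ) β =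
    D.isFrame.coeff β p.1.proj (p.1.snd + t • σ α p.1.proj)
  rw [map_add, map_smul, h.coeff_apply, smul_eq_mul, Pi.single_apply]

end LocalData

end Coordinates

/-! ### The Herglotz equations along integral curves. -/

section Herglotz

variable {A : LieAlgebroid n m E} {L : ExtPhase m E → ℝ} {D : LocalData n m E}
  {σ : Fin m → Sec n m E} {C : Fin m → Fin m → Fin m → Q → ℝ}

lemma LocalData.IsStructureFunctions.momentum_bracket (hC : D.IsStructureFunctions A C)
    (hL : ContMDiff (extModel n m) 𝓘(ℝ, ℝ) ∞ L) {p : ExtPhase m E}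
    (h : D.Extends σ p.1.proj) (α β : Fin m) :
    momentum L (A.bracket (σ α) (σ β)) p =
      ∑ γ, C γ α β p.1.proj * D.partialY L γ p := by
  have hσ : ∀ γ, ∀ᶠ q' in 𝓝 p.1.proj, σ γ q' = D.frame γ q' := fun γ => h.2.mono fun _ h' => h' γ
  have h1 : A.bracket (σ α) (σ β) p.1.proj = ∑ γ, C γ α β p.1.proj • σ γ p.1.proj := by
    rw [hC _ h.1 α β (σ α) (σ β) (hσ α) (hσ β)]
    exact Finset.sum_congr rfl fun γ _ => by rw [(hσ γ).self_of_nhds]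
  simp only [LocalData.Extends.partialY_eq_momentum hL h]
  refine (congrArg (fibDeriv L p) h1).trans ?_
  simp only [map_sum, map_smul, smul_eq_mul]
  rfl

/-- The derivatives of the momenta along the Lagrangian section. -/
lemma LocalData.Extends.mvfderiv_momentum_lagrangian
    (hL : ContMDiff (extModel n m) 𝓘(ℝ, ℝ) ∞ L) (hC : D.IsStructureFunctions A C)
    {p : ExtPhase m E} (h : D.Extends σ p.1.proj) {Γ : ProlSection A}
    (hb : Γ.base p = p.1.snd)
    (hΓ : ∀ w', omega A L p (Γ.val p) w' = dFun A (energy A L) p w' +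
      mvfderiv (extModel n m) L p (sVector p) * etaL A L p w') (α : Fin m) :
    mvfderiv (extModel n m) (momentum L (σ α)) p (Γ.vec p) =
      ∑ i, D.anchorCoeff A i α p.1.proj * D.partialQ L i p -
        ∑ β, ∑ γ, D.yCoord β p * C γ α β p.1.proj * D.partialY L γ p +
        D.partialY L α p * D.partialS L p := by
  obtain ⟨G, hGs, hGb⟩ := exists_lift A p.1.proj (σ α)
  have hGb' : prolBase A p (G.val p) = σ α p.1.proj := hGb.self_of_nhds p.1.snd p.2
  -- On a lift of σ_α the sum of the dP_β(Γ) collapses to dP_α(Γ), for which the equation is then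
  -- solved.
  have h1 := (h.omega_of_base_eq hL hb (G.val p)).symm.trans (hΓ (G.val p))
  have h2 : dFun A (energy A L) p (G.val p) = _ := h.mvfderiv_energy hL (G.vec p)
  have h3 : etaL A L p (G.val p) = - momentum L (σ α) p := by
    rw [etaL_apply, hGb']
    refine (congrArg (· - fibDeriv L p (σ α p.1.proj)) (hGs p)).trans (zero_sub _)
  have h4 := LocalData.mvfderiv_eq_sum_partial hL h.1 (G.vec p)
  have hq : ∀ i, mvfderiv (extModel n m) (D.qCoord i) p (G.vec p) =
      D.anchorCoeff A i α p.1.proj := fun i => by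
    rw [LocalData.mvfderiv_qCoord G h.1]
    have : G.base p = D.frame α p.1.proj := hGb'.trans (h.2.self_of_nhds α)
    rw [this]
    rfl
  -- The form contains [σ_β, σ_α] and the Herglotz equation C^γ_{αβ}; skew symmetry gives the minus
  -- sign.
  have h5 : ∀ β, momentum L (A.bracket (σ β) (σ α)) p =
      - ∑ γ, C γ α β p.1.proj * D.partialY L γ p := fun β => by
    rw [← hC.momentum_bracket hL h α β]
    exact (congrArg (fibDeriv L p) (A.bracket_apply_skew (σ β) (σ α) p.1.proj)).trans (map_neg _ _)
  have h6 : ∑ β, D.yCoord β p * momentum L (A.bracket (σ β) (σ α)) p =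
      - ∑ β, ∑ γ, D.yCoord β p * C γ α β p.1.proj * D.partialY L γ p := by
    simp only [h5, mul_neg, Finset.sum_neg_distrib, Finset.mul_sum, mul_assoc]
  simp only [h.compAt_eq hGb', mul_ite, mul_one, mul_zero, Finset.sum_ite_eq', Finset.mem_univ,
    if_true] at h1
  rw [h6, h2, h3] at h1
  rw [hGs p] at h4
  simp only [hq] at h4
  -- The terms dy^β(G) P_β in dL(G) cancel those from differentiating y^β in the energy, so of dL(G)
  -- only its q-part remains: the lift annihilates ds.
  rw [h4, Finset.sum_add_distrib] at h1
  simp only [LocalData.Extends.partialY_eq_momentum hL h,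
    LocalData.partialS_eq_sVector hL h.1] at h1 ⊢
  have h7 : ∀ β, LocalData.dMomAt A L σ p β (G.val p) =
    mvfderiv (extModel n m) (momentum L (σ β)) p (G.vec p) := fun _ => rfl
  have h8 : LocalData.dMomAt A L σ p α (Γ.val p) =
    mvfderiv (extModel n m) (momentum L (σ α)) p (Γ.vec p) := rfl
  simp only [h7, h8] at h1
  linarith

lemma LocalData.mvfderiv_qCoord_of_base_eq {p : ExtPhase m E} (h : p.1.proj ∈ D.U)
    {Γ : ProlSection A} (hb : Γ.base p = p.1.snd) (i : Fin n) :
    mvfderiv (extModel n m) (D.qCoord i) p (Γ.vec p) =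
      ∑ α, D.yCoord α p * D.anchorCoeff A i α p.1.proj := by
  rw [LocalData.mvfderiv_qCoord Γ h, hb]
  conv_lhs => rw [D.eq_sum_coeff h p.1.snd]
  simp only [map_sum, map_smul]
  rfl

/-- The derivative of a function along an integral curve. -/
lemma IsMIntegralCurveOn.hasDerivWithinAt {v : ∀ p : ExtPhase m E, TangentSpace (extModel n m) p}
    {c : ℝ → ExtPhase m E} {I : Set ℝ} (hc : IsMIntegralCurveOn (I := extModel n m) c v I) {t : ℝ}
    (ht : t ∈ I) {f : ExtPhase m E → ℝ}
    (hf : MDifferentiableAt (extModel n m) 𝓘(ℝ, ℝ) f (c t)) :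
    HasDerivWithinAt (fun t' => f (c t')) (mvfderiv (extModel n m) f (c t) (v (c t))) I t := by
  have key : ∀ {g : ℝ → ℝ} {T : ℝ →L[ℝ] ℝ} {a : ℝ}, HasFDerivWithinAt g T I t → T 1 = a →
      HasDerivWithinAt g a I t := fun h ha => ha ▸ h.hasDerivWithinAt
  refine key (hf.hasMFDerivAt.comp_hasMFDerivWithinAt t (hc t ht)).hasFDerivWithinAt ?_
  change mfderiv (extModel n m) 𝓘(ℝ, ℝ) f (c t) ((1 : ℝ) • v (c t)) = _
  rw [one_smul]
  rfl

/-- The chain rule along the curve is applied to the momenta, the q^i and s, whose derivatives along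
Γ are known. -/
theorem LocalData.satisfiesHerglotz (hL : ContMDiff (extModel n m) 𝓘(ℝ, ℝ) ∞ L)
    (hC : D.IsStructureFunctions A C) {Γ : ProlSection A}
    (hb : ∀ p, Γ.base p = p.1.snd)
    (hs : ∀ p, mvfderiv (extModel n m) (Prod.snd : ExtPhase m E → ℝ) p (Γ.vec p) = L p)
    (hΓ : ∀ p w', omega A L p (Γ.val p) w' = dFun A (energy A L) p w' +
      mvfderiv (extModel n m) L p (sVector p) * etaL A L p w')
    {c : ℝ → ExtPhase m E} {I : Set ℝ}
    (hc : IsMIntegralCurveOn (I := extModel n m) c Γ.vec I) : D.SatisfiesHerglotz A C L c I := by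
  intro t ht hU
  obtain ⟨σ, hσ⟩ := D.exists_extend hU
  have h : D.Extends σ (c t).1.proj := ⟨hU, hσ⟩
  refine ⟨fun α => ?_, fun i => ?_, ?_⟩
  · have h1 := IsMIntegralCurveOn.hasDerivWithinAt hc ht (mdifferentiableAt_momentum hL (σ α) (c t))
    rw [h.mvfderiv_momentum_lagrangian hL hC (hb _) (hΓ _)] at h1
    refine h1.congr_of_eventuallyEq ?_ (h.partialY_eq_momentum hL α)
    -- The global sections agree with the frame only near the base point of c(t). By continuity the
    -- curve stays there for times in `I` close to `t`, which suffices for a derivative within `I`.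
    exact ((hc t ht).continuousWithinAt.eventually h.eventually_ext).mono
      fun t' ht' => ht'.partialY_eq_momentum hL α
  · rw [← LocalData.mvfderiv_qCoord_of_base_eq hU (hb _)]
    exact IsMIntegralCurveOn.hasDerivWithinAt hc ht
      ((D.mdifferentiableAt_chart_apply hU i).comp (c t)
        (contMDiff_proj_ext.mdifferentiable (by simp) (c t)))
  · rw [← hs]
    exact IsMIntegralCurveOn.hasDerivWithinAt hc ht mdifferentiableAt_snd

end Herglotz

/-! ### Reduction of the defining equations to the fibres, and uniqueness. -/

section Characterization

variable {A : LieAlgebroid n m E} {L : ExtPhase m E → ℝ}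

lemma prolSection_eq_of_omega (hL : ContMDiff (extModel n m) 𝓘(ℝ, ℝ) ∞ L) (hreg : IsRegular L)
    {Z W : ProlSection A} (h : ∀ p w', omega A L p (Z.val p) w' = omega A L p (W.val p) w')
    (hη : ∀ p, etaL A L p (Z.val p) = etaL A L p (W.val p)) : Z = W := by
  refine ProlSection.ext fun p => sub_eq_zero.mp (eq_zero_of_omega_eq_zero hL hreg (fun w' => ?_) ?_)
  · rw [map_sub, LinearMap.sub_apply, h, sub_self]
  · rw [map_sub, hη, sub_self]

/-- `dForm` at `p` depends only on values at `p`, and these exhaust the fibre; an equation tested on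
all sections is thus one on each fibre. -/
lemma dForm_etaL_eq_iff (hL : ContMDiff (extModel n m) 𝓘(ℝ, ℝ) ∞ L) {Z : ProlSection A}
    {Φ : OneSection A} :
    (∀ (W : ProlSection A) (p : ExtPhase m E), dForm (etaL A L) Z W p = Φ p (W.val p)) ↔
      ∀ p w', omega A L p (Z.val p) w' = Φ p w' := by
  refine ⟨fun h p w' => ?_, fun h W p => (dForm_etaL_eq_omega hL Z W p).trans (h p _)⟩
  obtain ⟨W, rfl⟩ := exists_prolSection_eq p w'
  rw [← dForm_etaL_eq_omega hL, h]

lemma isReeb_etaL_iff (hL : ContMDiff (extModel n m) 𝓘(ℝ, ℝ) ∞ L) {R : ProlSection A} :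
    IsReeb (etaL A L) R ↔ (∀ p w', omega A L p (R.val p) w' = 0) ∧
      ∀ p, etaL A L p (R.val p) = 1 :=
  and_congr_left fun _ => dForm_etaL_eq_iff (Φ := fun _ => 0) hL

/-- The hypothesis on `R` eliminates the Reeb section: -ρ^π(R)(E_L) η_L becomes (∂L/∂s) η_L, the
form in which Γ was constructed. -/
lemma isLagrangianSection_iff (hL : ContMDiff (extModel n m) 𝓘(ℝ, ℝ) ∞ L) {R Γ : ProlSection A}
    (hR : ∀ p, dFun A (energy A L) p (R.val p) = - mvfderiv (extModel n m) L p (sVector p)) :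
    IsLagrangianSection L R Γ ↔ (∀ p, etaL A L p (Γ.val p) = - energy A L p) ∧
      ∀ p w', omega A L p (Γ.val p) w' = dFun A (energy A L) p w' +
        mvfderiv (extModel n m) L p (sVector p) * etaL A L p w' := by
  refine and_congr_right fun _ => ?_
  simp only [hR, neg_mul, sub_neg_eq_add]
  exact dForm_etaL_eq_iff (Φ := fun p => dFun A (energy A L) p +
    mvfderiv (extModel n m) L p (sVector p) • etaL A L p) hL

lemma etaL_eq_neg_energy {Γ : ProlSection A} {p : ExtPhase m E} (hb : Γ.base p = p.1.snd)
    (hs : mvfderiv (extModel n m) (Prod.snd : ExtPhase m E → ℝ) p (Γ.vec p) = L p) :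
    etaL A L p (Γ.val p) = - energy A L p := by
  rw [etaL_apply, energy_apply, neg_sub]
  exact congrArg₂ (· - ·) hs (congrArg (fibDeriv L p) hb)

lemma isSODE_of_base_eq {Γ : ProlSection A} (hb : ∀ p, Γ.base p = p.1.snd) : IsSODE Γ :=
  fun p => congrArg (vertLift A p) (hb p)

end Characterization

end HerglotzAlgebroid

end

theorem mainTheorem1 {n m : ℕ}
    {Q : Type*} [TopologicalSpace Q] [T2Space Q] [ChartedSpace (EuclideanSpace ℝ (Fin n)) Q]
    [IsManifold (𝓡 n) ∞ Q]
    {E : Q → Type*} [TopologicalSpace (Bundle.TotalSpace (EuclideanSpace ℝ (Fin m)) E)]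
    [∀ q, TopologicalSpace (E q)] [∀ q, AddCommGroup (E q)] [∀ q, Module ℝ (E q)]
    [FiberBundle (EuclideanSpace ℝ (Fin m)) E] [VectorBundle ℝ (EuclideanSpace ℝ (Fin m)) E]
    [ContMDiffVectorBundle ∞ (EuclideanSpace ℝ (Fin m)) E (𝓡 n)]
    (A : HerglotzAlgebroid.LieAlgebroid n m E)
    (L : HerglotzAlgebroid.ExtPhase m E → ℝ)
    (hL : ContMDiff (HerglotzAlgebroid.extModel n m) 𝓘(ℝ, ℝ) ∞ L)
    (hreg : HerglotzAlgebroid.IsRegular L) :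
    HerglotzAlgebroid.IsContactSection A m (HerglotzAlgebroid.etaL A L) ∧
    ∃ R : HerglotzAlgebroid.ProlSection A,
      (∀ R' : HerglotzAlgebroid.ProlSection A,
        HerglotzAlgebroid.IsReeb (HerglotzAlgebroid.etaL A L) R' ↔ R' = R) ∧
      ∃ Γ : HerglotzAlgebroid.ProlSection A,
        (∀ Γ' : HerglotzAlgebroid.ProlSection A,
          HerglotzAlgebroid.IsLagrangianSection L R Γ' ↔ Γ' = Γ) ∧
        HerglotzAlgebroid.IsSODE Γ ∧
        ∀ (D : HerglotzAlgebroid.LocalData n m E) (C : Fin m → Fin m → Fin m → Q → ℝ),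
          D.IsStructureFunctions A C →
          ∀ (c : ℝ → HerglotzAlgebroid.ExtPhase m E) (I : Set ℝ),
            IsMIntegralCurveOn (I := HerglotzAlgebroid.extModel n m) c Γ.vec I →
            D.SatisfiesHerglotz A C L c I := by
  obtain ⟨R, hR, hR1, hRE⟩ := HerglotzAlgebroid.exists_reeb (A := A) hL hreg
  obtain ⟨Γ, hb, hs, hΓ⟩ := HerglotzAlgebroid.exists_lagrangian (A := A) hL hreg
  have hη := fun p => HerglotzAlgebroid.etaL_eq_neg_energy (hb p) (hs p)
  refine ⟨HerglotzAlgebroid.isContactSection_etaL hL hreg, R, fun R' => ?_, Γ, fun Γ' => ?_,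
    HerglotzAlgebroid.isSODE_of_base_eq hb,
    fun D C hC c I hc => HerglotzAlgebroid.LocalData.satisfiesHerglotz hL hC hb hs hΓ hc⟩
  · rw [HerglotzAlgebroid.isReeb_etaL_iff hL]
    refine ⟨fun h => ?_, fun h => h ▸ ⟨hR, hR1⟩⟩
    exact HerglotzAlgebroid.prolSection_eq_of_omega hL hreg
      (fun p w' => (h.1 p w').trans (hR p w').symm) fun p => (h.2 p).trans (hR1 p).symm
  · rw [HerglotzAlgebroid.isLagrangianSection_iff hL hRE]
    refine ⟨fun h => ?_, fun h => h ▸ ⟨hη, hΓ⟩⟩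
    exact HerglotzAlgebroid.prolSection_eq_of_omega hL hreg
      (fun p w' => (h.2 p w').trans (hΓ p w').symm) fun p => (h.1 p).trans (hη p).symm
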